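/- Let $M$ be a smooth $n$-dimensional manifold with an affine connection $\nabla$, let $c<s$, and let $x(t)$ be a curve in $M$ that is smooth on a neighbourhood of $[c,s]$. Let $\alpha\in\mathbb R$ and let $A$ be a tensor field of type $(p,q)$ along the curve. For $\beta\in\mathbb R$ let $\frac{d^{\beta}f}{ds^{\beta}}=\frac{d^{m}}{ds^{m}}I^{m-\beta}f$, $m=\max(0,\lceil\beta\rceil)$, be the Riemann–Liouville fractional derivative with lower terminal $c$, where $I^0f=f$ and $I^{\nu}f(s)=\frac1{\Gamma(\nu)}\int_c^s(s-t)^{\nu-1}f(t)\,dt$ for $\nu>0$. It is *defined* at $s$ if the integral exists and, when $m>0$, $I^{m-\beta}f$ exists and is $C^m$ near $s$. In a coordinate system $(x^i)$ around the arc, with $\nabla_{\partial_l}\partial_j=\Gamma^i_{jl}\partial_i$, put $P^{i<0>}_j=Q^{i<0>}_j=\delta^i_j$, $P^{i<1>}_j=-Q^{i<1>}_j=\Gamma^i_{jl}\frac{dx^l}{ds}$ and, for $k\ge0$, $$P^{i<k+1>}_j=\frac{dP^{i<k>}_j}{ds}+P^{l<k>}_jP^{i<1>}_l,\qquad Q^{i<k+1>}_j=\frac{dQ^{i<k>}_j}{ds}+Q^{i<k>}_lQ^{l<1>}_j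 .$$ The fractional covariant derivative along the curve is given in these coordinates by $$\nabla^{\alpha}A^{j_1\cdots j_p}_{i_1\cdots i_q}=\sum_{a=0}^{\infty}\ \sum_{m_1+\cdots+m_p+l_1+\cdots+l_q=a}P^{j_1<m_1>}_{u_1}\cdots P^{j_p<m_p>}_{u_p}\,Q^{v_1<l_1>}_{i_1}\cdots Q^{v_q<l_q>}_{i_q}\,\frac{d^{\alpha-a}A^{u_1\cdots u_p}_{v_1\cdots v_q}}{ds^{\alpha-a}}\,\frac{\alpha(\alpha-1)\cdots(\alpha-a+1)}{m_1!\cdots m_p!\,l_1!\cdots l_q!},$$ with summation over repeated indices, $m_k,l_k\in\{0,1,2,\dots\}$, and the outer sum being the limit of its partial sums. Call a smooth coordinate system *admissible* if its domain contains the arc $x([c,s])$; the functions $t\mapsto P^{i<1>}_j(t)$ are smooth near $s$ and, if $\alpha\notin\{0,1,2,\dots\}$, real analytic on a neighbourhood of $[c,s]$; the fractional derivatives of order $\alpha$ of the components of $A$ are defined at $s$; and the series for all the components of $\nabla^\alpha A$ at $s$ converge. Then $\nabla^\alpha$ maps tensors of type $(p,q)$ to tensors of type $(p,q)$: for any two admissible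 coordinate systems $(x^i)$ and $(x'^i)$, at the point $x(s)$, $$\nabla^{\alpha}A^{j_1\cdots j_p}_{i_1\cdots i_q}=\frac{\partial x^{j_1}}{\partial x'^{r_1}}\cdots\frac{\partial x^{j_p}}{\partial x'^{r_p}}\,\frac{\partial x'^{a_1}}{\partial x^{i_1}}\cdots\frac{\partial x'^{a_q}}{\partial x^{i_q}}\,\nabla^{\alpha}A'^{r_1\cdots r_p}_{a_1\cdots a_q},$$ and there is a tensor $B$ of type $(p,q)$ at $x(s)$ whose components in every admissible coordinate system are those of $\nabla^\alpha A$. -/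

import Mathlib

open scoped Manifold ContDiff Topology
open Filter Set

noncomputable section

namespace FracCov

/-! ### Ordinary (Riemann-Liouville) fractional derivatives with lower terminal `c` -/

/-- The Riemann-Liouville integral of order `ν ≥ 0` with lower terminal `c`; order `0` is the
identity. -/
def fracInt (c ν : ℝ) (f : ℝ → ℝ) (s : ℝ) : ℝ :=
  if ν = 0 then f s else (Real.Gamma ν)⁻¹ * ∫ t in c..s, (s - t) ^ (ν - 1) * f t

/-- The derivative `d^β f / ds^β` of arbitrary real order `β`: with `m = ⌈β⌉₊`, it is the `m`-th
derivative of the integral of order `m - β ≥ 0`. So it is the integral of order `-β` for `β ≤ 0`,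
and the usual iterated derivative if `β` is a natural number. -/
def fracDeriv (c β : ℝ) (f : ℝ → ℝ) (s : ℝ) : ℝ :=
  iteratedDeriv ⌈β⌉₊ (fracInt c (⌈β⌉₊ - β) f) s

/-- The integral defining `fracInt c ν f s` exists. -/
def FracIntExists (c ν : ℝ) (f : ℝ → ℝ) (s : ℝ) : Prop :=
  ν = 0 ∨ IntervalIntegrable (fun t => (s - t) ^ (ν - 1) * f t) MeasureTheory.volume c s

/-- `d^β f / ds^β` is defined at `s`: the integral of order `m - β`, `m = ⌈β⌉₊`, exists and, if
`m > 0`, it exists near `s` and is `m` times continuously differentiable there. -/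
def FracDerivExists (c β : ℝ) (f : ℝ → ℝ) (s : ℝ) : Prop :=
  FracIntExists c (⌈β⌉₊ - β) f s ∧
    (0 < ⌈β⌉₊ → (∀ᶠ τ in 𝓝 s, FracIntExists c (⌈β⌉₊ - β) f τ) ∧
      ContDiffAt ℝ ⌈β⌉₊ (fracInt c (⌈β⌉₊ - β) f) s)

/-! ### The symbols `P` and `Q` -/

/-- `symbP G k s i j` is `P^{i<k>}_j` at `s`, where `G s i j` is `P^{i<1>}_j`. -/
def symbP {n : ℕ} (G : ℝ → Fin n → Fin n → ℝ) : ℕ → ℝ → Fin n → Fin n → ℝ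
  | 0 => fun _ i j => if i = j then 1 else 0
  | k + 1 => fun s i j =>
      deriv (fun τ => symbP G k τ i j) s + ∑ l, symbP G k s l j * G s i l

/-- `symbQ G k s i j` is `Q^{i<k>}_j` at `s`, where `-G s i j` is `Q^{i<1>}_j`. -/
def symbQ {n : ℕ} (G : ℝ → Fin n → Fin n → ℝ) : ℕ → ℝ → Fin n → Fin n → ℝ
  | 0 => fun _ i j => if i = j then 1 else 0
  | k + 1 => fun s i j =>
      deriv (fun τ => symbQ G k τ i j) s + ∑ l, symbQ G k s i l * (-G s l j)

/-! ### The series for the fractional covariant derivative -/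

/-- The term with index `a` of the series for `∇^α A^{j₁⋯j_p}_{i₁⋯i_q}` at `s`, for given
components `A t u v = A^{u₁⋯u_p}_{v₁⋯v_q}` along the curve. The index `w` collects
`m₁,…,m_p,l₁,…,l_q`, with `∑ m + ∑ l = a`. -/
def nablaTerm {n p q : ℕ} (c α : ℝ) (G : ℝ → Fin n → Fin n → ℝ)
    (A : ℝ → (Fin p → Fin n) → (Fin q → Fin n) → ℝ) (s : ℝ)
    (j : Fin p → Fin n) (i : Fin q → Fin n) (a : ℕ) : ℝ :=
  ∑ w ∈ Finset.piAntidiag (Finset.univ : Finset (Fin p ⊕ Fin q)) a,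
    ∑ u : Fin p → Fin n, ∑ v : Fin q → Fin n,
      (∏ k, symbP G (w (Sum.inl k)) s (j k) (u k)) *
      (∏ k, symbQ G (w (Sum.inr k)) s (v k) (i k)) *
      fracDeriv c (α - a) (fun t => A t u v) s *
      ((∏ r ∈ Finset.range a, (α - r)) / ∏ k, ((w k).factorial : ℝ))

/-- `∇^α A^{j₁⋯j_p}_{i₁⋯i_q}` at `s`: the limit of the partial sums over `a = 0, …, N`. -/
def nablaFrac {n p q : ℕ} (c α : ℝ) (G : ℝ → Fin n → Fin n → ℝ)
    (A : ℝ → (Fin p → Fin n) → (Fin q → Fin n) → ℝ) (s : ℝ)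
    (j : Fin p → Fin n) (i : Fin q → Fin n) : ℝ :=
  ∑'[SummationFilter.conditional ℕ] a, nablaTerm c α G A s j i a

/-! ### Coordinates on a manifold with an affine connection -/

/-- The standard basis vector of `ℝⁿ`. -/
abbrev stdVec (n : ℕ) (j : Fin n) : EuclideanSpace ℝ (Fin n) := EuclideanSpace.single j 1

section Manifold

variable {n : ℕ} {M : Type*} [TopologicalSpace M] [ChartedSpace (EuclideanSpace ℝ (Fin n)) M]

/-- The coordinate vector field `∂/∂x^j` of the chart `e` (meaningful on its domain). -/
def coordVec (e : OpenPartialHomeomorph M (EuclideanSpace ℝ (Fin n))) (j : Fin n) (x : M) :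
    TangentSpace (𝓡 n) x :=
  VectorField.mpullback (𝓡 n) (𝓡 n) e (fun _ => stdVec n j) x

/-- The coordinate covector field `dx^i` of the chart `e` (meaningful on its domain). -/
def coordCovec (e : OpenPartialHomeomorph M (EuclideanSpace ℝ (Fin n))) (i : Fin n) (x : M) :
    TangentSpace (𝓡 n) x →L[ℝ] ℝ :=
  (EuclideanSpace.proj i : EuclideanSpace ℝ (Fin n) →L[ℝ] ℝ).comp
    (mfderiv (𝓡 n) (𝓡 n) e x : TangentSpace (𝓡 n) x →L[ℝ] EuclideanSpace ℝ (Fin n))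

/-- The partial derivative `∂x^j/∂x'^r` at the point `x`, where `x^1,…,x^n` are the coordinates
of `e` and `x'^1,…,x'^n` those of `e'`. -/
def partialCoord (e e' : OpenPartialHomeomorph M (EuclideanSpace ℝ (Fin n))) (x : M)
    (j r : Fin n) : ℝ :=
  fderiv ℝ (fun y => e (e'.symm y)) (e' x) (stdVec n r) j

variable [IsManifold (𝓡 n) ∞ M]

/-- The Christoffel symbol `Γ^i_{jl}` in the chart `e`: the `i`-th component of
`∇_{∂_l} ∂_j`. (In `cov σ x v` the section `σ` is differentiated in the direction `v`.) -/
def christoffel (cov : CovariantDerivative (𝓡 n) (EuclideanSpace ℝ (Fin n))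
      (TangentSpace (𝓡 n) : M → Type _))
    (e : OpenPartialHomeomorph M (EuclideanSpace ℝ (Fin n))) (x : M) (i j l : Fin n) : ℝ :=
  coordCovec e i x (cov (coordVec e j) x (coordVec e l x))

/-- `P^{i<1>}_j = Γ^i_{jl} dx^l/ds` along the curve `γ`, in the chart `e`. -/
def connAlong (cov : CovariantDerivative (𝓡 n) (EuclideanSpace ℝ (Fin n))
      (TangentSpace (𝓡 n) : M → Type _))
    (γ : ℝ → M) (e : OpenPartialHomeomorph M (EuclideanSpace ℝ (Fin n)))
    (s : ℝ) (i j : Fin n) : ℝ :=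
  ∑ l, christoffel cov e (γ s) i j l * deriv (fun τ => e (γ τ) l) s

/-- Tensors of type `(p,q)` at the point `x`: functions of `p` covectors and `q` vectors, linear
in each of them. -/
abbrev TensorAt (n : ℕ) {M : Type*} [TopologicalSpace M]
    [ChartedSpace (EuclideanSpace ℝ (Fin n)) M] (p q : ℕ) (x : M) : Type :=
  MultilinearMap ℝ (fun _ : Fin p => (TangentSpace (𝓡 n) x →L[ℝ] ℝ))
    (MultilinearMap ℝ (fun _ : Fin q => TangentSpace (𝓡 n) x) ℝ)

/-- The component `T^{j₁⋯j_p}_{i₁⋯i_q}` of a tensor in the chart `e`. -/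
def tensorComp {p q : ℕ} (e : OpenPartialHomeomorph M (EuclideanSpace ℝ (Fin n))) {x : M}
    (T : TensorAt n p q x) (j : Fin p → Fin n) (i : Fin q → Fin n) : ℝ :=
  T (fun k => coordCovec e (j k) x) (fun k => coordVec e (i k) x)

/-- `∇^α A^{j₁⋯j_p}_{i₁⋯i_q}` at the parameter value `s`, computed in the chart `e`. -/
def nablaChart {p q : ℕ} (cov : CovariantDerivative (𝓡 n) (EuclideanSpace ℝ (Fin n))
      (TangentSpace (𝓡 n) : M → Type _))
    (γ : ℝ → M) (A : ∀ t : ℝ, TensorAt n p q (γ t)) (c α s : ℝ)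
    (e : OpenPartialHomeomorph M (EuclideanSpace ℝ (Fin n)))
    (j : Fin p → Fin n) (i : Fin q → Fin n) : ℝ :=
  nablaFrac c α (connAlong cov γ e) (fun t => tensorComp e (A t)) s j i

/-- `e` is a coordinate system of the smooth manifold `M` in which `∇^α A` makes sense at `s`. -/
structure IsAdmissible {p q : ℕ} (cov : CovariantDerivative (𝓡 n) (EuclideanSpace ℝ (Fin n))
      (TangentSpace (𝓡 n) : M → Type _))
    (γ : ℝ → M) (A : ∀ t : ℝ, TensorAt n p q (γ t)) (c α s : ℝ)
    (e : OpenPartialHomeomorph M (EuclideanSpace ℝ (Fin n))) : Prop where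
  /-- `e` is a smooth chart. -/
  mem_atlas : e ∈ IsManifold.maximalAtlas (𝓡 n) ∞ M
  /-- The arc on which the fractional derivatives depend lies in the domain of the chart. -/
  arc_mem : ∀ t ∈ Icc c s, γ t ∈ e.source
  /-- `Γ^i_{jl} dx^l/ds` is smooth near `s`, so that all the symbols `P` and `Q` exist. -/
  conn_smooth : ∀ i j, ContDiffAt ℝ ∞ (fun t => connAlong cov γ e t i j) s
  /-- If the order is fractional, `Γ^i_{jl} dx^l/ds` is real analytic along the arc. -/
  conn_analytic : (∀ k : ℕ, α ≠ k) →
    ∀ i j, AnalyticOnNhd ℝ (fun t => connAlong cov γ e t i j) (Icc c s)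
  /-- The ordinary fractional derivatives of the components are defined. -/
  fracDeriv_exists : ∀ u v, FracDerivExists c α (fun t => tensorComp e (A t) u v) s
  /-- The series for the components of `∇^α A` converge. -/
  series_converges : ∀ j i, Summable
    (nablaTerm c α (connAlong cov γ e) (fun t => tensorComp e (A t)) s j i)
    (SummationFilter.conditional ℕ)

end Manifold

end FracCov

end

/-! Write `G` for the matrix P^{<1>} along the curve, and let Φ, Ψ solve Φ̇ = ΦG, Ψ̇ = -GΨ with
value 1 at `s`; then Ψ = Φ⁻¹. The recursions for P and Q say exactly that the k-th derivatives of Φ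
and Ψ at `s` are P^{<k>} and Q^{<k>} (`IsFrame.iteratedDeriv_left`, `IsFrame.iteratedDeriv_right`).
Hence the series for ∇^α A is the formal Leibniz series, at `s`, of d^α applied to the components of
A in the frame that is parallel along the curve and equals the coordinate frame at `s`
(`IsFrame.nablaTerm_eq`). In another chart the transition matrix L satisfies L̇ = LG' - GL, so ΦLΨ'
is constant: the two parallel frames differ by the constant matrix L(s) (`IsFrame.mul_mul_eq`). The
difference of the two sides of the transformation law is therefore one convergent Leibniz series for
d^α(Σ F_u g_u) with Σ F_u g_u = 0, and it must be shown that its sum is 0 (`eq_zero_of_tendsto`).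

If α is a natural number, the series is finite and this is the ordinary Leibniz rule. Otherwise the
difficulty is that the Taylor series of the F_u at `s` may diverge on part of `[c, s]`, although the
Leibniz series converges. Two facts settle this.

(1) The sum is the finite Leibniz sum of K terms plus the integral of the Taylor remainder
(`eq_sum_leibnizSum_of_tendsto`). Up to a factor, the tail is a series of moments Σ p_k ∫ x^k h(x)
dx, to be identified with ∫ f h for a function f with Taylor coefficients p_k, holomorphic near the
interval. A regular summation method is used: f(x·φ(z)), with φ the generating function of a
logarithmic distribution, is holomorphic in a disc of radius greater than 1, because φ maps it into
a thin neighbourhood of [0, 1]. Re-expanding in z and putting z = 1, where φ(1) = 1, sums the Taylor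
series to f boundedly on the interval, and dominated convergence applies. The method leaves the sum
of a convergent series unchanged, as its weights decrease in k from 1 to 0 and each tends to 1.

(2) The Leibniz sum with remainder is 0 (`sum_leibnizSum_eq_zero`). At a negative order it is the
fractional integral of Σ F_u g_u, and differentiating it in the end point raises the order by one
(`hasDerivAt_leibnizSum`). -/

noncomputable section

namespace FracCov

/-! ### Coordinate frames and the transformation law of the connection -/

section Charts

variable {n : ℕ} {M : Type*} [TopologicalSpace M] [ChartedSpace (EuclideanSpace ℝ (Fin n)) M]

/-- The differential of the chart `e` at `x`, with values in `ℝⁿ`. -/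
def chartDeriv (e : OpenPartialHomeomorph M (EuclideanSpace ℝ (Fin n))) (x : M) :
    TangentSpace (𝓡 n) x →L[ℝ] EuclideanSpace ℝ (Fin n) :=
  mfderiv (𝓡 n) (𝓡 n) e x

theorem mdifferentiable_of_mem_maximalAtlas
    {e : OpenPartialHomeomorph M (EuclideanSpace ℝ (Fin n))}
    (he : e ∈ IsManifold.maximalAtlas (𝓡 n) ∞ M) : e.MDifferentiable (𝓡 n) (𝓡 n) :=
  ⟨(contMDiffOn_of_mem_maximalAtlas he).mdifferentiableOn (by simp),
    (contMDiffOn_symm_of_mem_maximalAtlas he).mdifferentiableOn (by simp)⟩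

theorem isInvertible_mfderiv_of_mem_maximalAtlas
    {e : OpenPartialHomeomorph M (EuclideanSpace ℝ (Fin n))}
    (he : e ∈ IsManifold.maximalAtlas (𝓡 n) ∞ M) {x : M} (hx : x ∈ e.source) :
    (mfderiv (𝓡 n) (𝓡 n) e x).IsInvertible :=
  ⟨(mdifferentiable_of_mem_maximalAtlas he).mfderiv hx, rfl⟩

theorem coordVec_eq {e : OpenPartialHomeomorph M (EuclideanSpace ℝ (Fin n))}
    (he : e ∈ IsManifold.maximalAtlas (𝓡 n) ∞ M) {x : M} (hx : x ∈ e.source) (j : Fin n) :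
    coordVec e j x = ((mdifferentiable_of_mem_maximalAtlas he).mfderiv hx).symm (stdVec n j) := by
  have h : (mfderiv (𝓡 n) (𝓡 n) e x) =
    ((mdifferentiable_of_mem_maximalAtlas he).mfderiv hx : _ →L[ℝ] _) := rfl
  change (mfderiv (𝓡 n) (𝓡 n) e x).inverse _ = _
  rw [h, ContinuousLinearMap.inverse_equiv]
  rfl

theorem chartDeriv_coordVec {e : OpenPartialHomeomorph M (EuclideanSpace ℝ (Fin n))}
    (he : e ∈ IsManifold.maximalAtlas (𝓡 n) ∞ M) {x : M} (hx : x ∈ e.source) (j : Fin n) :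
    chartDeriv e x (coordVec e j x) = stdVec n j := by
  rw [coordVec_eq he hx]
  exact ((mdifferentiable_of_mem_maximalAtlas he).mfderiv hx).apply_symm_apply (stdVec n j)

theorem coordCovec_apply (e : OpenPartialHomeomorph M (EuclideanSpace ℝ (Fin n))) (i : Fin n)
    (x : M) (v : TangentSpace (𝓡 n) x) : coordCovec e i x v = chartDeriv e x v i := rfl

theorem chartDeriv_injective {e : OpenPartialHomeomorph M (EuclideanSpace ℝ (Fin n))}
    (he : e ∈ IsManifold.maximalAtlas (𝓡 n) ∞ M) {x : M} (hx : x ∈ e.source) :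
    Function.Injective (chartDeriv e x) :=
  ((mdifferentiable_of_mem_maximalAtlas he).mfderiv hx).injective

theorem coordCovec_coordVec_self {e : OpenPartialHomeomorph M (EuclideanSpace ℝ (Fin n))}
    (he : e ∈ IsManifold.maximalAtlas (𝓡 n) ∞ M) {x : M} (hx : x ∈ e.source) (i r : Fin n) :
    coordCovec e i x (coordVec e r x) = if i = r then 1 else 0 := by
  rw [coordCovec_apply, chartDeriv_coordVec he hx]
  simp [stdVec, PiLp.single_apply]

theorem sum_coordCovec_smul_coordVec {e : OpenPartialHomeomorph M (EuclideanSpace ℝ (Fin n))}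
    (he : e ∈ IsManifold.maximalAtlas (𝓡 n) ∞ M) {x : M} (hx : x ∈ e.source)
    (v : TangentSpace (𝓡 n) x) : ∑ j, coordCovec e j x v • coordVec e j x = v := by
  apply chartDeriv_injective he hx
  rw [map_sum]
  simp_rw [map_smul, chartDeriv_coordVec he hx]
  ext i
  simp [stdVec, Pi.single_apply, coordCovec_apply]

theorem coordCovec_coordVec {e e' : OpenPartialHomeomorph M (EuclideanSpace ℝ (Fin n))}
    (he : e ∈ IsManifold.maximalAtlas (𝓡 n) ∞ M) (he' : e' ∈ IsManifold.maximalAtlas (𝓡 n) ∞ M)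
    {x : M} (hx : x ∈ e.source) (hx' : x ∈ e'.source) (i r : Fin n) :
    coordCovec e i x (coordVec e' r x) = partialCoord e e' x i r := by
  rw [coordVec_eq he' hx']
  have h1 : MDifferentiableAt (𝓡 n) (𝓡 n) e (e'.symm (e' x)) := by
    rw [e'.left_inv hx']
    exact (mdifferentiable_of_mem_maximalAtlas he).mdifferentiableAt hx
  have h2 : MDifferentiableAt (𝓡 n) (𝓡 n) e'.symm (e' x) :=
    (mdifferentiable_of_mem_maximalAtlas he').mdifferentiableAt_symm (e'.map_source hx')
  have h3 := mfderiv_comp (e' x) h1 h2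
  rw [e'.left_inv hx', mfderiv_eq_fderiv] at h3
  exact congrArg (fun v : EuclideanSpace ℝ (Fin n) => v i)
    (congrArg (fun f : EuclideanSpace ℝ (Fin n) →L[ℝ] EuclideanSpace ℝ (Fin n) =>
      f (stdVec n r)) h3.symm)

theorem coordVec_eq_sum {e e' : OpenPartialHomeomorph M (EuclideanSpace ℝ (Fin n))}
    (he : e ∈ IsManifold.maximalAtlas (𝓡 n) ∞ M) (he' : e' ∈ IsManifold.maximalAtlas (𝓡 n) ∞ M)
    {x : M} (hx : x ∈ e.source) (hx' : x ∈ e'.source) (r : Fin n) :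
    coordVec e' r x = ∑ j, partialCoord e e' x j r • coordVec e j x := by
  simp_rw [← coordCovec_coordVec he he' hx hx']
  exact (sum_coordCovec_smul_coordVec he hx _).symm

theorem coordCovec_eq_sum {e e' : OpenPartialHomeomorph M (EuclideanSpace ℝ (Fin n))}
    (he : e ∈ IsManifold.maximalAtlas (𝓡 n) ∞ M) (he' : e' ∈ IsManifold.maximalAtlas (𝓡 n) ∞ M)
    {x : M} (hx : x ∈ e.source) (hx' : x ∈ e'.source) (i : Fin n) :
    coordCovec e i x = ∑ r, partialCoord e e' x i r • coordCovec e' r x := by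
  ext v
  conv_lhs => rw [← sum_coordCovec_smul_coordVec he' hx' v]
  simp [coordCovec_coordVec he he' hx hx', mul_comm]

theorem sum_partialCoord_mul {e e' : OpenPartialHomeomorph M (EuclideanSpace ℝ (Fin n))}
    (he : e ∈ IsManifold.maximalAtlas (𝓡 n) ∞ M) (he' : e' ∈ IsManifold.maximalAtlas (𝓡 n) ∞ M)
    {x : M} (hx : x ∈ e.source) (hx' : x ∈ e'.source) (i j : Fin n) :
    ∑ r, partialCoord e e' x i r * partialCoord e' e x r j = if i = j then 1 else 0 := by
  rw [← coordCovec_coordVec_self he hx, coordCovec_eq_sum he he' hx hx']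
  simp [coordCovec_coordVec he' he hx' hx]

theorem tensorComp_change {p q : ℕ} {e e' : OpenPartialHomeomorph M (EuclideanSpace ℝ (Fin n))}
    (he : e ∈ IsManifold.maximalAtlas (𝓡 n) ∞ M) (he' : e' ∈ IsManifold.maximalAtlas (𝓡 n) ∞ M)
    {x : M} (hx : x ∈ e.source) (hx' : x ∈ e'.source) (T : TensorAt n p q x)
    (j : Fin p → Fin n) (i : Fin q → Fin n) :
    tensorComp e T j i = ∑ r : Fin p → Fin n, ∑ a : Fin q → Fin n,
      (∏ k, partialCoord e e' x (j k) (r k)) * (∏ k, partialCoord e' e x (a k) (i k)) *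
        tensorComp e' T r a := by
  classical
  unfold tensorComp
  simp_rw [coordCovec_eq_sum he he' hx hx', coordVec_eq_sum he' he hx' hx]
  rw [MultilinearMap.map_sum, Finset.sum_comm]
  refine Finset.sum_congr rfl fun a _ => ?_
  rw [MultilinearMap.map_smul_univ, MultilinearMap.map_sum, sum_apply, Finset.smul_sum]
  refine Finset.sum_congr rfl fun r _ => ?_
  rw [MultilinearMap.map_smul_univ, smul_apply]
  simp only [smul_eq_mul]
  ring

theorem contMDiffAt_partialCoord {e e' : OpenPartialHomeomorph M (EuclideanSpace ℝ (Fin n))}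
    (he : e ∈ IsManifold.maximalAtlas (𝓡 n) ∞ M) (he' : e' ∈ IsManifold.maximalAtlas (𝓡 n) ∞ M)
    {x : M} (hx : x ∈ e.source) (hx' : x ∈ e'.source) (j r : Fin n) :
    ContMDiffAt (𝓡 n) 𝓘(ℝ, ℝ) ∞ (fun y => partialCoord e e' y j r) x := by
  have h1 : ContMDiffAt (𝓡 n) (𝓡 n) ∞ e (e'.symm (e' x)) := by
    rw [e'.left_inv hx']
    exact contMDiffAt_of_mem_maximalAtlas he hx
  have h2 : ContMDiffAt (𝓡 n) (𝓡 n) ∞ e'.symm (e' x) :=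
    contMDiffAt_symm_of_mem_maximalAtlas he' (e'.map_source hx')
  have h3 : ContDiffAt ℝ ∞ (fun y => e (e'.symm y)) (e' x) :=
    (h1.comp (e' x) h2).contDiffAt
  have h4 : ContDiffAt ℝ ∞ (fun y => fderiv ℝ (fun y => e (e'.symm y)) y (stdVec n r) j)
      (e' x) := by
    have h5 := (h3.fderiv_right (m := ∞) (by simp)).clm_apply
      (contDiffAt_const (c := stdVec n r))
    exact (EuclideanSpace.proj (𝕜 := ℝ) j).contDiff.contDiffAt.comp (e' x) h5
  exact h4.contMDiffAt.comp x (contMDiffAt_of_mem_maximalAtlas he' hx')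

theorem mdifferentiableAt_stdVec_section (j : Fin n) (x : EuclideanSpace ℝ (Fin n)) :
    MDifferentiableAt (𝓡 n) (𝓡 n).tangent
      (fun y => (⟨y, stdVec n j⟩ : TangentBundle (𝓡 n) (EuclideanSpace ℝ (Fin n)))) x :=
  ((contMDiffAt_vectorSpace_iff_contDiffAt (V := fun _ : EuclideanSpace ℝ (Fin n) => stdVec n j)).2
    (contDiffAt_const (n := 1))).mdifferentiableAt (by simp)

theorem mdifferentiableAt_coordVec [IsManifold (𝓡 n) ∞ M]
    {e : OpenPartialHomeomorph M (EuclideanSpace ℝ (Fin n))}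
    (he : e ∈ IsManifold.maximalAtlas (𝓡 n) ∞ M) {x : M} (hx : x ∈ e.source) (j : Fin n) :
    MDifferentiableAt (𝓡 n) (𝓡 n).tangent
      (fun y => (⟨y, coordVec e j y⟩ : TangentBundle (𝓡 n) M)) x := by
  refine MDifferentiableAt.mpullback_vectorField (n := ∞) ?_
    (contMDiffAt_of_mem_maximalAtlas he hx) (isInvertible_mfderiv_of_mem_maximalAtlas he hx)
    (by norm_cast)
  exact mdifferentiableAt_stdVec_section _ _

theorem connAlong_eq [IsManifold (𝓡 n) ∞ M]
    (cov : CovariantDerivative (𝓡 n) (EuclideanSpace ℝ (Fin n))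
      (TangentSpace (𝓡 n) : M → Type _))
    {γ : ℝ → M} {e : OpenPartialHomeomorph M (EuclideanSpace ℝ (Fin n))}
    (he : e ∈ IsManifold.maximalAtlas (𝓡 n) ∞ M) {t : ℝ} (ht : γ t ∈ e.source)
    (hγ : MDifferentiableAt 𝓘(ℝ, ℝ) (𝓡 n) γ t) (i j : Fin n) :
    connAlong cov γ e t i j =
      coordCovec e i (γ t) (cov (coordVec e j) (γ t) (mfderiv 𝓘(ℝ, ℝ) (𝓡 n) γ t (1 : ℝ))) := by
  have h1 : ∀ l, coordCovec e l (γ t) (mfderiv 𝓘(ℝ, ℝ) (𝓡 n) γ t (1 : ℝ)) =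
      deriv (fun τ => e (γ τ) l) t := by
    intro l
    have h2 := (mdifferentiable_of_mem_maximalAtlas he).mdifferentiableAt ht
    have h3 : HasFDerivAt (fun τ => e (γ τ)) ((chartDeriv e (γ t)).comp
        (mfderiv 𝓘(ℝ, ℝ) (𝓡 n) γ t : ℝ →L[ℝ] TangentSpace (𝓡 n) (γ t))) t :=
      (h2.hasMFDerivAt.comp t hγ.hasMFDerivAt).hasFDerivAt
    have h4 := ((EuclideanSpace.proj (𝕜 := ℝ) l).hasFDerivAt.comp_hasDerivAt t h3.hasDerivAt)
    exact h4.deriv.symm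
  conv_rhs => rw [← sum_coordCovec_smul_coordVec he ht (mfderiv 𝓘(ℝ, ℝ) (𝓡 n) γ t (1 : ℝ))]
  simp_rw [h1]
  rw [map_sum, map_sum]
  simp [connAlong, christoffel, mul_comm]

theorem hasDerivAt_partialCoord 
    {γ : ℝ → M} {e e' : OpenPartialHomeomorph M (EuclideanSpace ℝ (Fin n))}
    (he : e ∈ IsManifold.maximalAtlas (𝓡 n) ∞ M) (he' : e' ∈ IsManifold.maximalAtlas (𝓡 n) ∞ M)
    {t : ℝ} (ht : γ t ∈ e.source) (ht' : γ t ∈ e'.source)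
    (hγ : MDifferentiableAt 𝓘(ℝ, ℝ) (𝓡 n) γ t) (j r : Fin n) :
    HasDerivAt (fun τ => partialCoord e e' (γ τ) j r)
      (mvfderiv (𝓡 n) (fun y => partialCoord e e' y j r) (γ t)
        (mfderiv 𝓘(ℝ, ℝ) (𝓡 n) γ t (1 : ℝ))) t := by
  have h1 := (contMDiffAt_partialCoord he he' ht ht' j r).mdifferentiableAt (by simp)
  have h2 : HasFDerivAt (fun τ => partialCoord e e' (γ τ) j r)
      ((mvfderiv (𝓡 n) (fun y => partialCoord e e' y j r) (γ t)).comp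
        (mfderiv 𝓘(ℝ, ℝ) (𝓡 n) γ t : ℝ →L[ℝ] TangentSpace (𝓡 n) (γ t))) t :=
    (h1.hasMFDerivAt.comp t hγ.hasMFDerivAt).hasFDerivAt
  exact h2.hasDerivAt

/-- The connection is local, so near `x` the field `coordVec e' r` may be replaced by its expansion
in the frame of `e`; additivity and the Leibniz rule do the rest. The derivative term is the
inhomogeneous part of the law for Christoffel symbols. -/
theorem cov_coordVec [IsManifold (𝓡 n) ∞ M]
    (cov : CovariantDerivative (𝓡 n) (EuclideanSpace ℝ (Fin n))
      (TangentSpace (𝓡 n) : M → Type _))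
    {e e' : OpenPartialHomeomorph M (EuclideanSpace ℝ (Fin n))}
    (he : e ∈ IsManifold.maximalAtlas (𝓡 n) ∞ M) (he' : e' ∈ IsManifold.maximalAtlas (𝓡 n) ∞ M)
    {x : M} (hx : x ∈ e.source) (hx' : x ∈ e'.source) (r : Fin n) (v : TangentSpace (𝓡 n) x) :
    cov (coordVec e' r) x v = ∑ j, (partialCoord e e' x j r • cov (coordVec e j) x v +
      mvfderiv (𝓡 n) (fun y => partialCoord e e' y j r) x v • coordVec e j x) := by
  have hcov := cov.isCovariantDerivativeOnUniv
  have hf := fun j => (contMDiffAt_partialCoord he he' hx hx' j r).mdifferentiableAt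
    (by simp)
  have hs := fun j => mdifferentiableAt_coordVec he hx j
  have hfs := fun j => (hf j).smul_section (hs j)
  have h1 : cov (coordVec e' r) x =
      cov (∑ j, (fun y => partialCoord e e' y j r) • coordVec e j) x := by
    refine hcov.congr_of_eventuallyEq (mdifferentiableAt_coordVec he' hx' r) ?_ univ_mem ?_
    · have := MDifferentiableAt.sum_section (s := Finset.univ) (fun j _ => hfs j)
      convert this using 2
      simp
    · filter_upwards [e.open_source.mem_nhds hx, e'.open_source.mem_nhds hx'] with y hy hy'
      rw [coordVec_eq_sum he he' hy hy' r]
      simp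
  have h2 : ∀ S : Finset (Fin n),
      cov (∑ j ∈ S, (fun y => partialCoord e e' y j r) • coordVec e j) x =
      ∑ j ∈ S, cov ((fun y => partialCoord e e' y j r) • coordVec e j) x := by
    intro S
    classical
    induction S using Finset.induction_on with
    | empty => simp
    | insert a S ha ih =>
      rw [Finset.sum_insert ha, Finset.sum_insert ha, hcov.add (hfs a), ih]
      have := MDifferentiableAt.sum_section (s := S) (fun j _ => hfs j)
      convert this using 2
      simp
  rw [h1, h2, sum_apply]
  refine Finset.sum_congr rfl fun j _ => ?_
  rw [hcov.leibniz (hs j) (hf j)]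
  rfl

/-- The transformation law of the connection form along a curve. -/
theorem hasDerivAt_partialCoord_connAlong [IsManifold (𝓡 n) ∞ M]
    (cov : CovariantDerivative (𝓡 n) (EuclideanSpace ℝ (Fin n))
      (TangentSpace (𝓡 n) : M → Type _))
    {γ : ℝ → M} {e e' : OpenPartialHomeomorph M (EuclideanSpace ℝ (Fin n))}
    (he : e ∈ IsManifold.maximalAtlas (𝓡 n) ∞ M) (he' : e' ∈ IsManifold.maximalAtlas (𝓡 n) ∞ M)
    {t : ℝ} (ht : γ t ∈ e.source) (ht' : γ t ∈ e'.source)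
    (hγ : MDifferentiableAt 𝓘(ℝ, ℝ) (𝓡 n) γ t) (i r : Fin n) :
    HasDerivAt (fun τ => partialCoord e e' (γ τ) i r)
      (∑ k, partialCoord e e' (γ t) i k * connAlong cov γ e' t k r -
        ∑ k, connAlong cov γ e t i k * partialCoord e e' (γ t) k r) t := by
  convert hasDerivAt_partialCoord he he' ht ht' hγ i r using 1
  simp_rw [connAlong_eq cov he ht hγ, connAlong_eq cov he' ht' hγ]
  set v := mfderiv 𝓘(ℝ, ℝ) (𝓡 n) γ t (1 : ℝ)
  have h1 := cov_coordVec cov he he' ht ht' r v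
  have h2 : coordCovec e i (γ t) (cov (coordVec e' r) (γ t) v) =
      ∑ k, partialCoord e e' (γ t) i k *
        coordCovec e' k (γ t) (cov (coordVec e' r) (γ t) v) := by
    rw [coordCovec_eq_sum he he' ht ht']
    simp
  rw [← h2, h1]
  simp [coordCovec_coordVec_self he ht, Finset.sum_add_distrib, mul_comm]

end Charts

/-! ### Linear differential equations over ℝ and ℂ -/

section LinearODE

variable {𝕜 : Type*} [RCLike 𝕜] {𝔸 : Type*} [NormedRing 𝔸] [NormedAlgebra 𝕜 𝔸]

/-- The mean value inequality along the segment from `s` to `z`. The factor `1 / (k + 1)`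
accumulates to `1 / k!` over the Picard iterates. -/
theorem norm_le_pow_of_hasDerivAt {Ω : Set 𝕜} (hΩ : Convex ℝ Ω) {s : 𝕜} (hs : s ∈ Ω)
    {g f : 𝕜 → 𝔸} (hg : ∀ z ∈ Ω, HasDerivAt g (f z) z) (hgs : g s = 0) {C : ℝ} {k : ℕ}
    (hf : ∀ z ∈ Ω, ‖f z‖ ≤ C * ‖z - s‖ ^ k) {z : 𝕜} (hz : z ∈ Ω) :
    ‖g z‖ ≤ C / (k + 1) * ‖z - s‖ ^ (k + 1) := by
  let : NormedSpace ℝ 𝔸 := .restrictScalars ℝ 𝕜 𝔸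
  have hseg : ∀ t ∈ Icc (0 : ℝ) 1, s + (t : 𝕜) * (z - s) ∈ Ω := by
    intro t ht
    have := hΩ.add_smul_sub_mem hs hz ht
    rwa [RCLike.real_smul_eq_coe_mul] at this
  have hφ : ∀ t ∈ Icc (0 : ℝ) 1, HasDerivAt (fun τ : ℝ => g (s + (τ : 𝕜) * (z - s)))
      ((z - s) • f (s + (t : 𝕜) * (z - s))) t := by
    intro t ht
    have h1 : HasDerivAt (fun τ : ℝ => s + (τ : 𝕜) * (z - s)) (z - s) t := by
      have h2 := ((RCLike.ofRealCLM (K := 𝕜)).hasDerivAt (x := t)).mul_const (z - s)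
      simpa using h2.const_add s
    exact (hg _ (hseg t ht)).scomp t h1
  have key := image_norm_le_of_norm_deriv_right_le_deriv_boundary
    (f := fun τ : ℝ => g (s + (τ : 𝕜) * (z - s)))
    (f' := fun t => (z - s) • f (s + (t : 𝕜) * (z - s))) (a := 0) (b := 1)
    (B := fun t => C / (k + 1) * ‖z - s‖ ^ (k + 1) * t ^ (k + 1))
    (B' := fun t => C * ‖z - s‖ ^ (k + 1) * t ^ k)
    (fun t ht => (hφ t ht).continuousAt.continuousWithinAt)
    (fun t ht => (hφ t (Ico_subset_Icc_self ht)).hasDerivWithinAt)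
    (by simp [hgs])
    (fun t => by
      have := (hasDerivAt_pow (k + 1) t).const_mul (C / (k + 1) * ‖z - s‖ ^ (k + 1))
      refine this.congr_deriv ?_
      have h0 : (k : ℝ) + 1 ≠ 0 := by positivity
      simp only [Nat.add_sub_cancel, Nat.cast_add, Nat.cast_one]
      field_simp)
    (fun t ht => by
      have h1 := hf _ (hseg t (Ico_subset_Icc_self ht))
      rw [norm_smul]
      have h2 : ‖s + (t : 𝕜) * (z - s) - s‖ = t * ‖z - s‖ := by
        rw [add_sub_cancel_left, norm_mul, RCLike.norm_ofReal, abs_of_nonneg ht.1]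
      rw [h2] at h1
      calc _ ≤ ‖z - s‖ * (C * (t * ‖z - s‖) ^ k) := by gcongr
        _ = _ := by ring)
  simpa using key (right_mem_Icc.2 zero_le_one)

/-- Picard iteration: start from 1 and let `T f` be the primitive of `f * G` that vanishes at `s`,
which exists because `Ω` is convex. The iterates are bounded by `(M R) ^ k / k!` up to a constant,
so their sum can be differentiated termwise. The complex case gives holomorphic solutions on all of
`Ω`. -/
theorem exists_hasDerivAt_mul_right [FiniteDimensional 𝕜 𝔸] {Ω : Set 𝕜} (hΩo : IsOpen Ω)
    (hΩ : Convex ℝ Ω) {s : 𝕜} (hs : s ∈ Ω) {G : 𝕜 → 𝔸} (hG : DifferentiableOn 𝕜 G Ω) {M R : ℝ}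
    (hM : ∀ z ∈ Ω, ‖G z‖ ≤ M) (hR : ∀ z ∈ Ω, ‖z - s‖ ≤ R) :
    ∃ Φ : 𝕜 → 𝔸, Φ s = 1 ∧ ∀ z ∈ Ω, HasDerivAt Φ (Φ z * G z) z := by
  have : CompleteSpace 𝔸 := FiniteDimensional.complete 𝕜 𝔸
  have hM0 : 0 ≤ M := (norm_nonneg _).trans (hM s hs)
  have hprim : ∀ f : {f : 𝕜 → 𝔸 // DifferentiableOn 𝕜 f Ω}, ∃ h : {f : 𝕜 → 𝔸 //
      DifferentiableOn 𝕜 f Ω}, h.1 s = 0 ∧ ∀ z ∈ Ω, HasDerivAt h.1 (f.1 z * G z) z := by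
    rintro ⟨f, hf⟩
    obtain ⟨h, hh⟩ := hΩ.exists_forall_hasDerivWithinAt (hf.mul hG)
    have h1 : ∀ z ∈ Ω, HasDerivAt (fun z => h z - h s) (f z * G z) z := fun z hz =>
      ((hh z hz).hasDerivAt (hΩo.mem_nhds hz)).sub_const _
    exact ⟨⟨fun z => h z - h s, fun z hz => (h1 z hz).differentiableAt.differentiableWithinAt⟩,
      sub_self _, h1⟩
  choose T hT0 hT using hprim
  let g : ℕ → {f : 𝕜 → 𝔸 // DifferentiableOn 𝕜 f Ω} := fun k =>
    T^[k] ⟨fun _ => 1, differentiableOn_const _⟩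
  have hg0 : (g 0).1 = fun _ => 1 := rfl
  have hgs : ∀ k, g (k + 1) = T (g k) := fun k => Function.iterate_succ_apply' _ _ _
  have hbound : ∀ k, ∀ z ∈ Ω, ‖(g k).1 z‖ ≤ ‖(1 : 𝔸)‖ * M ^ k / k.factorial * ‖z - s‖ ^ k := by
    intro k
    induction k with
    | zero => intro z _; simp [hg0]
    | succ k ih =>
      intro z hz
      rw [hgs]
      have := norm_le_pow_of_hasDerivAt hΩ hs (hT (g k)) (hT0 (g k))
        (C := ‖(1 : 𝔸)‖ * M ^ k / k.factorial * M) (k := k) (fun z hz => by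
          refine (norm_mul_le _ _).trans ?_
          have h1 := ih z hz
          have h2 := hM z hz
          calc _ ≤ (‖(1 : 𝔸)‖ * M ^ k / k.factorial * ‖z - s‖ ^ k) * M := by gcongr
            _ = _ := by ring) hz
      refine this.trans (le_of_eq ?_)
      rw [Nat.factorial_succ]
      push_cast
      field_simp
      ring
  let u : ℕ → ℝ := fun k => ‖(1 : 𝔸)‖ * ((M * R) ^ k / k.factorial)
  have hu : Summable u := (Real.summable_pow_div_factorial (M * R)).mul_left _
  have hbound' : ∀ k, ∀ z ∈ Ω, ‖(g k).1 z‖ ≤ u k := by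
    intro k z hz
    refine (hbound k z hz).trans ?_
    have h1 : ‖z - s‖ ^ k ≤ R ^ k := pow_le_pow_left₀ (norm_nonneg _) (hR z hz) k
    calc _ ≤ ‖(1 : 𝔸)‖ * M ^ k / k.factorial * R ^ k := by gcongr
      _ = u k := by simp only [u, mul_pow]; ring
  have hsum : ∀ z ∈ Ω, Summable fun k => (g k).1 z := fun z hz =>
    Summable.of_norm_bounded hu (fun k => hbound' k z hz)
  refine ⟨fun z => 1 + ∑' k, (g (k + 1)).1 z, ?_, fun z hz => ?_⟩
  · simp [hgs, hT0]
  · have h1 : HasDerivAt (fun z => ∑' k, (g (k + 1)).1 z) (∑' k, (g k).1 z * G z) z := by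
      refine hasDerivAt_tsum_of_isPreconnected (g := fun k => (g (k + 1)).1)
        (g' := fun k z => (g k).1 z * G z) (hu.mul_right M) hΩo hΩ.isPreconnected
        (fun k y hy => ?_) (fun k y hy => ?_) hs ?_ hz
      · rw [hgs]; exact hT _ y hy
      · refine (norm_mul_le _ _).trans ?_
        have := hbound' k y hy
        have := hM y hy
        gcongr
        exact (norm_nonneg _).trans (hbound' k y hy)
      · simp [hgs, hT0]
    have h2 := h1.const_add (1 : 𝔸)
    rwa [(hsum z hz).tsum_mul_right, (hsum z hz).tsum_eq_zero_add, hg0] at h2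

end LinearODE

/-! ### Holomorphic extension of real analytic functions -/

section HolExt

/-- `f` extends holomorphically to a complex neighbourhood of the real interval `[c, s]`. -/
def HolExt (c s : ℝ) (f : ℝ → ℝ) : Prop :=
  ∃ U : Set ℂ, IsOpen U ∧ (∀ t ∈ Icc c s, (t : ℂ) ∈ U) ∧
    ∃ F : ℂ → ℂ, DifferentiableOn ℂ F U ∧ ∀ x : ℝ, (x : ℂ) ∈ U → F x = f x

variable {c s : ℝ} {f g : ℝ → ℝ}

theorem HolExt.const (a : ℝ) : HolExt c s fun _ => a :=
  ⟨univ, isOpen_univ, fun _ _ => mem_univ _, fun _ => a, differentiableOn_const _, fun _ _ => rfl⟩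

theorem HolExt.mul (hf : HolExt c s f) (hg : HolExt c s g) : HolExt c s fun t => f t * g t := by
  obtain ⟨U, hU, hcU, F, hF, hFf⟩ := hf
  obtain ⟨V, hV, hcV, G, hG, hGg⟩ := hg
  exact ⟨U ∩ V, hU.inter hV, fun t ht => ⟨hcU t ht, hcV t ht⟩, fun z => F z * G z,
    (hF.mono inter_subset_left).mul (hG.mono inter_subset_right),
    fun x hx => by simp [hFf x hx.1, hGg x hx.2]⟩

theorem HolExt.prod {ι : Type*} {S : Finset ι} {f : ι → ℝ → ℝ} (hf : ∀ i, HolExt c s (f i)) :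
    HolExt c s fun t => ∏ i ∈ S, f i t := by
  classical
  induction S using Finset.induction_on with
  | empty => simpa using HolExt.const 1
  | insert a S ha ih => simpa [Finset.prod_insert ha] using (hf a).mul ih

theorem exists_holomorphic_of_analyticAt {t : ℝ} (hf : AnalyticAt ℝ f t) :
    ∃ r > 0, ∃ F : ℂ → ℂ, DifferentiableOn ℂ F (Metric.ball (t : ℂ) r) ∧
      ∀ x : ℝ, (x : ℂ) ∈ Metric.ball (t : ℂ) r → F x = f x := by
  obtain ⟨p, r, hp⟩ := hf
  obtain ⟨r', hr'0, hr'⟩ := ENNReal.lt_iff_exists_nnreal_btwn.1 hp.r_pos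
  have hr'0 : 0 < r' := by exact_mod_cast hr'0
  have hsum : Summable fun k => ‖p.coeff k‖ * (r' : ℝ) ^ k := by
    have := p.summable_norm_mul_pow (lt_of_lt_of_le hr' hp.r_le)
    refine this.congr fun k => ?_
    rw [p.norm_apply_eq_norm_coef]
  refine ⟨r', by exact_mod_cast hr'0, fun z => ∑' k, (p.coeff k : ℂ) * (z - t) ^ k, ?_, ?_⟩
  · refine Complex.differentiableOn_tsum_of_summable_norm hsum (fun k => by fun_prop)
      Metric.isOpen_ball fun k w hw => ?_
    rw [norm_mul, norm_pow, Complex.norm_real]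
    rw [Metric.mem_ball, dist_eq_norm] at hw
    gcongr
  · intro x hx
    have hx' : x - t ∈ Metric.eball (0 : ℝ) r := by
      rw [Metric.mem_ball, dist_eq_norm, ← Complex.ofReal_sub, Complex.norm_real] at hx
      rw [Metric.mem_eball, edist_zero_right]
      refine lt_of_le_of_lt ?_ hr'
      rw [enorm_le_coe]
      exact_mod_cast hx.le
    have h1 := hp.hasSum hx'
    rw [add_sub_cancel] at h1
    rw [← h1.tsum_eq, Complex.ofReal_tsum]
    refine tsum_congr fun k => ?_
    simp [mul_comm]

/-- Both balls have real centres, so with `z` they contain its real part, and the identity theorem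
applies on the convex intersection. This makes local extensions compatible, hence gluable. -/
theorem eqOn_ball_inter_ball {t₁ t₂ r₁ r₂ : ℝ} {F₁ F₂ : ℂ → ℂ}
    (h₁ : DifferentiableOn ℂ F₁ (Metric.ball (t₁ : ℂ) r₁))
    (h₂ : DifferentiableOn ℂ F₂ (Metric.ball (t₂ : ℂ) r₂))
    (h : ∀ x : ℝ, (x : ℂ) ∈ Metric.ball (t₁ : ℂ) r₁ → (x : ℂ) ∈ Metric.ball (t₂ : ℂ) r₂ →
      F₁ x = F₂ x) :
    EqOn F₁ F₂ (Metric.ball (t₁ : ℂ) r₁ ∩ Metric.ball (t₂ : ℂ) r₂) := by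
  intro z hz
  have hre : ∀ t r : ℝ, z ∈ Metric.ball (t : ℂ) r → ((z.re : ℝ) : ℂ) ∈ Metric.ball (t : ℂ) r := by
    intro t r hz
    rw [Metric.mem_ball, dist_eq_norm] at hz ⊢
    refine lt_of_le_of_lt ?_ hz
    rw [← Complex.ofReal_sub, Complex.norm_real]
    simpa using Complex.abs_re_le_norm (z - t)
  have hmem : ((z.re : ℝ) : ℂ) ∈ Metric.ball (t₁ : ℂ) r₁ ∩ Metric.ball (t₂ : ℂ) r₂ :=
    ⟨hre _ _ hz.1, hre _ _ hz.2⟩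
  have hopen : IsOpen (Metric.ball (t₁ : ℂ) r₁ ∩ Metric.ball (t₂ : ℂ) r₂) :=
    Metric.isOpen_ball.inter Metric.isOpen_ball
  refine AnalyticOnNhd.eqOn_of_preconnected_of_frequently_eq
    ((h₁.mono inter_subset_left).analyticOnNhd hopen)
    ((h₂.mono inter_subset_right).analyticOnNhd hopen)
    ((convex_ball _ _).inter (convex_ball _ _)).isPreconnected hmem ?_ hz
  have htend : Tendsto (fun x : ℝ => (x : ℂ)) (𝓝[≠] z.re) (𝓝[≠] ((z.re : ℝ) : ℂ)) := by
    refine tendsto_nhdsWithin_iff.2 ⟨(Complex.continuous_ofReal.tendsto _).mono_left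
      nhdsWithin_le_nhds, ?_⟩
    filter_upwards [self_mem_nhdsWithin] with x hx
    simpa using hx
  refine htend.frequently (Eventually.frequently ?_)
  have : ∀ᶠ x : ℝ in 𝓝 z.re, (x : ℂ) ∈ Metric.ball (t₁ : ℂ) r₁ ∩ Metric.ball (t₂ : ℂ) r₂ :=
    Complex.continuous_ofReal.continuousAt.eventually_mem (hopen.mem_nhds hmem)
  filter_upwards [nhdsWithin_le_nhds this] with x hx using h x hx.1 hx.2

theorem HolExt.of_analyticOnNhd (hf : AnalyticOnNhd ℝ f (Icc c s)) : HolExt c s f := by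
  classical
  have h := fun t : Icc c s => exists_holomorphic_of_analyticAt (hf t t.2)
  choose r hr F hF hFf using h
  let U : Set ℂ := ⋃ t : Icc c s, Metric.ball ((t : ℝ) : ℂ) (r t)
  have hch : ∀ z : ℂ, ∃ w : ℂ, ∀ t : Icc c s, z ∈ Metric.ball ((t : ℝ) : ℂ) (r t) → w = F t z := by
    intro z
    by_cases hz : ∃ t : Icc c s, z ∈ Metric.ball ((t : ℝ) : ℂ) (r t)
    · obtain ⟨t, ht⟩ := hz
      refine ⟨F t z, fun t' ht' => eqOn_ball_inter_ball (hF t) (hF t') (fun x hx hx' => ?_)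
        ⟨ht, ht'⟩⟩
      rw [hFf t x hx, hFf t' x hx']
    · exact ⟨0, fun t ht => (hz ⟨t, ht⟩).elim⟩
  choose H hH using hch
  refine ⟨U, isOpen_iUnion fun _ => Metric.isOpen_ball, fun t ht => mem_iUnion.2
    ⟨⟨t, ht⟩, Metric.mem_ball_self (hr _)⟩, H, ?_, ?_⟩
  · intro z hz
    obtain ⟨t, ht⟩ := mem_iUnion.1 hz
    have h1 : H =ᶠ[𝓝 z] F t := by
      filter_upwards [Metric.isOpen_ball.mem_nhds ht] with w hw using hH w t hw
    exact (h1.differentiableAt_iff.2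
      ((hF t).differentiableAt (Metric.isOpen_ball.mem_nhds ht))).differentiableWithinAt
  · intro x hx
    obtain ⟨t, ht⟩ := mem_iUnion.1 hx
    rw [hH _ t ht, hFf t x ht]

/-- Finitely many holomorphic extensions exist, and are bounded, on a common bounded convex
neighbourhood of the interval. -/
theorem HolExt.exists_common {ι : Type*} [Finite ι] {f : ι → ℝ → ℝ} (hf : ∀ i, HolExt c s (f i)) :
    ∃ ε > 0, ∃ F : ι → ℂ → ℂ,
      (∀ i, DifferentiableOn ℂ (F i) (Metric.thickening ε ((fun t : ℝ => (t : ℂ)) '' Icc c s))) ∧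
      (∀ i, ∀ x : ℝ, (x : ℂ) ∈ Metric.thickening ε ((fun t : ℝ => (t : ℂ)) '' Icc c s) →
        F i x = f i x) ∧
      ∃ M, ∀ i, ∀ z ∈ Metric.thickening ε ((fun t : ℝ => (t : ℂ)) '' Icc c s), ‖F i z‖ ≤ M := by
  have := Fintype.ofFinite ι
  choose U hU hcU F hF hFf using hf
  have hK : IsCompact ((fun t : ℝ => (t : ℂ)) '' Icc c s) :=
    isCompact_Icc.image Complex.continuous_ofReal
  have hsub : ((fun t : ℝ => (t : ℂ)) '' Icc c s) ⊆ ⋂ i, U i := by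
    rintro _ ⟨t, ht, rfl⟩
    exact mem_iInter.2 fun i => hcU i t ht
  obtain ⟨ε, hε, hεU⟩ := hK.exists_cthickening_subset_open (isOpen_iInter_of_finite hU) hsub
  have hth : Metric.thickening ε ((fun t : ℝ => (t : ℂ)) '' Icc c s) ⊆ ⋂ i, U i :=
    (Metric.thickening_subset_cthickening _ _).trans hεU
  refine ⟨ε, hε, F, fun i => (hF i).mono fun z hz => mem_iInter.1 (hth hz) i,
    fun i x hx => hFf i x (mem_iInter.1 (hth hx) i), ?_⟩
  have hb : ∀ i, ∃ M, ∀ z ∈ Metric.cthickening ε ((fun t : ℝ => (t : ℂ)) '' Icc c s),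
      ‖F i z‖ ≤ M := fun i =>
    hK.cthickening.exists_bound_of_continuousOn
      ((hF i).continuousOn.mono fun z hz => mem_iInter.1 (hεU hz) i)
  choose M hM using hb
  refine ⟨∑ i, |M i|, fun i z hz => (hM i z (Metric.thickening_subset_cthickening _ _ hz)).trans
    ((le_abs_self _).trans ?_)⟩
  exact Finset.single_le_sum (f := fun i => |M i|) (fun i _ => abs_nonneg _) (Finset.mem_univ i)

end HolExt

/-! ### Existence of parallel frames -/

section Frames

variable {n : ℕ}

/-- The operator norm turns matrices into a finite-dimensional normed algebra, where the system is
the single equation Φ̇ = ΦG. -/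
theorem exists_frame_of_differentiableOn {𝕜 : Type*} [RCLike 𝕜] {Ω : Set 𝕜} (hΩo : IsOpen Ω)
    (hΩ : Convex ℝ Ω) {s : 𝕜} (hs : s ∈ Ω) {G : 𝕜 → Fin n → Fin n → 𝕜}
    (hG : ∀ i j, DifferentiableOn 𝕜 (fun z => G z i j) Ω) {M R : ℝ}
    (hM : ∀ i j, ∀ z ∈ Ω, ‖G z i j‖ ≤ M) (hR : ∀ z ∈ Ω, ‖z - s‖ ≤ R) :
    ∃ Φ : 𝕜 → Fin n → Fin n → 𝕜, (∀ i j, Φ s i j = if i = j then 1 else 0) ∧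
      ∀ z ∈ Ω, ∀ i j, HasDerivAt (fun w => Φ w i j) (∑ l, Φ z i l * G z l j) z := by
  let := Matrix.linftyOpNormedRing (n := Fin n) (α := 𝕜)
  let := Matrix.linftyOpNormedAlgebra (R := 𝕜) (n := Fin n) (α := 𝕜)
  let H : 𝕜 → Matrix (Fin n) (Fin n) 𝕜 := fun z => ∑ i, ∑ j, G z i j • Matrix.single i j (1 : 𝕜)
  have hH : ∀ z i j, H z i j = G z i j := by
    intro z i j
    have := Matrix.matrix_eq_sum_single (Matrix.of (G z))
    have h2 : H z = Matrix.of (G z) := by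
      rw [this]
      refine Finset.sum_congr rfl fun i _ => Finset.sum_congr rfl fun j _ => ?_
      rw [Matrix.smul_single, smul_eq_mul, mul_one]
      rfl
    rw [h2]; rfl
  obtain ⟨Φ, hΦs, hΦ⟩ := exists_hasDerivAt_mul_right hΩo hΩ hs (G := H)
    (M := ∑ i : Fin n, ∑ j : Fin n, M * ‖Matrix.single i j (1 : 𝕜)‖) (R := R)
    (DifferentiableOn.fun_sum fun i _ => DifferentiableOn.fun_sum fun j _ =>
      (hG i j).smul_const _)
    (fun z hz => (norm_sum_le _ _).trans (Finset.sum_le_sum fun i _ => (norm_sum_le _ _).trans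
      (Finset.sum_le_sum fun j _ => (norm_smul_le _ _).trans
        (mul_le_mul_of_nonneg_right (hM i j z hz) (norm_nonneg _))))) hR
  refine ⟨fun z i j => Φ z i j, fun i j => ?_, fun z hz i j => ?_⟩
  · exact (congrArg (fun A : Matrix (Fin n) (Fin n) 𝕜 => A i j) hΦs).trans Matrix.one_apply
  · have h1 := ((Matrix.entryLinearMap 𝕜 𝕜 i j).toContinuousLinearMap.hasFDerivAt
      (x := Φ z)).comp_hasDerivAt z (hΦ z hz)
    refine h1.congr_deriv ?_
    change (Φ z * H z) i j = _
    rw [Matrix.mul_apply]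
    simp_rw [hH]

theorem exists_frame_of_contDiffAt {s : ℝ} {G : ℝ → Fin n → Fin n → ℝ}
    (hG : ∀ i j, ContDiffAt ℝ ∞ (fun t => G t i j) s) :
    ∃ a b, a < s ∧ s < b ∧ ∃ Φ : ℝ → Fin n → Fin n → ℝ,
      (∀ i j, Φ s i j = if i = j then 1 else 0) ∧
      ∀ t ∈ Ioo a b, ∀ i j, HasDerivAt (fun τ => Φ τ i j) (∑ l, Φ t i l * G t l j) t := by
  have h1 : ∀ᶠ t in 𝓝 s, ∀ i j, ContDiffAt ℝ 1 (fun t => G t i j) t :=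
    eventually_all.2 fun i => eventually_all.2 fun j =>
      ((hG i j).of_le (by norm_cast)).eventually (by simp)
  obtain ⟨δ, hδ, hball⟩ := Metric.eventually_nhds_iff.1 h1
  have hmem : ∀ t ∈ Icc (s - δ / 2) (s + δ / 2), ∀ i j,
      DifferentiableAt ℝ (fun t => G t i j) t := by
    intro t ht i j
    refine (hball ?_ i j).differentiableAt (by simp)
    rw [Real.dist_eq, abs_lt]
    constructor <;> linarith [ht.1, ht.2]
  have hb : ∀ i j, ∃ M, ∀ t ∈ Icc (s - δ / 2) (s + δ / 2), ‖G t i j‖ ≤ M := fun i j =>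
    isCompact_Icc.exists_bound_of_continuousOn fun t ht =>
      (hmem t ht i j).continuousAt.continuousWithinAt
  choose M hM using hb
  obtain ⟨Φ, h0, hΦ⟩ := exists_frame_of_differentiableOn (𝕜 := ℝ) (isOpen_Ioo (a := s - δ / 2)
    (b := s + δ / 2)) (convex_Ioo _ _) (s := s) ⟨by linarith, by linarith⟩ (G := G)
    (fun i j t ht => (hmem t (Ioo_subset_Icc_self ht) i j).differentiableWithinAt)
    (M := ∑ i, ∑ j, |M i j|) (R := δ)
    (fun i j t ht => (hM i j t (Ioo_subset_Icc_self ht)).trans <| (le_abs_self _).trans <|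
      (Finset.single_le_sum (f := fun j => |M i j|) (fun _ _ => abs_nonneg _)
        (Finset.mem_univ j)).trans
      (Finset.single_le_sum (f := fun i => ∑ j, |M i j|)
        (fun _ _ => Finset.sum_nonneg fun _ _ => abs_nonneg _) (Finset.mem_univ i)))
    (fun t ht => by
      rw [Real.norm_eq_abs, abs_le]
      constructor <;> linarith [ht.1, ht.2])
  exact ⟨_, _, by linarith, by linarith, Φ, h0, hΦ⟩

/-- By reflection: half the sum of F(z) and the conjugate of F(z̄) is holomorphic and equals Re F on
the real axis. Thus it need not be known that a complex solution is real there. -/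
theorem HolExt.of_re {c s : ℝ} {U : Set ℂ} (hU : IsOpen U) (hcU : ∀ t ∈ Icc c s, (t : ℂ) ∈ U)
    {F : ℂ → ℂ} (hF : DifferentiableOn ℂ F U) : HolExt c s fun t => (F t).re := by
  refine ⟨U ∩ (starRingEnd ℂ) ⁻¹' U, hU.inter (hU.preimage Complex.continuous_conj), fun t ht =>
    ⟨hcU t ht, by simpa using hcU t ht⟩,
    fun z => (F z + starRingEnd ℂ (F (starRingEnd ℂ z))) / 2, ?_, fun x _ => ?_⟩
  · intro z hz
    have h1 := hF.differentiableAt (hU.mem_nhds hz.1)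
    have h2 : DifferentiableAt ℂ F (starRingEnd ℂ z) := hF.differentiableAt (hU.mem_nhds hz.2)
    have h3 := h2.conj_conj
    rw [Complex.conj_conj] at h3
    exact ((h1.add h3).div_const 2).differentiableWithinAt
  · simp only [Complex.conj_ofReal, Complex.add_conj]
    push_cast
    ring

/-- The equation is solved on a complex neighbourhood of the interval. Its coefficients are real on
the axis, so the real part of the solution solves the real equation there. -/
theorem exists_frame_of_holExt {c s : ℝ} (hcs : c ≤ s) {G : ℝ → Fin n → Fin n → ℝ}
    (hG : ∀ i j, HolExt c s fun t => G t i j) :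
    ∃ a b, a < c ∧ s < b ∧ ∃ Φ : ℝ → Fin n → Fin n → ℝ,
      (∀ i j, Φ s i j = if i = j then 1 else 0) ∧
      (∀ t ∈ Ioo a b, ∀ i j, HasDerivAt (fun τ => Φ τ i j) (∑ l, Φ t i l * G t l j) t) ∧
      ∀ i j, HolExt c s fun t => Φ t i j := by
  obtain ⟨ε, hε, F, hF, hFG, M, hM⟩ := HolExt.exists_common
    (f := fun (p : Fin n × Fin n) t => G t p.1 p.2) (fun p => hG p.1 p.2)
  set K : Set ℂ := (fun t : ℝ => (t : ℂ)) '' Icc c s with hK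
  have hKc : IsCompact K := isCompact_Icc.image Complex.continuous_ofReal
  have hsK : (s : ℂ) ∈ K := ⟨s, ⟨hcs, le_rfl⟩, rfl⟩
  have hKconv : Convex ℝ K := by
    have := (convex_Icc c s).linear_image Complex.ofRealCLM.toLinearMap
    exact this
  have hself : K ⊆ Metric.thickening ε K := Metric.self_subset_thickening hε K
  obtain ⟨R, hR⟩ := (hKc.isBounded.thickening (δ := ε)).subset_closedBall (s : ℂ)
  obtain ⟨Φ, h0, hΦ⟩ := exists_frame_of_differentiableOn (𝕜 := ℂ)
    (Metric.isOpen_thickening (δ := ε) (E := K)) (hKconv.thickening ε) (hself hsK)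
    (G := fun z i j => F (i, j) z) (fun i j => hF (i, j)) (M := M) (fun i j z hz => hM (i, j) z hz)
    (R := R) (fun z hz => by simpa [dist_eq_norm] using hR hz)
  have hreal : ∀ t ∈ Ioo (c - ε) (s + ε), (t : ℂ) ∈ Metric.thickening ε K := by
    intro t ht
    rw [Metric.mem_thickening_iff]
    rcases lt_or_ge t c with h | h
    · refine ⟨c, ⟨c, ⟨le_rfl, hcs⟩, rfl⟩, ?_⟩
      rw [dist_eq_norm, ← Complex.ofReal_sub, Complex.norm_real, Real.norm_eq_abs, abs_lt]
      constructor <;> linarith [ht.1]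
    rcases lt_or_ge s t with h' | h'
    · refine ⟨s, hsK, ?_⟩
      rw [dist_eq_norm, ← Complex.ofReal_sub, Complex.norm_real, Real.norm_eq_abs, abs_lt]
      constructor <;> linarith [ht.2]
    · exact ⟨t, ⟨t, ⟨h, h'⟩, rfl⟩, by simpa using hε⟩
  refine ⟨c - ε, s + ε, by linarith, by linarith, fun t i j => (Φ t i j).re, fun i j => ?_,
    fun t ht i j => ?_, fun i j => ?_⟩
  · simp only [h0]; split_ifs <;> simp
  · have h1 := (hΦ t (hreal t ht) i j).real_of_complex
    refine h1.congr_deriv ?_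
    rw [Complex.re_sum]
    refine Finset.sum_congr rfl fun l _ => ?_
    rw [hFG (l, j) t (hreal t ht)]
    simp
  · exact HolExt.of_re (Metric.isOpen_thickening (δ := ε) (E := K))
      (fun t ht => hself ⟨t, ht, rfl⟩) (F := fun z => Φ z i j)
      fun z hz => (hΦ z hz i j).differentiableAt.differentiableWithinAt

end Frames

/-! ### Smoothness of the symbols and of solutions of linear equations -/

section Symbols

variable {n : ℕ} {s : ℝ} {G : ℝ → Fin n → Fin n → ℝ}

theorem _root_.ContDiffAt.deriv_of_infty {f : ℝ → ℝ} {s : ℝ} (hf : ContDiffAt ℝ ∞ f s) :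
    ContDiffAt ℝ ∞ (deriv f) s := by
  have := (hf.fderiv_right (m := ∞) (by simp)).clm_apply (contDiffAt_const (c := (1 : ℝ)))
  simpa only [fderiv_apply_one_eq_deriv] using this

theorem _root_.ContDiffAt.eventually_differentiableAt {f : ℝ → ℝ} {s : ℝ}
    (hf : ContDiffAt ℝ ∞ f s) : ∀ᶠ t in 𝓝 s, DifferentiableAt ℝ f t := by
  have h1 : ContDiffAt ℝ 1 f s := hf.of_le (by norm_cast)
  filter_upwards [h1.eventually (by simp)] with t ht using ht.differentiableAt (by simp)

theorem contDiffAt_symbP (hG : ∀ i j, ContDiffAt ℝ ∞ (fun t => G t i j) s) (k : ℕ) :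
    ∀ i j, ContDiffAt ℝ ∞ (fun t => symbP G k t i j) s := by
  induction k with
  | zero => intro i j; exact contDiffAt_const
  | succ k ih =>
    intro i j
    exact (ih i j).deriv_of_infty.add (ContDiffAt.sum fun l _ => (ih l j).mul (hG i l))

theorem contDiffAt_symbQ (hG : ∀ i j, ContDiffAt ℝ ∞ (fun t => G t i j) s) (k : ℕ) :
    ∀ i j, ContDiffAt ℝ ∞ (fun t => symbQ G k t i j) s := by
  induction k with
  | zero => intro i j; exact contDiffAt_const
  | succ k ih =>
    intro i j
    exact (ih i j).deriv_of_infty.add (ContDiffAt.sum fun l _ => (ih i l).mul (hG l j).neg)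

/-- Solutions of linear equations with smooth coefficients are smooth. -/
theorem contDiffAt_of_linear {ι : Type*} [Fintype ι] {Φ : ι → ℝ → ℝ} {H : ι → ι → ℝ → ℝ}
    (hH : ∀ i j, ContDiffAt ℝ ∞ (H i j) s)
    (hΦ : ∀ᶠ t in 𝓝 s, ∀ i, HasDerivAt (Φ i) (∑ l, Φ l t * H l i t) t) (i : ι) :
    ContDiffAt ℝ ∞ (Φ i) s := by
  -- Bootstrapping: if all components are C^k, so is the right-hand side of the equation, whence
  -- they are C^(k+1).
  refine contDiffAt_infty.2 fun k => ?_
  induction k generalizing i with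
  | zero =>
    refine contDiffAt_zero.2 ?_
    obtain ⟨u, hu, hΦu⟩ := hΦ.exists_mem
    exact ⟨u, hu, fun t ht => (hΦu t ht i).continuousAt.continuousWithinAt⟩
  | succ k ih =>
    have h1 : ContDiffAt ℝ k (fun t => ∑ l, Φ l t * H l i t) s :=
      ContDiffAt.sum fun l _ => (ih l).mul ((hH l i).of_le (by exact_mod_cast le_top))
    obtain ⟨u, hu, hΦu⟩ := hΦ.exists_mem
    refine contDiffAt_succ_iff_hasFDerivAt.2
      ⟨fun t => ContinuousLinearMap.toSpanSingleton ℝ (∑ l, Φ l t * H l i t), ⟨u, hu, fun t ht =>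
        (hΦu t ht i).hasFDerivAt⟩, ?_⟩
    exact (ContinuousLinearMap.toSpanSingletonCLE (𝕜 := ℝ) (E := ℝ)).contDiff.contDiffAt.comp s h1

end Symbols

/-! ### Parallel frames, their change of coordinates and their derivatives -/

section Transport

variable {n : ℕ}

theorem hasDerivAt_matrix_mul {X Y : ℝ → Matrix (Fin n) (Fin n) ℝ}
    {X' Y' : Matrix (Fin n) (Fin n) ℝ}
    {t : ℝ} (hX : ∀ i j, HasDerivAt (fun τ => X τ i j) (X' i j) t)
    (hY : ∀ i j, HasDerivAt (fun τ => Y τ i j) (Y' i j) t) (i j : Fin n) :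
    HasDerivAt (fun τ => (X τ * Y τ) i j) ((X' * Y t + X t * Y') i j) t := by
  simp only [Matrix.mul_apply, Matrix.add_apply]
  rw [← Finset.sum_add_distrib]
  exact HasDerivAt.fun_sum fun l _ => (hX i l).mul (hY l j)

/-- `Φ` and `Ψ` are the solutions of `Φ̇ = Φ G` and `Ψ̇ = -G Ψ` on `I` that are the identity
at `s`. -/
structure IsFrame (G : ℝ → Fin n → Fin n → ℝ) (s : ℝ) (I : Set ℝ)
    (Φ Ψ : ℝ → Matrix (Fin n) (Fin n) ℝ) : Prop where
  left_one : Φ s = 1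
  right_one : Ψ s = 1
  left_deriv : ∀ t ∈ I, ∀ i j,
    HasDerivAt (fun τ => Φ τ i j) ((Φ t * Matrix.of (G t)) i j) t
  right_deriv : ∀ t ∈ I, ∀ i j,
    HasDerivAt (fun τ => Ψ τ i j) ((-(Matrix.of (G t) * Ψ t)) i j) t

variable {G G' : ℝ → Fin n → Fin n → ℝ} {s a b : ℝ} {Φ Ψ Φ' Ψ' L K : ℝ → Matrix (Fin n) (Fin n) ℝ}

/-- The derivative ΦGL + Φ(LG' - GL) - ΦLG' (times Ψ') cancels identically, so the product keeps its
value at `s`. With G' = G and L = 1 the same computation shows that Ψ inverts Φ. -/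
theorem IsFrame.mul_mul_eq (h : IsFrame G s (Ioo a b) Φ Ψ) (h' : IsFrame G' s (Ioo a b) Φ' Ψ')
    (hs : s ∈ Ioo a b)
    (hL : ∀ t ∈ Ioo a b, ∀ i j, HasDerivAt (fun τ => L τ i j)
      ((L t * Matrix.of (G' t) - Matrix.of (G t) * L t) i j) t) {t : ℝ} (ht : t ∈ Ioo a b) :
    Φ t * L t * Ψ' t = L s := by
  have hD : ∀ τ ∈ Ioo a b, ∀ i j, HasDerivAt (fun τ => (Φ τ * L τ * Ψ' τ) i j) 0 τ := by
    intro τ hτ i j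
    have := hasDerivAt_matrix_mul (hasDerivAt_matrix_mul (h.left_deriv τ hτ) (hL τ hτ))
      (h'.right_deriv τ hτ) i j
    refine this.congr_deriv ?_
    have h0 : ((Φ τ * Matrix.of (G τ)) * L τ +
        Φ τ * (L τ * Matrix.of (G' τ) - Matrix.of (G τ) * L τ)) * Ψ' τ +
        Φ τ * L τ * (-(Matrix.of (G' τ) * Ψ' τ)) = 0 := by noncomm_ring
    rw [h0]; rfl
  ext i j
  have key := isOpen_Ioo.is_const_of_deriv_eq_zero isPreconnected_Ioo
    (f := fun τ => (Φ τ * L τ * Ψ' τ) i j)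
    (fun τ hτ => (hD τ hτ i j).differentiableAt.differentiableWithinAt)
    (fun τ hτ => (hD τ hτ i j).deriv) ht hs
  simpa [h.left_one, h'.right_one] using key

theorem IsFrame.mul_eq_one (h : IsFrame G s (Ioo a b) Φ Ψ) (hs : s ∈ Ioo a b) {t : ℝ}
    (ht : t ∈ Ioo a b) : Φ t * Ψ t = 1 := by
  have := h.mul_mul_eq h hs (L := fun _ => 1) (fun t _ i j => by
    simpa using hasDerivAt_const t ((1 : Matrix (Fin n) (Fin n) ℝ) i j)) ht
  simpa using this

theorem IsFrame.mul_left_eq (h : IsFrame G s (Ioo a b) Φ Ψ) (h' : IsFrame G' s (Ioo a b) Φ' Ψ')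
    (hs : s ∈ Ioo a b)
    (hL : ∀ t ∈ Ioo a b, ∀ i j, HasDerivAt (fun τ => L τ i j)
      ((L t * Matrix.of (G' t) - Matrix.of (G t) * L t) i j) t) {t : ℝ} (ht : t ∈ Ioo a b) :
    Φ t * L t = L s * Φ' t := by
  rw [← h.mul_mul_eq h' hs hL ht, Matrix.mul_assoc, mul_eq_one_comm.1 (h'.mul_eq_one hs ht),
    Matrix.mul_one]

theorem IsFrame.mul_right_eq (h : IsFrame G s (Ioo a b) Φ Ψ) (h' : IsFrame G' s (Ioo a b) Φ' Ψ')
    (hs : s ∈ Ioo a b)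
    (hL : ∀ t ∈ Ioo a b, ∀ i j, HasDerivAt (fun τ => L τ i j)
      ((L t * Matrix.of (G' t) - Matrix.of (G t) * L t) i j) t)
    (hK : ∀ t ∈ Ioo a b, K t * L t = 1) {t : ℝ} (ht : t ∈ Ioo a b) :
    K t * Ψ t = Ψ' t * K s := by
  have h1 : Ψ t * L s = L t * Ψ' t := by
    rw [← h.mul_mul_eq h' hs hL ht, Matrix.mul_assoc, ← Matrix.mul_assoc (Ψ t),
      mul_eq_one_comm.1 (h.mul_eq_one hs ht), Matrix.one_mul]
  calc K t * Ψ t = K t * (Ψ t * L s) * K s := by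
        rw [Matrix.mul_assoc, Matrix.mul_assoc (Ψ t), mul_eq_one_comm.1 (hK s hs), Matrix.mul_one]
    _ = K t * (L t * Ψ' t) * K s := by rw [h1]
    _ = Ψ' t * K s := by rw [← Matrix.mul_assoc, hK t ht, Matrix.one_mul]

theorem IsFrame.mono (h : IsFrame G s (Ioo a b) Φ Ψ) {a' b' : ℝ} (ha : a ≤ a') (hb : b' ≤ b) :
    IsFrame G s (Ioo a' b') Φ Ψ :=
  ⟨h.left_one, h.right_one, fun t ht => h.left_deriv t (Ioo_subset_Ioo ha hb ht),
    fun t ht => h.right_deriv t (Ioo_subset_Ioo ha hb ht)⟩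

theorem IsFrame.of_solutions {X Y : ℝ → Fin n → Fin n → ℝ} {I : Set ℝ}
    (hX0 : ∀ i j, X s i j = if i = j then 1 else 0) (hY0 : ∀ i j, Y s i j = if i = j then 1 else 0)
    (hX : ∀ t ∈ I, ∀ i j, HasDerivAt (fun τ => X τ i j) (∑ l, X t i l * G t l j) t)
    (hY : ∀ t ∈ I, ∀ i j, HasDerivAt (fun τ => Y τ i j) (∑ l, Y t i l * -G t j l) t) :
    IsFrame G s I (fun t => Matrix.of (X t)) (fun t => (Matrix.of (Y t)).transpose) where
  left_one := by ext i j; simp [hX0, Matrix.one_apply]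
  right_one := by ext i j; simp [hY0, Matrix.one_apply, eq_comm]
  left_deriv t ht i j := by simpa [Matrix.mul_apply] using hX t ht i j
  right_deriv t ht i j := by
    simpa [Matrix.mul_apply, mul_comm] using hY t ht j i

theorem exists_isFrame_of_contDiffAt (hG : ∀ i j, ContDiffAt ℝ ∞ (fun t => G t i j) s) :
    ∃ a b Φ Ψ, a < s ∧ s < b ∧ IsFrame G s (Ioo a b) Φ Ψ := by
  obtain ⟨a, b, ha, hb, X, hX0, hX⟩ := exists_frame_of_contDiffAt hG
  obtain ⟨a', b', ha', hb', Y, hY0, hY⟩ := exists_frame_of_contDiffAt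
    (G := fun t i j => -G t j i) (fun i j => (hG j i).neg)
  exact ⟨max a a', min b b', _, _, max_lt ha ha', lt_min hb hb', IsFrame.of_solutions hX0 hY0
    (fun t ht => hX t ⟨(le_max_left _ _).trans_lt ht.1, ht.2.trans_le (min_le_left _ _)⟩)
    (fun t ht => hY t ⟨(le_max_right _ _).trans_lt ht.1, ht.2.trans_le (min_le_right _ _)⟩)⟩

theorem exists_isFrame_of_holExt {c : ℝ} (hcs : c ≤ s) (hG : ∀ i j, HolExt c s fun t => G t i j) :
    ∃ a b Φ Ψ, a < c ∧ s < b ∧ IsFrame G s (Ioo a b) Φ Ψ ∧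
      (∀ i j, HolExt c s fun t => Φ t i j) ∧ ∀ i j, HolExt c s fun t => Ψ t i j := by
  obtain ⟨a, b, ha, hb, X, hX0, hX, hXc⟩ := exists_frame_of_holExt hcs hG
  obtain ⟨a', b', ha', hb', Y, hY0, hY, hYc⟩ := exists_frame_of_holExt hcs
    (G := fun t i j => -G t j i) (fun i j => by simpa using (HolExt.const (-1)).mul (hG j i))
  exact ⟨max a a', min b b', _, _, max_lt ha ha', lt_min hb hb', IsFrame.of_solutions hX0 hY0
    (fun t ht => hX t ⟨(le_max_left _ _).trans_lt ht.1, ht.2.trans_le (min_le_left _ _)⟩)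
    (fun t ht => hY t ⟨(le_max_right _ _).trans_lt ht.1, ht.2.trans_le (min_le_right _ _)⟩),
    hXc, fun i j => hYc j i⟩

/-- Near `s` the k-th derivative of Φ is ΦP^{<k>}: differentiating gives Φ(GP^{<k>} + Ṗ^{<k>}),
which is the recursion for P. At `s` the factor Φ is 1. -/
theorem IsFrame.iteratedDeriv_left (h : IsFrame G s (Ioo a b) Φ Ψ) (hs : s ∈ Ioo a b)
    (hG : ∀ i j, ContDiffAt ℝ ∞ (fun t => G t i j) s) (k : ℕ) (i j : Fin n) :
    iteratedDeriv k (fun t => Φ t i j) s = symbP G k s i j := by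
  have key : ∀ k, ∀ᶠ t in 𝓝 s, ∀ i j,
      iteratedDeriv k (fun τ => Φ τ i j) t = ∑ l, Φ t i l * symbP G k t l j := by
    intro k
    induction k with
    | zero => exact Eventually.of_forall fun t i j => by simp [symbP]
    | succ k ih =>
      have hP : ∀ᶠ t in 𝓝 s, ∀ i j, DifferentiableAt ℝ (fun t => symbP G k t i j) t :=
        eventually_all.2 fun i => eventually_all.2 fun j =>
          (contDiffAt_symbP hG k i j).eventually_differentiableAt
      filter_upwards [ih.eventually_nhds, hP, isOpen_Ioo.mem_nhds hs] with t ht hPt hI i j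
      have h1 : iteratedDeriv k (fun τ => Φ τ i j) =ᶠ[𝓝 t]
          fun τ => ∑ l, Φ τ i l * symbP G k τ l j := by
        filter_upwards [ht] with τ hτ using hτ i j
      rw [iteratedDeriv_succ, h1.deriv_eq]
      have h2 : HasDerivAt (fun τ => ∑ l, Φ τ i l * symbP G k τ l j)
          (∑ l, ((Φ t * Matrix.of (G t)) i l * symbP G k t l j +
            Φ t i l * deriv (fun τ => symbP G k τ l j) t)) t :=
        HasDerivAt.fun_sum fun l _ => (h.left_deriv t hI i l).mul (hPt l j).hasDerivAt
      rw [h2.deriv, Finset.sum_add_distrib]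
      simp only [symbP, mul_add, Finset.sum_add_distrib, Matrix.mul_apply, Matrix.of_apply,
        Finset.sum_mul, Finset.mul_sum]
      rw [add_comm]
      congr 1
      rw [Finset.sum_comm]
      exact Finset.sum_congr rfl fun l _ => Finset.sum_congr rfl fun m _ => by ring
  rw [(key k).self_of_nhds i j, h.left_one]
  simp [Matrix.one_apply]

/-- Here the k-th derivative of Ψ is Q^{<k>}Ψ, with Ψ on the other side; this matches the order of
the factors in the recursion for Q. -/
theorem IsFrame.iteratedDeriv_right (h : IsFrame G s (Ioo a b) Φ Ψ) (hs : s ∈ Ioo a b)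
    (hG : ∀ i j, ContDiffAt ℝ ∞ (fun t => G t i j) s) (k : ℕ) (i j : Fin n) :
    iteratedDeriv k (fun t => Ψ t i j) s = symbQ G k s i j := by
  have key : ∀ k, ∀ᶠ t in 𝓝 s, ∀ i j,
      iteratedDeriv k (fun τ => Ψ τ i j) t = ∑ l, symbQ G k t i l * Ψ t l j := by
    intro k
    induction k with
    | zero => exact Eventually.of_forall fun t i j => by simp [symbQ]
    | succ k ih =>
      have hP : ∀ᶠ t in 𝓝 s, ∀ i j, DifferentiableAt ℝ (fun t => symbQ G k t i j) t :=
        eventually_all.2 fun i => eventually_all.2 fun j =>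
          (contDiffAt_symbQ hG k i j).eventually_differentiableAt
      filter_upwards [ih.eventually_nhds, hP, isOpen_Ioo.mem_nhds hs] with t ht hPt hI i j
      have h1 : iteratedDeriv k (fun τ => Ψ τ i j) =ᶠ[𝓝 t]
          fun τ => ∑ l, symbQ G k τ i l * Ψ τ l j := by
        filter_upwards [ht] with τ hτ using hτ i j
      rw [iteratedDeriv_succ, h1.deriv_eq]
      have h2 : HasDerivAt (fun τ => ∑ l, symbQ G k τ i l * Ψ τ l j)
          (∑ l, (deriv (fun τ => symbQ G k τ i l) t * Ψ t l j +
            symbQ G k t i l * (-(Matrix.of (G t) * Ψ t)) l j)) t :=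
        HasDerivAt.fun_sum fun l _ => (hPt i l).hasDerivAt.mul (h.right_deriv t hI l j)
      rw [h2.deriv, Finset.sum_add_distrib]
      simp only [symbQ, add_mul, Finset.sum_add_distrib, Matrix.mul_apply, Matrix.of_apply,
        Finset.sum_mul, Finset.mul_sum, Matrix.neg_apply, ← Finset.sum_neg_distrib]
      congr 1
      rw [Finset.sum_comm]
      exact Finset.sum_congr rfl fun l _ => Finset.sum_congr rfl fun m _ => by ring
  rw [(key k).self_of_nhds i j, h.right_one]
  simp [Matrix.one_apply]

theorem IsFrame.contDiffAt_left (h : IsFrame G s (Ioo a b) Φ Ψ) (hs : s ∈ Ioo a b)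
    (hG : ∀ i j, ContDiffAt ℝ ∞ (fun t => G t i j) s) (i j : Fin n) :
    ContDiffAt ℝ ∞ (fun t => Φ t i j) s := by
  refine contDiffAt_of_linear (Φ := fun j t => Φ t i j) (H := fun l j t => G t l j) hG ?_ j
  filter_upwards [isOpen_Ioo.mem_nhds hs] with t ht j
  simpa [Matrix.mul_apply] using h.left_deriv t ht i j

theorem IsFrame.contDiffAt_right (h : IsFrame G s (Ioo a b) Φ Ψ) (hs : s ∈ Ioo a b)
    (hG : ∀ i j, ContDiffAt ℝ ∞ (fun t => G t i j) s) (i j : Fin n) :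
    ContDiffAt ℝ ∞ (fun t => Ψ t i j) s := by
  refine contDiffAt_of_linear (Φ := fun i t => Ψ t i j) (H := fun l i t => -G t i l)
    (fun l i => (hG i l).neg) ?_ i
  filter_upwards [isOpen_Ioo.mem_nhds hs] with t ht i
  simpa [Matrix.mul_apply, mul_comm] using h.right_deriv t ht i j

end Transport

/-! ### Taylor coefficients of products -/

section Taylor

/-- The `k`-th Taylor coefficient of `f` at `s`. -/
def taylorC (f : ℝ → ℝ) (s : ℝ) (k : ℕ) : ℝ := iteratedDeriv k f s / k.factorial

theorem taylorC_mul {f g : ℝ → ℝ} {s : ℝ} (hf : ContDiffAt ℝ ∞ f s) (hg : ContDiffAt ℝ ∞ g s)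
    (a : ℕ) : taylorC (fun t => f t * g t) s a =
      ∑ p ∈ Finset.HasAntidiagonal.antidiagonal a, taylorC f s p.1 * taylorC g s p.2 := by
  unfold taylorC
  rw [iteratedDeriv_fun_mul (hf.of_le (by exact_mod_cast le_top))
    (hg.of_le (by exact_mod_cast le_top)), Finset.Nat.sum_antidiagonal_eq_sum_range_succ_mk,
    Finset.sum_div]
  refine Finset.sum_congr rfl fun k hk => ?_
  have hk' : k ≤ a := Nat.lt_succ_iff.1 (Finset.mem_range.1 hk)
  rw [Nat.cast_choose ℝ hk']
  have h1 : (a.factorial : ℝ) ≠ 0 := by positivity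
  field_simp

theorem taylorC_prod {ι : Type*} [DecidableEq ι] (S : Finset ι) {f : ι → ℝ → ℝ} {s : ℝ}
    (hf : ∀ i, ContDiffAt ℝ ∞ (f i) s) (a : ℕ) :
    taylorC (fun t => ∏ i ∈ S, f i t) s a =
      ∑ w ∈ Finset.piAntidiag S a, ∏ i ∈ S, taylorC (f i) s (w i) := by
  induction S using Finset.cons_induction generalizing a with
  | empty =>
    rw [Finset.piAntidiag_empty]
    rcases eq_or_ne a 0 with rfl | ha
    · simp [taylorC]
    · simp [taylorC, ha, iteratedDeriv_const]
  | cons i S hi ih =>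
    rw [Finset.piAntidiag_cons, Finset.sum_disjiUnion]
    simp_rw [Finset.prod_cons]
    rw [taylorC_mul (hf i) (contDiffAt_prod fun i _ => hf i)]
    refine Finset.sum_congr rfl fun p _ => ?_
    rw [Finset.sum_map, ih, Finset.mul_sum]
    refine Finset.sum_congr rfl fun w hw => ?_
    have hwi : w i = 0 := by
      by_contra h
      exact hi ((Finset.mem_piAntidiag.1 hw).2 i h)
    have h1 : ∀ k ∈ S, (addRightEmbedding fun t => if t = i then p.1 else 0) w k = w k := by
      intro k hk
      have : k ≠ i := fun h => hi (h ▸ hk)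
      simp [this]
    have h2 : ∏ k ∈ S, taylorC (f k) s ((addRightEmbedding fun t => if t = i then p.1 else 0) w k) =
        ∏ k ∈ S, taylorC (f k) s (w k) := Finset.prod_congr rfl fun k hk => by rw [h1 k hk]
    rw [h2]
    simp [hwi]

end Taylor

/-! ### The series as a formal Leibniz series -/

section Kernel

variable {n p q : ℕ}

/-- The action of a pair of matrices on the components of tensors of type `(p, q)`. -/
def tensorKer (X Y : Matrix (Fin n) (Fin n) ℝ) (j : Fin p → Fin n) (i : Fin q → Fin n)
    (u : Fin p → Fin n) (v : Fin q → Fin n) : ℝ :=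
  (∏ k, X (j k) (u k)) * ∏ k, Y (v k) (i k)

theorem tensorKer_mul (X Y X' Y' : Matrix (Fin n) (Fin n) ℝ) (j : Fin p → Fin n)
    (i : Fin q → Fin n) (u : Fin p → Fin n) (v : Fin q → Fin n) :
    tensorKer (X * X') (Y' * Y) j i u v =
      ∑ r, ∑ a, tensorKer X Y j i r a * tensorKer X' Y' r a u v := by
  classical
  simp only [tensorKer, Matrix.mul_apply, Finset.prod_univ_sum, Fintype.piFinset_univ]
  rw [Finset.sum_mul_sum]
  refine Finset.sum_congr rfl fun r _ => Finset.sum_congr rfl fun a _ => ?_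
  simp only [Finset.prod_mul_distrib]
  ring

variable {G : ℝ → Fin n → Fin n → ℝ} {s a b : ℝ} {Φ Ψ : ℝ → Matrix (Fin n) (Fin n) ℝ}

theorem tensorKer_eq_prod (j : Fin p → Fin n) (i : Fin q → Fin n) (u : Fin p → Fin n)
    (v : Fin q → Fin n) (t : ℝ) : tensorKer (Φ t) (Ψ t) j i u v =
      ∏ k, Sum.elim (fun k t => Φ t (j k) (u k)) (fun k t => Ψ t (v k) (i k)) k t := by
  simp [tensorKer]

theorem IsFrame.contDiffAt_tensorKer (h : IsFrame G s (Ioo a b) Φ Ψ) (hs : s ∈ Ioo a b)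
    (hG : ∀ i j, ContDiffAt ℝ ∞ (fun t => G t i j) s) (j : Fin p → Fin n) (i : Fin q → Fin n)
    (u : Fin p → Fin n) (v : Fin q → Fin n) :
    ContDiffAt ℝ ∞ (fun t => tensorKer (Φ t) (Ψ t) j i u v) s :=
  (contDiffAt_prod fun _ _ => h.contDiffAt_left hs hG _ _).mul
    (contDiffAt_prod fun _ _ => h.contDiffAt_right hs hG _ _)

/-- The sum over m₁,…,l_q with the factorials is the Cauchy product of the Taylor series of the
entries of Φ and Ψ, hence a Taylor coefficient of their product. What remains is the term of index
`m` of the Leibniz series. -/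
theorem IsFrame.nablaTerm_eq (h : IsFrame G s (Ioo a b) Φ Ψ) (hs : s ∈ Ioo a b)
    (hG : ∀ i j, ContDiffAt ℝ ∞ (fun t => G t i j) s) (c α : ℝ)
    (A : ℝ → (Fin p → Fin n) → (Fin q → Fin n) → ℝ) (j : Fin p → Fin n) (i : Fin q → Fin n)
    (m : ℕ) : nablaTerm c α G A s j i m = ∑ u, ∑ v, (∏ r ∈ Finset.range m, (α - r)) *
      taylorC (fun t => tensorKer (Φ t) (Ψ t) j i u v) s m *
      fracDeriv c (α - m) (fun t => A t u v) s := by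
  unfold nablaTerm
  rw [Finset.sum_comm]
  refine Finset.sum_congr rfl fun u _ => ?_
  rw [Finset.sum_comm]
  refine Finset.sum_congr rfl fun v _ => ?_
  simp_rw [tensorKer_eq_prod]
  rw [taylorC_prod]
  · rw [Finset.mul_sum, Finset.sum_mul]
    refine Finset.sum_congr rfl fun w _ => ?_
    simp only [taylorC, Fintype.prod_sum_type, Sum.elim_inl, Sum.elim_inr,
      h.iteratedDeriv_left hs hG, h.iteratedDeriv_right hs hG, Finset.prod_div_distrib]
    ring
  · rintro (k | k)
    · exact h.contDiffAt_left hs hG _ _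
    · exact h.contDiffAt_right hs hG _ _

end Kernel

/-! ### Weights from the logarithmic distribution -/

section Weights

/-- The probabilities of the logarithmic distribution with parameter `η`. -/
def logProb (η : ℝ) (n : ℕ) : ℝ := η ^ n / n / -Real.log (1 - η)

/-- The probabilities of the sum of `k` independent logarithmic random variables. -/
def logConv (η : ℝ) : ℕ → ℕ → ℝ
  | 0 => fun n => if n = 0 then 1 else 0
  | k + 1 => fun n => ∑ ij ∈ Finset.HasAntidiagonal.antidiagonal n,
      logConv η k ij.1 * logProb η ij.2

/-- The distribution functions of the sum of `k` independent logarithmic random variables. -/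
def logCdf (η : ℝ) (N k : ℕ) : ℝ := ∑ n ∈ Finset.range (N + 1), logConv η k n

/-- The probability generating function of the logarithmic distribution. -/
def logGen (η : ℝ) (z : ℂ) : ℂ := -Complex.log (1 - η * z) / (-Real.log (1 - η) : ℝ)

variable {η : ℝ}

theorem neg_log_one_sub_pos (h0 : 0 < η) (h1 : η < 1) : 0 < -Real.log (1 - η) := by
  have := Real.log_neg (by linarith : 0 < 1 - η) (by linarith)
  linarith

theorem logProb_nonneg (h0 : 0 < η) (h1 : η < 1) (n : ℕ) : 0 ≤ logProb η n :=
  div_nonneg (by positivity) (neg_log_one_sub_pos h0 h1).le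

theorem logConv_nonneg (h0 : 0 < η) (h1 : η < 1) (k n : ℕ) : 0 ≤ logConv η k n := by
  induction k generalizing n with
  | zero => simp only [logConv]; split_ifs <;> norm_num
  | succ k ih => exact Finset.sum_nonneg fun ij _ => mul_nonneg (ih _) (logProb_nonneg h0 h1 _)

theorem logConv_eq_zero (k n : ℕ) (h : n < k) : logConv η k n = 0 := by
  induction k generalizing n with
  | zero => omega
  | succ k ih =>
    refine Finset.sum_eq_zero fun ij hij => ?_
    have := Finset.HasAntidiagonal.mem_antidiagonal.1 hij
    rcases Nat.eq_zero_or_pos ij.2 with h2 | h2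
    · simp [logProb, h2]
    · rw [ih _ (by omega), zero_mul]

theorem hasSum_logProb {z : ℂ} (h0 : 0 < η) (hz : η * ‖z‖ < 1) :
    HasSum (fun n => (logProb η n : ℂ) * z ^ n) (logGen η z) := by
  have h : ‖(η : ℂ) * z‖ < 1 := by simpa [abs_of_pos h0] using hz
  have := (Complex.hasSum_taylorSeries_neg_log h).div_const ((-Real.log (1 - η) : ℝ) : ℂ)
  refine this.congr_fun fun n => ?_
  simp only [logProb, mul_pow]
  push_cast
  ring

theorem summable_norm_logProb {z : ℂ} (h0 : 0 < η) (hz : η * ‖z‖ < 1) :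
    Summable fun n => ‖(logProb η n : ℂ) * z ^ n‖ :=
  (hasSum_logProb h0 hz).summable.norm

/-- A convolution has the product of the generating functions, here as an absolutely convergent
Cauchy product. -/
theorem hasSum_logConv {z : ℂ} (h0 : 0 < η) (hz : η * ‖z‖ < 1) (k : ℕ) :
    HasSum (fun n => (logConv η k n : ℂ) * z ^ n) (logGen η z ^ k) := by
  induction k with
  | zero =>
    simp only [logConv, pow_zero]
    convert hasSum_ite_eq (0 : ℕ) (1 : ℂ) using 2 with n
    split_ifs with h <;> simp [h]
  | succ k ih =>
    have h1 := summable_norm_sum_mul_antidiagonal_of_summable_norm ih.summable.norm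
      (summable_norm_logProb h0 hz)
    have h2 := tsum_mul_tsum_eq_tsum_sum_antidiagonal_of_summable_norm ih.summable.norm
      (summable_norm_logProb h0 hz)
    rw [ih.tsum_eq, (hasSum_logProb h0 hz).tsum_eq, ← pow_succ] at h2
    have h3 := h1.of_norm.hasSum
    rw [← h2] at h3
    refine h3.congr_fun fun n => ?_
    simp only [logConv]
    push_cast
    rw [Finset.sum_mul]
    refine Finset.sum_congr rfl fun ij hij => ?_
    rw [← Finset.HasAntidiagonal.mem_antidiagonal.1 hij, pow_add]
    ring

theorem logGen_one (h0 : 0 < η) (h1 : η < 1) : logGen η 1 = 1 := by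
  unfold logGen
  have h2 := (neg_log_one_sub_pos h0 h1).ne'
  have h3 : Complex.log (1 - η * 1) = (Real.log (1 - η) : ℝ) := by
    rw [Complex.ofReal_log (by linarith)]
    push_cast
    ring_nf
  rw [h3, Complex.ofReal_neg]
  refine div_self ?_
  exact_mod_cast h2

theorem hasSum_logConv_one (h0 : 0 < η) (h1 : η < 1) (k : ℕ) :
    HasSum (fun n => logConv η k n) 1 := by
  have := hasSum_logConv (z := 1) h0 (by simpa using h1) k
  rw [logGen_one h0 h1, one_pow] at this
  simp only [one_pow, mul_one] at this
  exact Complex.hasSum_ofReal.1 (by simpa using this)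

theorem hasSum_logProb_one (h0 : 0 < η) (h1 : η < 1) : HasSum (logProb η) 1 := by
  have := hasSum_logProb (z := 1) h0 (by simpa using h1)
  rw [logGen_one h0 h1] at this
  simp only [one_pow, mul_one] at this
  exact Complex.hasSum_ofReal.1 (by simpa using this)

theorem tendsto_logCdf (h0 : 0 < η) (h1 : η < 1) (k : ℕ) :
    Tendsto (fun N => logCdf η N k) atTop (𝓝 1) :=
  (hasSum_logConv_one h0 h1 k).tendsto_sum_nat.comp (tendsto_add_atTop_nat 1)

theorem logCdf_eq_zero {N k : ℕ} (h : N < k) : logCdf η N k = 0 :=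
  Finset.sum_eq_zero fun n hn => logConv_eq_zero _ _ (by have := Finset.mem_range.1 hn; omega)

theorem logCdf_zero (N : ℕ) : logCdf η N 0 = 1 := by
  simp [logCdf, logConv]

/-- A further nonnegative summand can only decrease the distribution function: for a fixed value of
the first `k` summands, the last one contributes a partial sum of probabilities, at most 1. -/
theorem logCdf_succ_le (h0 : 0 < η) (h1 : η < 1) (N k : ℕ) :
    logCdf η N (k + 1) ≤ logCdf η N k := by
  unfold logCdf
  simp only [logConv]
  simp_rw [Finset.Nat.sum_antidiagonal_eq_sum_range_succ_mk]
  rw [Finset.sum_comm' (t' := Finset.range (N + 1)) (s' := fun i => Finset.Ico i (N + 1))]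
  · refine Finset.sum_le_sum fun i _ => ?_
    rw [← Finset.mul_sum]
    refine mul_le_of_le_one_right (logConv_nonneg h0 h1 _ _) ?_
    rw [Finset.sum_Ico_eq_sum_range]
    simp only [Nat.add_sub_cancel_left]
    exact sum_le_hasSum _ (fun n _ => logProb_nonneg h0 h1 n) (hasSum_logProb_one h0 h1)
  · intro n i
    simp only [Finset.mem_range, Finset.mem_Ico]
    omega

end Weights

/-! ### Regularity of the summation method -/

section Regularity

/-- Weighted sums of a convergent series tend to its sum if the weights decrease to `0` and
tend to `1`. -/
theorem tendsto_weighted_sum {c : ℕ → ℕ → ℝ} (hc0 : ∀ N, c N 0 = 1)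
    (hcN : ∀ N k, N < k → c N k = 0) (hanti : ∀ N k, c N (k + 1) ≤ c N k)
    (hlim : ∀ k, Tendsto (fun N => c N k) atTop (𝓝 1)) {b : ℕ → ℂ} {l : ℂ}
    (hb : Tendsto (fun N => ∑ k ∈ Finset.range N, b k) atTop (𝓝 l)) :
    Tendsto (fun N => ∑ k ∈ Finset.range (N + 1), (c N k : ℂ) * b k) atTop (𝓝 l) := by
  set B : ℕ → ℂ := fun k => ∑ i ∈ Finset.range (k + 1), b i with hB
  have hBl : Tendsto B atTop (𝓝 l) := hb.comp (tendsto_add_atTop_nat 1)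
  -- Abel summation, with `B` the partial sums of `b`.
  have habel : ∀ N m, ∑ k ∈ Finset.range (m + 1), (c N k : ℂ) * b k =
      ∑ k ∈ Finset.range m, ((c N k - c N (k + 1) : ℝ) : ℂ) * B k + c N m * B m := by
    intro N m
    induction m with
    | zero => simp [hB]
    | succ m ih =>
      rw [Finset.sum_range_succ, ih, Finset.sum_range_succ _ m]
      have : B (m + 1) = B m + b (m + 1) := Finset.sum_range_succ _ _
      rw [this]
      push_cast
      ring
  -- The differences `c N k - c N (k + 1)` are nonnegative with total 1, so the error is an average
  -- of the `B k - l`. These are small for large `k`, and the mass on each fixed `k` tends to 0.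
  have hform : ∀ N, ∑ k ∈ Finset.range (N + 1), (c N k : ℂ) * b k - l =
      ∑ k ∈ Finset.range (N + 1), ((c N k - c N (k + 1) : ℝ) : ℂ) * (B k - l) := by
    intro N
    have h1 := habel N N
    have h2 : ∑ k ∈ Finset.range (N + 1), (c N k - c N (k + 1)) = 1 := by
      rw [Finset.sum_range_sub', hc0, hcN N _ (Nat.lt_succ_self N), sub_zero]
    simp_rw [mul_sub]
    rw [Finset.sum_sub_distrib, ← Finset.sum_mul, ← Complex.ofReal_sum, h2, h1,
      Finset.sum_range_succ _ N, hcN N (N + 1) (Nat.lt_succ_self N)]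
    simp
  rw [← tendsto_sub_nhds_zero_iff]
  simp_rw [hform]
  rw [Metric.tendsto_atTop]
  intro ε hε
  obtain ⟨K, hK⟩ := Metric.tendsto_atTop.1 hBl (ε / 2) (by linarith)
  have hhead : Tendsto (fun N => ∑ k ∈ Finset.range K,
      (c N k - c N (k + 1)) * ‖B k - l‖) atTop (𝓝 0) := by
    have : Tendsto (fun N => ∑ k ∈ Finset.range K,
        (c N k - c N (k + 1)) * ‖B k - l‖) atTop (𝓝 (∑ k ∈ Finset.range K,
        ((1 : ℝ) - 1) * ‖B k - l‖)) :=
      tendsto_finsetSum _ fun k _ => ((hlim k).sub (hlim (k + 1))).mul_const _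
    simpa using this
  obtain ⟨N₀, hN₀⟩ := Metric.tendsto_atTop.1 hhead (ε / 2) (by linarith)
  refine ⟨max N₀ K, fun N hN => ?_⟩
  have hN1 := hN₀ N ((le_max_left _ _).trans hN)
  have hN2 : K ≤ N + 1 := ((le_max_right _ _).trans hN).trans (Nat.le_succ N)
  rw [dist_zero_right] at hN1 ⊢
  have hd : ∀ k, 0 ≤ c N k - c N (k + 1) := fun k => sub_nonneg.2 (hanti N k)
  have hle : ‖∑ k ∈ Finset.range (N + 1), ((c N k - c N (k + 1) : ℝ) : ℂ) * (B k - l)‖ ≤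
      ∑ k ∈ Finset.range (N + 1), (c N k - c N (k + 1)) * ‖B k - l‖ := by
    refine (norm_sum_le _ _).trans (Finset.sum_le_sum fun k _ => ?_)
    rw [norm_mul, Complex.norm_real, Real.norm_of_nonneg (hd k)]
  refine hle.trans_lt ?_
  rw [← Finset.sum_range_add_sum_Ico _ hN2]
  have htail : ∑ k ∈ Finset.Ico K (N + 1), (c N k - c N (k + 1)) * ‖B k - l‖ ≤ ε / 2 := by
    calc _ ≤ ∑ k ∈ Finset.Ico K (N + 1), (c N k - c N (k + 1)) * (ε / 2) := by
          refine Finset.sum_le_sum fun k hk => mul_le_mul_of_nonneg_left ?_ (hd k)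
          have := hK k (Finset.mem_Ico.1 hk).1
          rw [dist_eq_norm] at this
          exact this.le
      _ ≤ ∑ k ∈ Finset.range (N + 1), (c N k - c N (k + 1)) * (ε / 2) :=
          Finset.sum_le_sum_of_subset_of_nonneg
            (fun k hk => Finset.mem_range.2 (Finset.mem_Ico.1 hk).2)
            fun k _ _ => mul_nonneg (hd k) (by linarith)
      _ = ε / 2 := by
          rw [← Finset.sum_mul, Finset.sum_range_sub', hc0, hcN N _ (Nat.lt_succ_self N)]
          ring
  have := (le_abs_self _).trans_lt hN1
  linarith

end Regularity

/-! ### Summing a Taylor series beyond its disc of convergence -/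

section Summation

/-- The logarithmic generating function maps a disc of radius greater than `1` into a given
neighbourhood of the unit interval. -/
theorem exists_logGen_mem_thickening {ρ ε : ℝ} (hρ : 0 < ρ) (hε : 0 < ε) :
    ∃ η R : ℝ, 0 < η ∧ η < 1 ∧ 1 < R ∧ η * R < 1 ∧ ∀ z : ℂ, ‖z‖ < R → ∀ x ∈ Icc 0 ρ,
      (x : ℂ) * logGen η z ∈ Metric.thickening ε ((fun t : ℝ => (t : ℂ)) '' Icc 0 ρ) := by
  -- `Λ` will be `-log (1 - η)`. The value `-log (1 - η z)` stays within `log 2 + π` of the segment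
  -- `[0, Λ]`; after division by `Λ` and multiplication by `x ≤ ρ` this error is below `ε`.
  set Λ : ℝ := ρ * (Real.log 2 + Real.pi) / ε + 1 with hΛ
  have hlog2 : 0 < Real.log 2 := Real.log_pos (by norm_num)
  have hpi := Real.pi_pos
  have hΛ0 : 0 < Λ := by positivity
  have hexp : Real.exp (-Λ) < 1 := by simpa using hΛ0
  have hexp0 := Real.exp_pos (-Λ)
  set η : ℝ := 1 - Real.exp (-Λ) with hη
  have hη0 : 0 < η := by linarith
  have hη1 : η < 1 := by linarith
  have hL : -Real.log (1 - η) = Λ := by rw [hη]; simp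
  -- With this radius `η R = (1 + η) / 2` lies strictly between `η` and 1, so `R > 1` while `1 - η
  -- z` stays away from 0.
  refine ⟨η, (1 + η) / (2 * η), hη0, hη1, ?_, ?_, ?_⟩
  · rw [lt_div_iff₀ (by positivity)]; linarith
  · rw [mul_div_assoc', div_lt_iff₀ (by positivity)]; nlinarith
  intro z hz x hx
  have hz' : ‖(η : ℂ) * z‖ < (1 + η) / 2 := by
    rw [norm_mul, Complex.norm_real, Real.norm_of_nonneg hη0.le]
    calc η * ‖z‖ < η * ((1 + η) / (2 * η)) := by gcongr
      _ = (1 + η) / 2 := by field_simp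
  set w : ℂ := Complex.log (1 - η * z) with hw
  have hn1 : (1 - η) / 2 ≤ ‖1 - (η : ℂ) * z‖ := by
    have := norm_sub_norm_le (1 : ℂ) (η * z)
    rw [norm_one] at this
    linarith
  have hn2 : ‖1 - (η : ℂ) * z‖ ≤ 2 := by
    have := norm_sub_le (1 : ℂ) (η * z)
    rw [norm_one] at this
    linarith
  have hre1 : -w.re ≤ Λ + Real.log 2 := by
    rw [hw, Complex.log_re]
    have h1 := Real.log_le_log (by linarith) hn1
    rw [Real.log_div (by linarith) (by norm_num)] at h1
    linarith
  have hre2 : -Real.log 2 ≤ -w.re := by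
    rw [hw, Complex.log_re]
    have h1 := Real.log_le_log (by linarith) hn2
    linarith
  have him : |w.im| ≤ Real.pi := by
    rw [hw, Complex.log_im]
    exact Complex.abs_arg_le_pi _
  have hgen : logGen η z = -w / Λ := by rw [logGen, hL]
  -- The real part of `-w` clamped to `[0, Λ]`; `x * (r / Λ)` is the nearby point of `[0, ρ]`.
  set r : ℝ := max 0 (min Λ (-w.re)) with hr
  have hr0 : 0 ≤ r := le_max_left _ _
  have hr1 : r ≤ Λ := max_le hΛ0.le (min_le_left _ _)
  have hdist : |-w.re - r| ≤ Real.log 2 := by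
    rw [hr, abs_le]
    rcases le_total Λ (-w.re) with h | h
    · rw [min_eq_left h, max_eq_right hΛ0.le]
      constructor <;> linarith
    · rw [min_eq_right h]
      rcases le_total 0 (-w.re) with h' | h'
      · rw [max_eq_right h']
        constructor <;> linarith
      · rw [max_eq_left h']
        constructor <;> linarith
  rw [Metric.mem_thickening_iff]
  refine ⟨((x * (r / Λ) : ℝ) : ℂ), ⟨x * (r / Λ), ⟨by have := hx.1; positivity, ?_⟩, rfl⟩, ?_⟩
  · exact (mul_le_of_le_one_right hx.1 ((div_le_one hΛ0).2 hr1)).trans hx.2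
  · rw [dist_eq_norm, hgen]
    have h1 : (x : ℂ) * (-w / Λ) - ((x * (r / Λ) : ℝ) : ℂ) = ((x / Λ : ℝ) : ℂ) * (-w - r) := by
      push_cast
      have : (Λ : ℂ) ≠ 0 := by exact_mod_cast hΛ0.ne'
      field_simp
    have h2 : ‖-w - (r : ℂ)‖ ≤ Real.log 2 + Real.pi := by
      refine (Complex.norm_le_abs_re_add_abs_im _).trans ?_
      simp only [Complex.sub_re, Complex.neg_re, Complex.ofReal_re, Complex.sub_im,
        Complex.neg_im, Complex.ofReal_im, sub_zero, abs_neg]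
      linarith
    rw [h1, norm_mul, Complex.norm_real, Real.norm_of_nonneg (div_nonneg hx.1 hΛ0.le)]
    calc x / Λ * ‖-w - (r : ℂ)‖ ≤ ρ / Λ * (Real.log 2 + Real.pi) := by
          have := hx.2
          gcongr
      _ < ε := by
          rw [div_mul_eq_mul_div, div_lt_iff₀ hΛ0, hΛ, mul_add ε, mul_div_cancel₀ _ hε.ne']
          linarith

variable {η : ℝ}

/-- For small `z` the power series of `f` may be composed with the powers of `logGen η`, and the
double series rearranged by powers of `z`. The inner sums are finite because `logConv η k n = 0` for
`n < k`. -/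
theorem hasFPowerSeriesAt_comp_logGen (h0 : 0 < η) (h1 : η < 1) {f : ℂ → ℂ}
    {p : FormalMultilinearSeries ℂ ℂ ℂ} (hp : HasFPowerSeriesAt f p 0) (x : ℝ) :
    HasFPowerSeriesAt (fun z => f (x * logGen η z))
      (FormalMultilinearSeries.ofScalars ℂ fun n =>
        ∑ k ∈ Finset.range (n + 1), p.coeff k * (x : ℂ) ^ k * (logConv η k n : ℂ)) 0 := by
  obtain ⟨r, hr⟩ := hp
  obtain ⟨δ, hδ0, hδr⟩ := ENNReal.lt_iff_exists_nnreal_btwn.1 hr.r_pos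
  have hδ0 : 0 < δ := by exact_mod_cast hδ0
  have hsum : Summable fun k => ‖p.coeff k‖ * (δ : ℝ) ^ k := by
    refine (p.summable_norm_mul_pow (lt_of_lt_of_le hδr hr.r_le)).congr fun k => ?_
    rw [p.norm_apply_eq_norm_coef]
  have hgen0 : logGen η 0 = 0 := by simp [logGen]
  have hcont : ContinuousAt (logGen η) 0 := by
    unfold logGen
    refine ContinuousAt.div_const (ContinuousAt.neg (ContinuousAt.clog (by fun_prop) ?_)) _
    simp
  have hsmall : ∀ᶠ z : ℂ in 𝓝 0, η * ‖z‖ < 1 ∧ ‖(x : ℂ) * logGen η (‖z‖ : ℂ)‖ < δ ∧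
      ‖(x : ℂ) * logGen η z‖ < δ := by
    refine Filter.Eventually.and ?_ (Filter.Eventually.and ?_ ?_)
    · have : ContinuousAt (fun z : ℂ => η * ‖z‖) 0 := by fun_prop
      exact this.eventually_lt_const (by simp)
    · have h2 : ContinuousAt (fun z : ℂ => logGen η (‖z‖ : ℂ)) 0 :=
        
        ContinuousAt.comp (f := fun z : ℂ => ((‖z‖ : ℝ) : ℂ)) (x := 0) (g := logGen η)
          (by simpa using hcont)
          (Complex.continuous_ofReal.comp continuous_norm).continuousAt
      have : ContinuousAt (fun z : ℂ => ‖(x : ℂ) * logGen η (‖z‖ : ℂ)‖) 0 :=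
        (continuousAt_const.mul h2).norm
      exact this.eventually_lt_const (by simpa [hgen0] using hδ0)
    · have : ContinuousAt (fun z : ℂ => ‖(x : ℂ) * logGen η z‖) 0 :=
        (continuousAt_const.mul hcont).norm
      exact this.eventually_lt_const (by simpa [hgen0] using hδ0)
  rw [hasFPowerSeriesAt_iff]
  filter_upwards [hsmall] with z ⟨hz1, hz2, hz3⟩
  have hf : HasSum (fun k => p.coeff k * ((x : ℂ) * logGen η z) ^ k) (f (x * logGen η z)) := by
    have hmem : (x : ℂ) * logGen η z ∈ Metric.eball (0 : ℂ) r := by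
      rw [Metric.mem_eball, edist_zero_right]
      refine lt_of_le_of_lt ?_ hδr
      rw [enorm_le_coe]
      exact_mod_cast hz3.le
    have := hr.hasSum hmem
    rw [zero_add] at this
    simpa [FormalMultilinearSeries.apply_eq_pow_smul_coeff, mul_comm] using this
  have hF : ∀ k, HasSum (fun n => p.coeff k * (x : ℂ) ^ k * ((logConv η k n : ℂ) * z ^ n))
      (p.coeff k * ((x : ℂ) * logGen η z) ^ k) := by
    intro k
    have := (hasSum_logConv h0 hz1 k).mul_left (p.coeff k * (x : ℂ) ^ k)
    rwa [mul_assoc, ← mul_pow] at this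
  -- The coefficients `logConv` are nonnegative, so the sum of the norms is the same expression at
  -- the point `‖z‖`; this gives absolute convergence of the double series.
  have hnorm : ∀ k, HasSum (fun n => ‖p.coeff k * (x : ℂ) ^ k * ((logConv η k n : ℂ) * z ^ n)‖)
      (‖p.coeff k‖ * ‖(x : ℂ) * logGen η (‖z‖ : ℂ)‖ ^ k) := by
    intro k
    have h2 := hasSum_logConv (z := (‖z‖ : ℂ)) h0 (by simpa using hz1) k
    have h3 := (h2.mul_left (p.coeff k * (x : ℂ) ^ k))
    have h4 : ∀ n, ‖p.coeff k * (x : ℂ) ^ k * ((logConv η k n : ℂ) * z ^ n)‖ =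
        ‖p.coeff k * (x : ℂ) ^ k * ((logConv η k n : ℂ) * (‖z‖ : ℂ) ^ n)‖ := by
      intro n; simp
    have h5 : HasSum (fun n => logConv η k n * ‖z‖ ^ n) (‖logGen η (‖z‖ : ℂ)‖ ^ k) := by
      have h6 : HasSum (fun n => ((logConv η k n * ‖z‖ ^ n : ℝ) : ℂ)) (logGen η (‖z‖ : ℂ) ^ k) := by
        simpa using h2
      have h7 := Complex.hasSum_re h6
      simp only [Complex.ofReal_re] at h7
      convert h7 using 1
      have h8 : HasSum (fun n => ((logConv η k n * ‖z‖ ^ n : ℝ) : ℂ))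
        (((logGen η (‖z‖ : ℂ) ^ k).re : ℝ) : ℂ) := Complex.hasSum_ofReal.2 h7
      have h9 := h8.unique h6
      rw [← norm_pow, ← h9, Complex.norm_real, Complex.ofReal_re, Real.norm_of_nonneg]
      exact h7.nonneg fun n => mul_nonneg (logConv_nonneg h0 h1 _ _) (by positivity)
    have h10 := h5.mul_left (‖p.coeff k‖ * ‖(x : ℂ)‖ ^ k)
    rw [mul_assoc, ← mul_pow, ← norm_mul] at h10
    refine h10.congr_fun fun n => ?_
    rw [norm_mul, norm_mul, norm_mul, norm_pow, norm_pow, Complex.norm_real (logConv η k n),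
      Real.norm_of_nonneg (logConv_nonneg h0 h1 _ _)]
  have hsumm : Summable fun kn : ℕ × ℕ =>
      p.coeff kn.1 * (x : ℂ) ^ kn.1 * ((logConv η kn.1 kn.2 : ℂ) * z ^ kn.2) := by
    refine Summable.of_norm ((summable_prod_of_nonneg fun _ => norm_nonneg _).2
      ⟨fun k => (hnorm k).summable, ?_⟩)
    simp_rw [fun k => (hnorm k).tsum_eq]
    refine Summable.of_nonneg_of_le (fun k => by positivity) (fun k => ?_) hsum
    gcongr
  have hall : HasSum (fun kn : ℕ × ℕ =>
      p.coeff kn.1 * (x : ℂ) ^ kn.1 * ((logConv η kn.1 kn.2 : ℂ) * z ^ kn.2))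
      (f (x * logGen η z)) := by
    have := hsumm.hasSum.prod_fiberwise hF
    rw [← this.unique hf]
    exact hsumm.hasSum
  have hswap := (Equiv.prodComm ℕ ℕ).hasSum_iff.2 hall
  rw [zero_add]
  refine hswap.prod_fiberwise fun n => ?_
  rw [FormalMultilinearSeries.coeff_ofScalars, smul_eq_mul, Finset.mul_sum]
  have : ∀ k, ((fun kn : ℕ × ℕ => p.coeff kn.1 * (x : ℂ) ^ kn.1 *
      ((logConv η kn.1 kn.2 : ℂ) * z ^ kn.2)) ∘ (Equiv.prodComm ℕ ℕ)) (n, k) =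
      z ^ n * (p.coeff k * (x : ℂ) ^ k * (logConv η k n : ℂ)) := by
    intro k; simp only [Function.comp, Equiv.prodComm_apply, Prod.swap]; ring
  simp_rw [this]
  refine hasSum_sum_of_ne_finset_zero fun k hk => ?_
  rw [logConv_eq_zero k n (by simpa using hk)]
  simp

/-- The composite is holomorphic on the disc of radius `R`, so Cauchy's estimate on the circle of
radius `r > 1` makes its coefficients decay geometrically, and its expansion converges at 1, where
`logGen η 1 = 1`. This recovers `f x` even where the Taylor series of `f` diverges; the bound does
not depend on `x`. -/
theorem norm_coeff_comp_logGen_le (h0 : 0 < η) (h1 : η < 1) {f : ℂ → ℂ}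
    {p : FormalMultilinearSeries ℂ ℂ ℂ} (hp : HasFPowerSeriesAt f p 0) {U : Set ℂ} (hU : IsOpen U)
    (hf : DifferentiableOn ℂ f U) {M r R x : ℝ} (hM : ∀ z ∈ U, ‖f z‖ ≤ M) (hr1 : 1 < r)
    (hrR : r < R) (hηR : η * R < 1) (hU' : ∀ z : ℂ, ‖z‖ < R → (x : ℂ) * logGen η z ∈ U) :
    HasSum (fun n => ∑ k ∈ Finset.range (n + 1), p.coeff k * (x : ℂ) ^ k * (logConv η k n : ℂ))
        (f x) ∧
      ∀ n, ‖∑ k ∈ Finset.range (n + 1), p.coeff k * (x : ℂ) ^ k * (logConv η k n : ℂ)‖ ≤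
        M * r⁻¹ ^ n := by
  have hr0 : 0 < r := by linarith
  have hdiff : DifferentiableOn ℂ (fun z => f (x * logGen η z)) (Metric.ball 0 R) := by
    intro z hz
    rw [mem_ball_zero_iff] at hz
    have hg : DifferentiableAt ℂ (fun z => (x : ℂ) * logGen η z) z := by
      unfold logGen
      refine (((DifferentiableAt.clog (by fun_prop) ?_).neg).div_const _).const_mul _
      refine Complex.mem_slitPlane_iff.2 (Or.inl ?_)
      have h2 : (η * z.re) < 1 := by
        calc η * z.re ≤ η * ‖z‖ := by gcongr; exact Complex.re_le_norm z
          _ ≤ η * R := by gcongr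
          _ < 1 := hηR
      simp only [Complex.sub_re, Complex.one_re, Complex.re_ofReal_mul]
      linarith
    exact ((hf.differentiableAt (hU.mem_nhds (hU' z hz))).comp z hg).differentiableWithinAt
  lift r to NNReal using hr0.le
  have hsub : Metric.closedBall (0 : ℂ) r ⊆ Metric.ball 0 R := Metric.closedBall_subset_ball hrR
  have hps := (hdiff.mono hsub).hasFPowerSeriesOnBall (by exact_mod_cast hr0)
  have heq := hps.hasFPowerSeriesAt.eq_formalMultilinearSeries
    (hasFPowerSeriesAt_comp_logGen h0 h1 hp x)
  constructor
  · have h2 : (1 : ℂ) ∈ Metric.eball (0 : ℂ) r := by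
      rw [Metric.mem_eball, edist_zero_right]
      have : ‖(1 : ℂ)‖₊ < r := by simpa using (by exact_mod_cast hr1 : (1 : NNReal) < r)
      exact_mod_cast this
    have h3 := hps.hasSum h2
    rw [heq] at h3
    simpa [FormalMultilinearSeries.apply_eq_pow_smul_coeff, logGen_one h0 h1] using h3
  · intro n
    have h2 := norm_cauchyPowerSeries_le (fun z => f (x * logGen η z)) 0 r n
    rw [heq, FormalMultilinearSeries.norm_apply_eq_norm_coef,
      FormalMultilinearSeries.coeff_ofScalars, abs_of_pos hr0] at h2
    refine h2.trans ?_
    gcongr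
    have h3 : ‖∫ θ in 0..2 * Real.pi, ‖f (x * logGen η (circleMap 0 r θ))‖‖ ≤
        M * |2 * Real.pi - 0| := by
      refine intervalIntegral.norm_integral_le_of_norm_le_const fun θ _ => ?_
      rw [norm_norm]
      refine hM _ (hU' _ ?_)
      rw [norm_circleMap_zero, abs_of_pos hr0]
      exact hrR
    have hpi := Real.pi_pos
    rw [sub_zero, abs_of_pos (by positivity)] at h3
    rw [inv_mul_le_iff₀ (by positivity)]
    exact (le_abs_self _).trans (h3.trans (le_of_eq (by ring)))

/-- Partial sums of the re-expanded series are the partial sums of the original one with weights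
`logCdf`. -/
theorem sum_range_logConv (N : ℕ) (g : ℕ → ℂ) :
    ∑ n ∈ Finset.range (N + 1), ∑ k ∈ Finset.range (n + 1), g k * (logConv η k n : ℂ) =
      ∑ k ∈ Finset.range (N + 1), (logCdf η N k : ℂ) * g k := by
  have : ∀ n ∈ Finset.range (N + 1), ∑ k ∈ Finset.range (n + 1), g k * (logConv η k n : ℂ) =
      ∑ k ∈ Finset.range (N + 1), g k * (logConv η k n : ℂ) := by
    intro n hn
    refine Finset.sum_subset (fun k hk => ?_) fun k _ hk => ?_
    · rw [Finset.mem_range] at hn hk ⊢; omega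
    · rw [logConv_eq_zero k n (by simpa using hk)]
      simp
  rw [Finset.sum_congr rfl this, Finset.sum_comm]
  refine Finset.sum_congr rfl fun k _ => ?_
  rw [← Finset.mul_sum, logCdf, mul_comm]
  push_cast
  rfl

/-- If the Taylor series at `0` of functions that are holomorphic near `[0, ρ]` is integrated term
by term and the resulting series converges, then its sum is the integral, even if the Taylor
series diverge on a part of the interval. -/
theorem eq_integral_of_tendsto_moment_series {ρ : ℝ} (hρ : 0 < ρ) {ι : Type*} [Fintype ι]
    {U : Set ℂ} (hU : IsOpen U) (hUρ : ∀ x ∈ Icc 0 ρ, (x : ℂ) ∈ U) {f : ι → ℂ → ℂ}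
    (hf : ∀ u, DifferentiableOn ℂ (f u) U) {h : ι → ℝ → ℂ}
    (hh : ∀ u, IntervalIntegrable (h u) MeasureTheory.volume 0 ρ)
    {p : ι → FormalMultilinearSeries ℂ ℂ ℂ} (hp : ∀ u, HasFPowerSeriesAt (f u) (p u) 0) {l : ℂ}
    (hl : Tendsto (fun N => ∑ k ∈ Finset.range N, ∑ u, (p u).coeff k *
      ∫ x in 0..ρ, (x : ℂ) ^ k * h u x) atTop (𝓝 l)) :
    l = ∑ u, ∫ x in 0..ρ, f u x * h u x := by
  set K : Set ℂ := (fun t : ℝ => (t : ℂ)) '' Icc 0 ρ with hK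
  have hKc : IsCompact K := isCompact_Icc.image Complex.continuous_ofReal
  have hKU : K ⊆ U := by rintro _ ⟨t, ht, rfl⟩; exact hUρ t ht
  obtain ⟨ε, hε, hεU⟩ := hKc.exists_cthickening_subset_open hU hKU
  obtain ⟨η, R, h0, h1, hR1, hηR, hgen⟩ := exists_logGen_mem_thickening hρ hε
  have hth : Metric.thickening ε K ⊆ U := (Metric.thickening_subset_cthickening _ _).trans hεU
  have hb : ∀ u, ∃ M, ∀ z ∈ Metric.cthickening ε K, ‖f u z‖ ≤ M := fun u =>
    hKc.cthickening.exists_bound_of_continuousOn ((hf u).continuousOn.mono hεU)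
  choose M hM using hb
  set r := (1 + R) / 2 with hr
  have hr1 : 1 < r := by linarith
  have hrR : r < R := by linarith
  have key := fun u x (hx : x ∈ Icc 0 ρ) => norm_coeff_comp_logGen_le h0 h1 (hp u)
    (Metric.isOpen_thickening (δ := ε) (E := K)) ((hf u).mono hth) (M := M u)
    (fun z hz => hM u z (Metric.thickening_subset_cthickening _ _ hz)) hr1 hrR hηR
    (fun z hz => hgen z hz x hx)
  -- The weighted Taylor sums: by `key` they converge to `f u x` and are bounded uniformly in `N`
  -- and `x`.
  set S : ι → ℕ → ℝ → ℂ := fun u N x =>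
    ∑ k ∈ Finset.range (N + 1), (logCdf η N k : ℂ) * ((p u).coeff k * (x : ℂ) ^ k) with hS
  have hS' : ∀ u N x, S u N x = ∑ n ∈ Finset.range (N + 1), ∑ k ∈ Finset.range (n + 1),
      (p u).coeff k * (x : ℂ) ^ k * (logConv η k n : ℂ) := fun u N x =>
    (sum_range_logConv N fun k => (p u).coeff k * (x : ℂ) ^ k).symm
  have hSlim : ∀ u, ∀ x ∈ Icc 0 ρ, Tendsto (fun N => S u N x) atTop (𝓝 (f u x)) := by
    intro u x hx
    simp_rw [hS']
    exact (key u x hx).1.tendsto_sum_nat.comp (tendsto_add_atTop_nat 1)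
  have hr0 : 0 ≤ r⁻¹ := by positivity
  have hr1' : r⁻¹ < 1 := inv_lt_one_of_one_lt₀ hr1
  have hSb : ∀ u, ∀ x ∈ Icc 0 ρ, ∀ N, ‖S u N x‖ ≤ M u * (1 - r⁻¹)⁻¹ := by
    intro u x hx N
    have hM0 : 0 ≤ M u := (norm_nonneg _).trans
      (hM u x (Metric.self_subset_cthickening K ⟨x, hx, rfl⟩))
    rw [hS']
    refine (norm_sum_le _ _).trans ((Finset.sum_le_sum fun n _ => (key u x hx).2 n).trans ?_)
    rw [← Finset.mul_sum, ← tsum_geometric_of_lt_one hr0 hr1']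
    exact mul_le_mul_of_nonneg_left
      ((summable_geometric_of_lt_one hr0 hr1').sum_le_tsum _ fun n _ => by positivity) hM0
  have hint : ∀ u, Tendsto (fun N => ∫ x in 0..ρ, S u N x * h u x) atTop
      (𝓝 (∫ x in 0..ρ, f u x * h u x)) := by
    intro u
    have hΙ : ∀ x, x ∈ Set.uIoc 0 ρ → x ∈ Icc 0 ρ := fun x hx => by
      rw [uIoc_of_le hρ.le] at hx
      exact Ioc_subset_Icc_self hx
    refine intervalIntegral.tendsto_integral_filter_of_dominated_convergence
      (fun x => M u * (1 - r⁻¹)⁻¹ * ‖h u x‖) (Eventually.of_forall fun N => ?_)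
      (Eventually.of_forall fun N => Eventually.of_forall fun x hx => ?_)
      ((hh u).norm.const_mul _) (Eventually.of_forall fun x hx =>
        (hSlim u x (hΙ x hx)).mul_const _)
    · refine MeasureTheory.AEStronglyMeasurable.mul ?_ (by
        rw [uIoc_of_le hρ.le]; exact (hh u).1.aestronglyMeasurable)
      refine Continuous.aestronglyMeasurable ?_
      simp only [hS]
      fun_prop
    · rw [norm_mul]
      exact mul_le_mul_of_nonneg_right (hSb u x (hΙ x hx) N) (norm_nonneg _)
  have hsum : ∀ N, ∑ u, ∫ x in 0..ρ, S u N x * h u x =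
      ∑ k ∈ Finset.range (N + 1), (logCdf η N k : ℂ) * ∑ u, (p u).coeff k *
        ∫ x in 0..ρ, (x : ℂ) ^ k * h u x := by
    intro N
    simp_rw [Finset.mul_sum]
    rw [Finset.sum_comm]
    refine Finset.sum_congr rfl fun u _ => ?_
    simp only [hS, Finset.sum_mul]
    rw [intervalIntegral.integral_finsetSum]
    · refine Finset.sum_congr rfl fun k _ => ?_
      rw [← intervalIntegral.integral_const_mul, ← intervalIntegral.integral_const_mul]
      refine intervalIntegral.integral_congr fun x _ => ?_
      ring
    · intro k _
      exact (hh u).continuousOn_mul (by fun_prop)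
  -- The weighted moment sums have two limits: `l` by regularity of the method, and the sum of the
  -- integrals by dominated convergence.
  refine tendsto_nhds_unique (tendsto_weighted_sum (c := logCdf η) logCdf_zero
    (fun N k => logCdf_eq_zero) (logCdf_succ_le h0 h1) (tendsto_logCdf h0 h1) hl) ?_
  simp_rw [← hsum]
  exact tendsto_finsetSum _ fun u _ => hint u

end Summation

/-! ### Riemann–Liouville integrals -/

section FractionalIntegral

open MeasureTheory

/-- The falling factorial `β (β - 1) ⋯ (β - k + 1)`. -/
def fallFact (β : ℝ) (k : ℕ) : ℝ := ∏ r ∈ Finset.range k, (β - r)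

theorem fallFact_zero (β : ℝ) : fallFact β 0 = 1 := by simp [fallFact]

theorem fallFact_succ (β : ℝ) (k : ℕ) : fallFact β (k + 1) = fallFact β k * (β - k) := by
  simp [fallFact, Finset.prod_range_succ]

theorem fallFact_add_one_succ (β : ℝ) (k : ℕ) :
    fallFact (β + 1) (k + 1) = (β + 1) * fallFact β k := by
  rw [fallFact, Finset.prod_range_succ', fallFact, mul_comm]
  congr 1
  · simp
  · exact Finset.prod_congr rfl fun r _ => by push_cast; ring

theorem fallFact_pascal (β : ℝ) (k : ℕ) :
    fallFact (β + 1) (k + 1) = fallFact β (k + 1) + (k + 1) * fallFact β k := by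
  rw [fallFact_add_one_succ, fallFact_succ]
  ring

/-- Used to turn the coefficient `fallFact β k / Γ(k - β)` of a Leibniz term into `(-1) ^ k /
Γ(-β)`, so that all terms share one constant. -/
theorem Gamma_nat_sub {β : ℝ} (hβ : ∀ k : ℕ, β ≠ k) (k : ℕ) :
    Real.Gamma (k - β) = (-1) ^ k * fallFact β k * Real.Gamma (-β) := by
  induction k with
  | zero => simp [fallFact]
  | succ k ih =>
    have h : (k : ℝ) - β ≠ 0 := sub_ne_zero.2 (hβ k).symm
    have h2 : ((k + 1 : ℕ) : ℝ) - β = (k - β) + 1 := by push_cast; ring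
    rw [h2, Real.Gamma_add_one h, ih, fallFact_succ]
    ring

theorem Gamma_neg_ne_zero {β : ℝ} (hβ : ∀ k : ℕ, β ≠ k) : Real.Gamma (-β) ≠ 0 :=
  Real.Gamma_ne_zero fun m => by simpa using hβ m

variable {c b μ : ℝ} {g : ℝ → ℝ}

/-- Truncating both factors turns the fractional integral into a convolution of functions on the
line, for which integrability of the double integrand and Fubini are available. -/
theorem integral_indicator_kernel {r : ℝ} (hr : r ∈ Icc c b) :
    ∫ t, (Ioc c b).indicator g t * (Ioc 0 (b - c)).indicator (fun x => x ^ (μ - 1)) (r - t) =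
      ∫ t in c..r, (r - t) ^ (μ - 1) * g t := by
  rw [intervalIntegral.integral_of_le hr.1, integral_Ioc_eq_integral_Ioo,
    ← integral_indicator measurableSet_Ioo]
  refine integral_congr_ae ?_
  have : ∀ᵐ t : ℝ, t ≠ r := by simp [ae_iff]
  filter_upwards [this] with t ht
  by_cases h1 : t ∈ Ioo c r
  · rw [indicator_of_mem (show t ∈ Ioc c b from ⟨h1.1, h1.2.le.trans hr.2⟩),
      indicator_of_mem
        (show r - t ∈ Ioc 0 (b - c) from ⟨by linarith [h1.2], by linarith [h1.1, hr.2]⟩),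
      indicator_of_mem h1, mul_comm]
  · rw [indicator_of_notMem h1]
    by_cases h2 : c < t
    · have h3 : ¬ t < r := fun h => h1 ⟨h2, h⟩
      rw [indicator_of_notMem (s := Ioc 0 (b - c)) fun h => h3 (by linarith [h.1]), mul_zero]
    · rw [indicator_of_notMem (s := Ioc c b) fun h => h2 h.1, zero_mul]

theorem intervalIntegral_indicator_kernel (hμ : 0 < μ) {t τ : ℝ} (ht : c < t) (hτ : τ ∈ Icc c b) :
    ∫ r in c..τ, (Ioc 0 (b - c)).indicator (fun x => x ^ (μ - 1)) (r - t) =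
      (Ioc c τ).indicator (fun t => (τ - t) ^ μ / μ) t := by
  rw [intervalIntegral.integral_of_le hτ.1, ← integral_indicator measurableSet_Ioc]
  by_cases h1 : t ≤ τ
  · rw [indicator_of_mem (show t ∈ Ioc c τ from ⟨ht, h1⟩)]
    have h2 : (Ioc c τ).indicator
        (fun r => (Ioc 0 (b - c)).indicator (fun x => x ^ (μ - 1)) (r - t)) =
        (Ioc t τ).indicator (fun r => (r - t) ^ (μ - 1)) := by
      funext r
      by_cases h3 : r ∈ Ioc t τ
      · rw [indicator_of_mem h3, indicator_of_mem (show r ∈ Ioc c τ from ⟨ht.trans h3.1, h3.2⟩),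
          indicator_of_mem
            (show r - t ∈ Ioc 0 (b - c) from ⟨by linarith [h3.1], by linarith [h3.2, hτ.2]⟩)]
      · rw [indicator_of_notMem h3]
        by_cases h4 : r ∈ Ioc c τ
        · rw [indicator_of_mem h4, indicator_of_notMem]
          exact fun h => h3 ⟨by linarith [h.1], h4.2⟩
        · rw [indicator_of_notMem h4]
    rw [h2, integral_indicator measurableSet_Ioc, ← intervalIntegral.integral_of_le h1,
      intervalIntegral.integral_comp_sub_right (fun x => x ^ (μ - 1)) t, sub_self,
      integral_rpow (Or.inl (by linarith))]
    simp [Real.zero_rpow hμ.ne']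
  · rw [indicator_of_notMem (fun h => h1 h.2)]
    refine (integral_congr_ae (Eventually.of_forall fun r => ?_)).trans (integral_zero ℝ ℝ)
    by_cases h4 : r ∈ Ioc c τ
    · rw [indicator_of_mem h4, indicator_of_notMem]
      exact fun h => h1 (by linarith [h.1, h4.2])
    · rw [indicator_of_notMem h4]

/-- The semigroup law with the integral of order 1: exchange the integrals and use ∫_t^τ (r -
t)^(μ-1) dr = (τ - t)^μ / μ. -/
theorem fracInt_add_one (hμ : 0 < μ) (hcb : c ≤ b) (hg : IntervalIntegrable g volume c b) :
    IntervalIntegrable (fracInt c μ g) volume c b ∧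
      ∀ τ ∈ Icc c b, fracInt c (μ + 1) g τ = ∫ r in c..τ, fracInt c μ g r := by
  set f : ℝ → ℝ := (Ioc c b).indicator g
  set k : ℝ → ℝ := (Ioc 0 (b - c)).indicator (fun x => x ^ (μ - 1))
  have hf : Integrable f := by
    rw [integrable_indicator_iff measurableSet_Ioc]
    exact (intervalIntegrable_iff_integrableOn_Ioc_of_le hcb).1 hg
  have hk : Integrable k := by
    rw [integrable_indicator_iff measurableSet_Ioc]
    exact (intervalIntegrable_iff_integrableOn_Ioc_of_le (by linarith)).1
      (intervalIntegral.intervalIntegrable_rpow' (by linarith))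
  have hint : Integrable (fun p : ℝ × ℝ => f p.2 * k (p.1 - p.2)) (volume.prod volume) := by
    simpa using hf.convolution_integrand (ContinuousLinearMap.mul ℝ ℝ) hk
  have hconv : ∀ r ∈ Icc c b, fracInt c μ g r = (Real.Gamma μ)⁻¹ * ∫ t, f t * k (r - t) := by
    intro r hr
    rw [fracInt, if_neg hμ.ne', integral_indicator_kernel hr]
  refine ⟨?_, fun τ hτ => ?_⟩
  · have h1 := (hint.integral_prod_left.const_mul (Real.Gamma μ)⁻¹)
    refine (h1.intervalIntegrable (a := c) (b := b)).congr ?_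
    intro r hr
    rw [uIoc_of_le hcb] at hr
    exact (hconv r (Ioc_subset_Icc_self hr)).symm
  · have h1 : ∫ r in c..τ, fracInt c μ g r =
        ∫ r in c..τ, (Real.Gamma μ)⁻¹ * ∫ t, f t * k (r - t) := by
      refine intervalIntegral.integral_congr fun r hr => ?_
      rw [uIcc_of_le hτ.1] at hr
      exact hconv r ⟨hr.1, hr.2.trans hτ.2⟩
    have hint' : Integrable (Function.uncurry fun r t : ℝ => f t * k (r - t))
        ((volume.restrict (Set.uIoc c τ)).prod volume) := by
      have : (volume.restrict (Set.uIoc c τ)).prod (volume : Measure ℝ) =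
          (volume.prod volume).restrict (Set.uIoc c τ ×ˢ univ) := by
        rw [← Measure.prod_restrict, Measure.restrict_univ]
      rw [this]
      exact hint.restrict
    rw [h1, intervalIntegral.integral_const_mul, intervalIntegral_integral_swap hint']
    have h2 : ∀ t, ∫ r in c..τ, f t * k (r - t) =
        (Ioc c τ).indicator (fun t => (τ - t) ^ μ / μ * g t) t := by
      intro t
      rw [intervalIntegral.integral_const_mul]
      by_cases ht : t ∈ Ioc c b
      · rw [intervalIntegral_indicator_kernel hμ ht.1 hτ]
        simp only [f, indicator_of_mem ht]
        by_cases h3 : t ∈ Ioc c τ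
        · rw [indicator_of_mem h3, indicator_of_mem h3, mul_comm]
        · rw [indicator_of_notMem h3, indicator_of_notMem h3, mul_zero]
      · simp only [f, indicator_of_notMem ht]
        rw [indicator_of_notMem fun h => ht ⟨h.1, h.2.trans hτ.2⟩, zero_mul]
    simp_rw [h2]
    rw [integral_indicator measurableSet_Ioc, ← intervalIntegral.integral_of_le hτ.1, fracInt,
      if_neg (by positivity), Real.Gamma_add_one hμ.ne', add_sub_cancel_right,
      ← intervalIntegral.integral_const_mul, ← intervalIntegral.integral_const_mul]
    refine intervalIntegral.integral_congr fun t _ => ?_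
    have := Real.Gamma_pos_of_pos hμ
    field_simp

theorem continuousOn_fracInt_add_one (hμ : 0 < μ) (hcb : c ≤ b)
    (hg : IntervalIntegrable g volume c b) : ContinuousOn (fracInt c (μ + 1) g) (Icc c b) := by
  obtain ⟨h1, h2⟩ := fracInt_add_one hμ hcb hg
  have := intervalIntegral.continuousOn_primitive_interval' h1 left_mem_uIcc
  rw [uIcc_of_le hcb] at this
  exact this.congr h2

theorem hasDerivAt_fracInt_add_one (hμ : 0 < μ) (hg : IntervalIntegrable g volume c b) {τ : ℝ}
    (hτ : τ ∈ Ioo c b) (hc : ∀ᶠ t in 𝓝 τ, ContinuousAt (fracInt c μ g) t) :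
    HasDerivAt (fracInt c (μ + 1) g) (fracInt c μ g τ) τ := by
  have hcb : c ≤ b := (hτ.1.trans hτ.2).le
  obtain ⟨h1, h2⟩ := fracInt_add_one hμ hcb hg
  have h3 : fracInt c (μ + 1) g =ᶠ[𝓝 τ] fun τ => ∫ r in c..τ, fracInt c μ g r := by
    filter_upwards [Ioo_mem_nhds hτ.1 hτ.2] with t ht
    exact h2 t (Ioo_subset_Icc_self ht)
  refine HasDerivAt.congr_of_eventuallyEq ?_ h3
  refine intervalIntegral.integral_hasDerivAt_right (h1.mono_set ?_) ?_ hc.self_of_nhds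
  · rw [uIcc_of_le hcb, uIcc_of_le hτ.1.le]
    exact Icc_subset_Icc_right hτ.2.le
  · obtain ⟨V, hV, hVo, hVτ⟩ := mem_nhds_iff.1 hc
    exact ⟨V, hVo.mem_nhds hVτ,
      (ContinuousOn.aestronglyMeasurable (fun t ht => (hV ht).continuousWithinAt)
        hVo.measurableSet)⟩

/-- The existence of a fractional integral at `b` implies integrability. -/
theorem FracIntExists.intervalIntegrable (hcb : c ≤ b) (hμ : 0 < μ) (hμ1 : μ ≤ 1)
    (h : FracIntExists c μ g b) : IntervalIntegrable g volume c b := by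
  have h := h.resolve_left hμ.ne'
  -- As `μ ≤ 1`, the factor `(b - t) ^ (1 - μ)` is continuous up to `b` and cancels the kernel off
  -- the point `b`.
  have h1 := h.continuousOn_mul (g := fun t => (b - t) ^ (1 - μ))
    ((continuousOn_const.sub continuousOn_id).rpow_const fun t ht => Or.inr (by linarith))
  refine h1.congr_ae ?_
  rw [uIoc_of_le hcb]
  have : ∀ᵐ t : ℝ, t ≠ b := by simp [ae_iff]
  filter_upwards [ae_restrict_of_ae this, ae_restrict_mem measurableSet_Ioc] with t ht ht'
  have h0 : 0 < b - t := by
    have := lt_of_le_of_ne ht'.2 ht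
    linarith
  rw [← mul_assoc, ← Real.rpow_add h0]
  simp

end FractionalIntegral

theorem _root_.ContDiffAt.differentiableAt_iteratedDeriv {𝕜 : Type*}
    [NontriviallyNormedField 𝕜] {f : 𝕜 → 𝕜} {x : 𝕜} {k : WithTop ℕ∞} {j : ℕ}
    (hf : ContDiffAt 𝕜 k f x) (hj : j < k) : DifferentiableAt 𝕜 (iteratedDeriv j f) x := by
  have := ContDiffWithinAt.differentiableWithinAt_iteratedDerivWithin (s := univ) hf hj (by
    simp)
  rwa [iteratedDerivWithin_univ, differentiableWithinAt_univ] at this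

/-! ### Fractional derivatives of consecutive orders -/

section FracDeriv

open MeasureTheory

variable {c b s ν μ : ℝ} {g : ℝ → ℝ}

theorem fracDeriv_neg (hμ : 0 ≤ μ) : fracDeriv c (-μ) g = fracInt c μ g := by
  have : ⌈-μ⌉₊ = 0 := Nat.ceil_eq_zero.2 (by linarith)
  funext s
  simp [fracDeriv, this]

theorem fracDeriv_nat_sub (h0 : 0 ≤ ν) (h1 : ν < 1) (j : ℕ) :
    fracDeriv c (j - ν) g = iteratedDeriv j (fracInt c ν g) := by
  have : ⌈(j : ℝ) - ν⌉₊ = j := by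
    rcases Nat.eq_zero_or_pos j with rfl | hj
    · simpa using h0
    · rw [Nat.ceil_eq_iff hj.ne', Nat.cast_sub hj]
      constructor <;> push_cast <;> linarith
  funext s
  simp [fracDeriv, this]

/-- For `k ≤ N` the order `N - ν - k` comes from ordinary derivatives of the integral of order `ν`,
which is C^m. For `k > N` it is an integral of order above `ν`, differentiated by the fundamental
theorem of calculus. -/
theorem eventually_hasDerivAt_fracDeriv (h0 : 0 < ν) (h1 : ν < 1)
    (hg : IntervalIntegrable g volume c b) (hs : s ∈ Ioo c b) {m : ℕ}
    (hv : ContDiffAt ℝ m (fracInt c ν g) s) {N : ℕ} (hN : N < m) (k : ℕ) :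
    ∀ᶠ τ in 𝓝 s, HasDerivAt (fracDeriv c (N - ν - k) g) (fracDeriv c (N - ν - k + 1) g τ) τ := by
  have hvc : ∀ᶠ τ in 𝓝 s, ContDiffAt ℝ m (fracInt c ν g) τ := hv.eventually (by simp)
  have hcb : c ≤ b := (hs.1.trans hs.2).le
  rcases le_or_gt k N with hk | hk
  · obtain ⟨j, rfl⟩ := Nat.exists_eq_add_of_le' hk
    have e1 : ((j + k : ℕ) : ℝ) - ν - k = j - ν := by push_cast; ring
    have e2 : ((j : ℕ) : ℝ) - ν + 1 = (j + 1 : ℕ) - ν := by push_cast; ring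
    rw [e1, e2, fracDeriv_nat_sub h0.le h1, fracDeriv_nat_sub h0.le h1]
    filter_upwards [hvc] with τ hτ
    rw [iteratedDeriv_succ]
    exact (hτ.differentiableAt_iteratedDeriv (by exact_mod_cast (by omega : j < m))).hasDerivAt
  · obtain ⟨i, rfl⟩ := Nat.exists_eq_add_of_lt hk
    have e1 : (N : ℝ) - ν - (N + i + 1 : ℕ) = -((ν + i) + 1) := by push_cast; ring
    have e2 : -(ν + i + 1) + 1 = -(ν + i) := by ring
    rw [e1, e2, fracDeriv_neg (by positivity), fracDeriv_neg (by positivity)]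
    have hc : ∀ᶠ τ in 𝓝 s, ContinuousAt (fracInt c (ν + i) g) τ := by
      cases i with
      | zero => simpa using hvc.mono fun τ h => h.continuousAt
      | succ i =>
        filter_upwards [Ioo_mem_nhds hs.1 hs.2] with τ hτ
        have := continuousOn_fracInt_add_one (μ := ν + i) (by positivity) hcb hg
        push_cast
        rw [← add_assoc]
        exact this.continuousAt (Icc_mem_nhds hτ.1 hτ.2)
    filter_upwards [hc.eventually_nhds, Ioo_mem_nhds hs.1 hs.2] with τ hτ hτ'
    exact hasDerivAt_fracInt_add_one (by positivity) hg hτ' hτ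

end FracDeriv

/-! ### The Taylor remainder as a function of the expansion point -/

section TaylorRemainder

/-- The remainder of the Taylor expansion of `F t` at `τ`, of order `K`. -/
def taylorR (F : ℝ → ℝ) (K : ℕ) (τ t : ℝ) : ℝ :=
  F t - ∑ k ∈ Finset.range K, taylorC F τ k * (t - τ) ^ k

variable {F : ℝ → ℝ} {U : Set ℝ} {τ t : ℝ}

theorem taylorR_succ (K : ℕ) :
    taylorR F (K + 1) τ t = taylorR F K τ t - taylorC F τ K * (t - τ) ^ K := by
  rw [taylorR, taylorR, Finset.sum_range_succ]
  ring

theorem taylorR_self (K : ℕ) : taylorR F (K + 1) t t = 0 := by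
  rw [taylorR, Finset.sum_range_succ']
  simp [taylorC]

theorem hasDerivAt_taylorC (hF : ContDiffAt ℝ ∞ F τ) (k : ℕ) :
    HasDerivAt (fun τ => taylorC F τ k) ((k + 1) * taylorC F τ (k + 1)) τ := by
  have h1 := (hF.differentiableAt_iteratedDeriv (j := k)
    (by exact_mod_cast WithTop.coe_lt_top _)).hasDerivAt.div_const (k.factorial : ℝ)
  rw [← iteratedDeriv_succ] at h1
  convert! h1 using 1
  rw [taylorC, Nat.factorial_succ]
  have := Nat.factorial_pos k
  push_cast
  field_simp

/-- Differentiation in the expansion point telescopes, leaving a single term. -/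
theorem hasDerivAt_taylorR (hF : ContDiffAt ℝ ∞ F τ) (K : ℕ) :
    HasDerivAt (fun τ => taylorR F K τ t) (-(K * taylorC F τ K * (t - τ) ^ (K - 1))) τ := by
  induction K with
  | zero => simpa [taylorR] using hasDerivAt_const τ (F t)
  | succ K ih =>
    simp_rw [taylorR_succ]
    have h1 : HasDerivAt (fun τ => (t - τ) ^ K) (K * (t - τ) ^ (K - 1) * (-1)) τ :=
      ((hasDerivAt_id τ).const_sub t).pow K
    convert! ih.sub ((hasDerivAt_taylorC hF K).mul h1) using 1
    rw [Nat.add_sub_cancel]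
    push_cast
    ring

theorem continuousOn_taylorC (hU : IsOpen U) (hF : ContDiffOn ℝ ∞ F U) (k : ℕ) :
    ContinuousOn (fun τ => taylorC F τ k) U := fun _ hτ =>
  (hasDerivAt_taylorC (hF.contDiffAt (hU.mem_nhds hτ)) k).continuousAt.continuousWithinAt

/-- The remainder vanishes at `τ = t`, so the mean value inequality in `τ`, with the one-term
derivative, gives the bound; the constant `(K + 1) * C` is not optimal. -/
theorem exists_abs_taylorR_le {c b : ℝ} (hU : IsOpen U) (hcb : Icc c b ⊆ U)
    (hF : ContDiffOn ℝ ∞ F U) (K : ℕ) :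
    ∃ C, 0 ≤ C ∧ (∀ τ ∈ Icc c b, |taylorC F τ (K + 1)| ≤ C) ∧
      ∀ τ ∈ Icc c b, ∀ t ∈ Icc c b, |taylorR F (K + 1) τ t| ≤ (K + 1) * C * |τ - t| ^ (K + 1) := by
  obtain ⟨C, hC⟩ := isCompact_Icc.exists_bound_of_continuousOn
    ((continuousOn_taylorC hU hF (K + 1)).mono hcb)
  refine ⟨max C 0, le_max_right _ _, fun τ hτ => (hC τ hτ).trans (le_max_left _ _),
    fun τ hτ t ht => ?_⟩
  have hsub : uIcc t τ ⊆ Icc c b := ordConnected_Icc.uIcc_subset ht hτ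
  have h := (convex_uIcc t τ).norm_image_sub_le_of_norm_hasDerivWithin_le
    (f := fun τ => taylorR F (K + 1) τ t) (C := (K + 1) * max C 0 * |τ - t| ^ K)
    (fun r hr => (hasDerivAt_taylorR (hF.contDiffAt
      (hU.mem_nhds (hcb (hsub hr)))) (K + 1)).hasDerivWithinAt) (fun r hr => ?_)
    left_mem_uIcc right_mem_uIcc
  · rw [taylorR_self, sub_zero] at h
    calc _ ≤ _ := h
      _ = _ := by rw [Real.norm_eq_abs, pow_succ]; ring
  · rw [norm_neg, norm_mul, norm_mul, Nat.add_sub_cancel, norm_pow]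
    have h1 : ‖t - r‖ ≤ |τ - t| := by
      rw [← norm_neg, neg_sub, Real.norm_eq_abs]
      exact abs_sub_left_of_mem_uIcc hr
    have h2 : ‖((K + 1 : ℕ) : ℝ)‖ = K + 1 := by
      rw [Real.norm_of_nonneg (by positivity)]; push_cast; rfl
    rw [h2]
    gcongr
    exact (hC r (hsub hr)).trans (le_max_left _ _)

end TaylorRemainder

/-! ### Differentiating the remainder integral -/

section Leibniz

open MeasureTheory

/-- The integral kernel of the remainder term in the Leibniz formula. -/
def remKer (F : ℝ → ℝ) (K : ℕ) (β τ : ℝ) : ℝ → ℝ :=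
  (Iio τ).indicator fun t => taylorR F K τ t * (τ - t) ^ (-β - 1)

/-- The derivative of `remKer F (L + 1) β τ t` with respect to `τ`. -/
def remKerDeriv (F : ℝ → ℝ) (L : ℕ) (β τ : ℝ) : ℝ → ℝ :=
  (Iio τ).indicator fun t =>
    -((L + 1) * taylorC F τ (L + 1)) * ((t - τ) ^ L * (τ - t) ^ (-β - 1)) +
      (-β - 1) * (taylorR F (L + 1) τ t * (τ - t) ^ (-β - 2))

variable {F : ℝ → ℝ} {U : Set ℝ} {c b β τ t : ℝ} {L : ℕ} {g : ℝ → ℝ}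

/-- Extending the kernel by 0 beyond `τ` fixes the interval of integration, at the cost of a
possible singularity at `t = τ`. The remainder of order `L + 1` makes the kernel O((τ - t)^(L - β))
there, and `L - β ≥ 2` gives derivative 0 across the diagonal. -/
theorem hasDerivAt_remKer (hU : IsOpen U) (hcb : Icc c b ⊆ U) (hF : ContDiffOn ℝ ∞ F U)
    (hL : β + 2 ≤ L) (hτ : τ ∈ Ioo c b) (ht : t ∈ Icc c b) :
    HasDerivAt (fun τ => remKer F (L + 1) β τ t) (remKerDeriv F L β τ t) τ := by
  rcases lt_trichotomy t τ with h | rfl | h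
  · have h1 : (fun τ => remKer F (L + 1) β τ t) =ᶠ[𝓝 τ]
        fun τ => taylorR F (L + 1) τ t * (τ - t) ^ (-β - 1) := by
      filter_upwards [lt_mem_nhds h] with τ' hτ'
      rw [remKer, indicator_of_mem (by exact hτ')]
    refine HasDerivAt.congr_of_eventuallyEq ?_ h1
    rw [remKerDeriv, indicator_of_mem (by exact h)]
    have h2 := ((hasDerivAt_id τ).sub_const t).rpow_const (p := -β - 1)
      (Or.inl (sub_pos.2 h).ne')
    have h3 := (hasDerivAt_taylorR (t := t)
      (hF.contDiffAt (hU.mem_nhds (hcb (Ioo_subset_Icc_self hτ)))) (L + 1)).mul h2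
    convert! h3 using 1
    rw [Nat.add_sub_cancel, show -β - 1 - 1 = -β - 2 by ring]
    push_cast
    simp only [id_eq]
    ring
  · obtain ⟨C, hC0, -, hC⟩ := exists_abs_taylorR_le hU hcb hF L
    have h0 : remKerDeriv F L β t t = 0 := by simp [remKerDeriv]
    have h1 : remKer F (L + 1) β t t = 0 := by simp [remKer]
    rw [h0]
    have hO : (fun τ => remKer F (L + 1) β τ t) =O[𝓝 t] fun τ => ‖τ - t‖ ^ 2 := by
      refine Asymptotics.IsBigO.of_bound ((L + 1) * C) ?_
      filter_upwards [Ioo_mem_nhds hτ.1 hτ.2, Metric.ball_mem_nhds t one_pos] with x hx hx1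
      rcases lt_or_ge t x with h | h
      · rw [remKer, indicator_of_mem (by exact h), norm_mul]
        have hp : 0 < x - t := sub_pos.2 h
        have h2 := hC x (Ioo_subset_Icc_self hx) t ht
        rw [Real.norm_of_nonneg (Real.rpow_nonneg hp.le _), norm_pow, norm_norm,
          Real.norm_of_nonneg hp.le, Real.norm_eq_abs]
        rw [abs_of_pos hp] at h2
        have h3 : (x - t) ^ (L + 1) * (x - t) ^ (-β - 1) ≤ (x - t) ^ 2 := by
          rw [← Real.rpow_natCast (x - t) (L + 1), ← Real.rpow_add hp,
            ← Real.rpow_natCast (x - t) 2]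
          refine Real.rpow_le_rpow_of_exponent_ge hp ?_ (by push_cast; linarith)
          rw [Metric.mem_ball, Real.dist_eq, abs_of_pos hp] at hx1
          exact hx1.le
        calc _ ≤ (L + 1) * C * (x - t) ^ (L + 1) * (x - t) ^ (-β - 1) := by gcongr
          _ = (L + 1) * C * ((x - t) ^ (L + 1) * (x - t) ^ (-β - 1)) := by ring
          _ ≤ _ := by gcongr
      · rw [remKer, indicator_of_notMem (by simpa using h), norm_zero]
        positivity
    have := (hO.hasFDerivAt (𝕜 := ℝ) one_lt_two).hasDerivAt
    simpa using this
  · have h1 : (fun τ => remKer F (L + 1) β τ t) =ᶠ[𝓝 τ] fun _ => 0 := by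
      filter_upwards [gt_mem_nhds h] with τ' hτ'
      rw [remKer, indicator_of_notMem (by simpa using hτ'.le)]
    refine HasDerivAt.congr_of_eventuallyEq ?_ h1
    rw [remKerDeriv, indicator_of_notMem (by simpa using h.le)]
    exact hasDerivAt_const _ _

theorem exists_abs_remKer_le (hU : IsOpen U) (hcb : Icc c b ⊆ U) (hF : ContDiffOn ℝ ∞ F U)
    (hL : β + 2 ≤ L) : ∃ D, ∀ τ ∈ Icc c b, ∀ t ∈ Icc c b,
      |remKer F (L + 1) β τ t| ≤ D ∧ |remKerDeriv F L β τ t| ≤ D := by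
  obtain ⟨C, hC0, hC1, hC⟩ := exists_abs_taylorR_le hU hcb hF L
  set d : ℝ := b - c
  rcases lt_or_ge b c with hbc | hbc
  · exact ⟨0, fun τ hτ => absurd (hτ.1.trans hτ.2) (not_le.2 hbc)⟩
  have hd : 0 ≤ d := sub_nonneg.2 hbc
  have key : ∀ y : ℝ, 0 < y → y ≤ d → ∀ (k : ℕ) (a : ℝ), 0 ≤ k + a → y ^ k * y ^ a ≤ d ^ (k + a) :=
    fun y hy hyd k a hka => by
      rw [← Real.rpow_natCast, ← Real.rpow_add hy]
      exact Real.rpow_le_rpow hy.le hyd hka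
  refine ⟨(L + 1) * C * d ^ (((L + 1 : ℕ) : ℝ) + (-β - 1)) +
    ((L + 1) * C * d ^ ((L : ℝ) + (-β - 1)) +
      |-β - 1| * ((L + 1) * C * d ^ (((L + 1 : ℕ) : ℝ) + (-β - 2)))), fun τ hτ t ht => ?_⟩
  rcases lt_or_ge t τ with h | h
  · have hp : 0 < τ - t := sub_pos.2 h
    have hpd : τ - t ≤ d := by simp only [d]; linarith [hτ.2, ht.1]
    have h2 := hC τ hτ t ht
    rw [abs_of_pos hp] at h2
    have h3 := key _ hp hpd (L + 1) (-β - 1) (by push_cast; linarith)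
    have h4 := key _ hp hpd L (-β - 1) (by linarith)
    have h5 := key _ hp hpd (L + 1) (-β - 2) (by push_cast; linarith)
    have e1 : |taylorR F (L + 1) τ t * (τ - t) ^ (-β - 1)| ≤
        (L + 1) * C * d ^ (((L + 1 : ℕ) : ℝ) + (-β - 1)) := by
      rw [abs_mul, abs_of_nonneg (Real.rpow_nonneg hp.le _)]
      calc _ ≤ (L + 1) * C * (τ - t) ^ (L + 1) * (τ - t) ^ (-β - 1) := by gcongr
        _ = (L + 1) * C * ((τ - t) ^ (L + 1) * (τ - t) ^ (-β - 1)) := by ring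
        _ ≤ _ := by gcongr
    have e2 : |taylorR F (L + 1) τ t * (τ - t) ^ (-β - 2)| ≤
        (L + 1) * C * d ^ (((L + 1 : ℕ) : ℝ) + (-β - 2)) := by
      rw [abs_mul, abs_of_nonneg (Real.rpow_nonneg hp.le _)]
      calc _ ≤ (L + 1) * C * (τ - t) ^ (L + 1) * (τ - t) ^ (-β - 2) := by gcongr
        _ = (L + 1) * C * ((τ - t) ^ (L + 1) * (τ - t) ^ (-β - 2)) := by ring
        _ ≤ _ := by gcongr
    have e3 : |-((L + 1) * taylorC F τ (L + 1)) * ((t - τ) ^ L * (τ - t) ^ (-β - 1))| ≤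
        (L + 1) * C * d ^ ((L : ℝ) + (-β - 1)) := by
      rw [abs_mul, abs_neg, abs_mul, abs_mul, abs_pow, abs_sub_comm t, abs_of_pos hp,
        abs_of_nonneg (Real.rpow_nonneg hp.le _), abs_of_nonneg (by positivity : (0 : ℝ) ≤ L + 1)]
      gcongr
      exact hC1 τ hτ
    rw [remKer, remKerDeriv, indicator_of_mem (by exact h), indicator_of_mem (by exact h)]
    constructor
    · refine e1.trans (le_add_of_nonneg_right ?_)
      positivity
    · refine (abs_add_le _ _).trans (le_add_of_nonneg_of_le (by positivity) (add_le_add e3 ?_))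
      rw [abs_mul]
      gcongr
  · rw [remKer, remKerDeriv, indicator_of_notMem (by simpa using h),
      indicator_of_notMem (by simpa using h), abs_zero]
    constructor <;> positivity

theorem aestronglyMeasurable_taylorR (hcb : Icc c b ⊆ U) (hF : ContinuousOn F U) (K : ℕ) (τ : ℝ) :
    AEStronglyMeasurable (taylorR F K τ) (volume.restrict (Icc c b)) := by
  refine ContinuousOn.aestronglyMeasurable ?_ measurableSet_Icc
  exact (hF.mono hcb).sub (by fun_prop)

theorem aestronglyMeasurable_remKer (hcb : Icc c b ⊆ U) (hF : ContinuousOn F U) (τ : ℝ) :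
    AEStronglyMeasurable (remKer F (L + 1) β τ) (volume.restrict (Icc c b)) ∧
    AEStronglyMeasurable (remKerDeriv F L β τ) (volume.restrict (Icc c b)) := by
  have h1 := aestronglyMeasurable_taylorR hcb hF (L + 1) τ
  have h2 : ∀ a : ℝ, AEStronglyMeasurable (fun t => (τ - t) ^ a) (volume.restrict (Icc c b)) :=
    fun a => (by fun_prop : Measurable fun t => (τ - t) ^ a).aestronglyMeasurable
  have h3 : AEStronglyMeasurable (fun t => (t - τ) ^ L) (volume.restrict (Icc c b)) :=
    (by fun_prop : Measurable fun t => (t - τ) ^ L).aestronglyMeasurable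
  exact ⟨(h1.mul (h2 _)).indicator measurableSet_Iio,
    (((h3.mul (h2 _)).const_mul _).add ((h1.mul (h2 _)).const_mul _)).indicator measurableSet_Iio⟩

theorem integral_remKer_mul {f : ℝ → ℝ} (hτ : τ ∈ Icc c b) :
    ∫ t in c..b, (Iio τ).indicator f t * g t = ∫ t in c..τ, f t * g t := by
  rw [intervalIntegral.integral_of_le (hτ.1.trans hτ.2), intervalIntegral.integral_of_le hτ.1,
    integral_Ioc_eq_integral_Ioo (y := τ), ← integral_indicator measurableSet_Ioc,
    ← integral_indicator measurableSet_Ioo]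
  congr 1
  funext t
  by_cases h : t < τ
  · by_cases h2 : c < t
    · rw [indicator_of_mem (show t ∈ Ioc c b from ⟨h2, h.le.trans hτ.2⟩),
        indicator_of_mem (show t ∈ Ioo c τ from ⟨h2, h⟩), indicator_of_mem (by exact h)]
    · rw [indicator_of_notMem (fun h3 => h2 h3.1), indicator_of_notMem (fun h3 => h2 h3.1)]
  · rw [indicator_of_notMem (s := Ioo c τ) (fun h3 => h h3.2)]
    by_cases h3 : t ∈ Ioc c b
    · rw [indicator_of_mem h3, indicator_of_notMem (s := Iio τ) h, zero_mul]
    · rw [indicator_of_notMem h3]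

theorem intervalIntegrable_remKer_mul (hU : IsOpen U) (hcb : Icc c b ⊆ U)
    (hF : ContDiffOn ℝ ∞ F U) (hL : β + 2 ≤ L) (hτ : τ ∈ Icc c b)
    (hg : IntervalIntegrable g volume c b) :
    IntervalIntegrable (fun t => remKer F (L + 1) β τ t * g t) volume c b := by
  obtain ⟨D, hD⟩ := exists_abs_remKer_le hU hcb hF hL
  have hsub : Set.uIoc c b ⊆ Icc c b := by
    rw [uIoc_of_le (hτ.1.trans hτ.2)]; exact Ioc_subset_Icc_self
  have hm := aestronglyMeasurable_remKer (L := L) (β := β) hcb hF.continuousOn τ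
  refine (hg.norm.const_mul D).mono_fun
    ((hm.1.mono_measure (Measure.restrict_mono hsub le_rfl)).mul
      hg.aestronglyMeasurable_restrict_uIoc) ?_
  refine (ae_restrict_mem measurableSet_uIoc).mono fun t ht => ?_
  have h2 : ‖remKer F (L + 1) β τ t * g t‖ ≤ ‖D * ‖g t‖‖ := by
    rw [norm_mul, norm_mul, norm_norm]
    exact mul_le_mul_of_nonneg_right ((hD τ hτ t (hsub ht)).1.trans (le_abs_self D))
      (norm_nonneg _)
  exact h2

theorem hasDerivAt_integral_remKer (hU : IsOpen U) (hcb : Icc c b ⊆ U)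
    (hF : ContDiffOn ℝ ∞ F U) (hL : β + 2 ≤ L) (hτ : τ ∈ Ioo c b)
    (hg : IntervalIntegrable g volume c b) :
    IntervalIntegrable (fun t => remKerDeriv F L β τ t * g t) volume c b ∧
    HasDerivAt (fun τ => ∫ t in c..b, remKer F (L + 1) β τ t * g t)
      (∫ t in c..b, remKerDeriv F L β τ t * g t) τ := by
  obtain ⟨D, hD⟩ := exists_abs_remKer_le hU hcb hF hL
  have hsub : Set.uIoc c b ⊆ Icc c b := by
    rw [uIoc_of_le (hτ.1.trans hτ.2).le]; exact Ioc_subset_Icc_self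
  have hgm := hg.aestronglyMeasurable_restrict_uIoc
  have hm := fun τ => aestronglyMeasurable_remKer (L := L) (β := β) hcb hF.continuousOn τ
  refine intervalIntegral.hasDerivAt_integral_of_dominated_loc_of_deriv_le
    (bound := fun t => D * ‖g t‖) (Ioo_mem_nhds hτ.1 hτ.2)
    (Eventually.of_forall fun x => ((hm x).1.mono_measure (Measure.restrict_mono hsub le_rfl)).mul
      hgm) (intervalIntegrable_remKer_mul hU hcb hF hL (Ioo_subset_Icc_self hτ) hg)
    (((hm τ).2.mono_measure (Measure.restrict_mono hsub le_rfl)).mul hgm)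
    (Eventually.of_forall fun t ht x hx => ?_) (hg.norm.const_mul D)
    (Eventually.of_forall fun t ht x hx =>
      (hasDerivAt_remKer hU hcb hF hL hx (hsub ht)).mul_const _)
  rw [norm_mul]
  gcongr
  exact (hD x (Ioo_subset_Icc_self hx) t (hsub ht)).2

end Leibniz

/-! ### The Leibniz formula with remainder -/

section Leibniz

open MeasureTheory

/-- The terms of index less than `K` of the Leibniz series for `d^β (F g) / dτ^β`, with the
remainder in integral form. -/
def leibnizSum (F g : ℝ → ℝ) (c : ℝ) (K : ℕ) (β τ : ℝ) : ℝ :=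
  ∑ k ∈ Finset.range K, fallFact β k * taylorC F τ k * fracDeriv c (β - k) g τ +
    (Real.Gamma (-β))⁻¹ * ∫ t in c..τ, taylorR F K τ t * (τ - t) ^ (-β - 1) * g t

/-- The derivative of a truncated Leibniz sum, rearranged by Pascal's rule for falling factorials.
Truncation leaves the last term, which the derivative of the remainder will cancel. -/
theorem sum_fallFact_pascal (β : ℝ) (a d : ℕ → ℝ) (L : ℕ) :
    ∑ k ∈ Finset.range (L + 1), fallFact β k * ((k + 1) * a (k + 1) * d (k + 1) + a k * d k) =
      ∑ k ∈ Finset.range (L + 1), fallFact (β + 1) k * a k * d k +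
        (L + 1) * fallFact β L * a (L + 1) * d (L + 1) := by
  induction L with
  | zero => simp [fallFact_zero]; ring
  | succ L ih =>
    rw [Finset.sum_range_succ, ih, Finset.sum_range_succ _ (L + 1), fallFact_pascal]
    push_cast
    ring

variable {F : ℝ → ℝ} {U : Set ℝ} {c b β τ t s ν : ℝ} {L : ℕ} {g : ℝ → ℝ}

/-- Separates the kernel of an integral of order `L - β`, which matches the boundary term of the
truncated sum, from the remainder kernel of order `β + 1`. -/
theorem remKerDeriv_eq (F : ℝ → ℝ) (L : ℕ) (β τ t : ℝ) :
    remKerDeriv F L β τ t = -((L + 1) * taylorC F τ (L + 1)) * (-1) ^ L *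
      (Iio τ).indicator (fun t => (τ - t) ^ ((L : ℝ) - β - 1)) t +
      (-β - 1) * remKer F (L + 1) (β + 1) τ t := by
  by_cases h : t < τ
  · rw [remKerDeriv, remKer, indicator_of_mem (by exact h), indicator_of_mem (by exact h),
      indicator_of_mem (by exact h), show -(β + 1) - 1 = -β - 2 by ring]
    have h1 : (t - τ) ^ L * (τ - t) ^ (-β - 1) = (-1) ^ L * (τ - t) ^ ((L : ℝ) - β - 1) := by
      rw [show t - τ = (-1) * (τ - t) by ring, mul_pow, mul_assoc, ← Real.rpow_natCast (τ - t),
        ← Real.rpow_add (sub_pos.2 h)]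
      congr 2
      ring
    rw [h1]
    ring
  · rw [remKerDeriv, remKer, indicator_of_notMem (by exact h), indicator_of_notMem (by exact h),
      indicator_of_notMem (by exact h)]
    ring

/-- The number of terms is kept fixed while the order rises. The bound `β + 3 ≤ L` makes the
remainder kernels of both orders `β` and `β + 1` harmless on the diagonal. -/
theorem hasDerivAt_leibnizSum (hU : IsOpen U) (hcb : Icc c b ⊆ U) (hF : ContDiffOn ℝ ∞ F U)
    (hL : β + 3 ≤ L) (hβ : ∀ k : ℕ, β + 1 ≠ k) (hτ : τ ∈ Ioo c b)
    (hg : IntervalIntegrable g volume c b)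
    (hD : ∀ k ∈ Finset.range (L + 1), HasDerivAt (fracDeriv c (β - k) g)
      (fracDeriv c (β - k + 1) g τ) τ) :
    HasDerivAt (leibnizSum F g c (L + 1) β) (leibnizSum F g c (L + 1) (β + 1) τ) τ := by
  have hFτ := hF.contDiffAt (hU.mem_nhds (hcb (Ioo_subset_Icc_self hτ)))
  obtain ⟨hi, hd⟩ := hasDerivAt_integral_remKer hU hcb hF (by linarith) hτ hg (L := L) (β := β)
  have hi2 := intervalIntegrable_remKer_mul (L := L) (β := β + 1) hU hcb hF (by linarith)
    (Ioo_subset_Icc_self hτ) hg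
  have hΓ : Real.Gamma (-β) = (-β - 1) * Real.Gamma (-(β + 1)) := by
    have h1 : -(β + 1) ≠ 0 := fun h => hβ 0 (by push_cast; linarith)
    rw [show -β = -(β + 1) + 1 by ring, Real.Gamma_add_one h1]
    ring
  have hβ' : ∀ k : ℕ, β ≠ k := fun k h => hβ (k + 1) (by rw [h]; push_cast; ring)
  have hΓ0 := Gamma_neg_ne_zero hβ'
  have hΓ1 := Gamma_neg_ne_zero hβ
  have e1 : ∫ t in c..b, remKerDeriv F L β τ t * g t =
      -((L + 1) * taylorC F τ (L + 1)) * (-1) ^ L *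
        (∫ t in c..τ, (τ - t) ^ ((L : ℝ) - β - 1) * g t) + (-β - 1) *
        ∫ t in c..τ, taylorR F (L + 1) τ t * (τ - t) ^ (-(β + 1) - 1) * g t := by
    rw [← integral_remKer_mul (Ioo_subset_Icc_self hτ), ← integral_remKer_mul
      (f := fun t => taylorR F (L + 1) τ t * (τ - t) ^ (-(β + 1) - 1)) (Ioo_subset_Icc_self hτ)]
    have h3 := intervalIntegral.integral_sub hi (hi2.const_mul (-β - 1))
    rw [← sub_eq_iff_eq_add, ← intervalIntegral.integral_const_mul,
      ← intervalIntegral.integral_const_mul]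
    refine Eq.trans h3.symm (intervalIntegral.integral_congr fun t _ => ?_)
    simp only [remKerDeriv_eq]
    ring
  have e2 : fracDeriv c (β - L) g τ = (Real.Gamma (L - β))⁻¹ *
      ∫ t in c..τ, (τ - t) ^ ((L : ℝ) - β - 1) * g t := by
    rw [show β - L = -(L - β) by ring, fracDeriv_neg (by linarith), fracInt,
      if_neg (by linarith)]
  have hf0 : fallFact β L ≠ 0 := Finset.prod_ne_zero_iff.2 fun r _ => sub_ne_zero.2 (hβ' r)
  have hsum : HasDerivAt (fun τ => ∑ k ∈ Finset.range (L + 1),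
      fallFact β k * taylorC F τ k * fracDeriv c (β - k) g τ)
      (∑ k ∈ Finset.range (L + 1), fallFact β k * ((k + 1) * taylorC F τ (k + 1) *
        fracDeriv c (β + 1 - (k + 1 : ℕ)) g τ + taylorC F τ k *
          fracDeriv c (β + 1 - k) g τ)) τ := by
    refine HasDerivAt.fun_sum fun k hk => ?_
    have h4 := ((hasDerivAt_taylorC hFτ k).const_mul (fallFact β k)).mul (hD k hk)
    convert! h4 using 1
    rw [show β + 1 - (k + 1 : ℕ) = β - k by push_cast; ring,
      show β + 1 - k = β - k + 1 by ring]
    ring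
  have hev : leibnizSum F g c (L + 1) β =ᶠ[𝓝 τ] fun τ => ∑ k ∈ Finset.range (L + 1),
      fallFact β k * taylorC F τ k * fracDeriv c (β - k) g τ +
      (Real.Gamma (-β))⁻¹ * ∫ t in c..b, remKer F (L + 1) β τ t * g t := by
    filter_upwards [Ioo_mem_nhds hτ.1 hτ.2] with x hx
    rw [leibnizSum, ← integral_remKer_mul
      (f := fun t => taylorR F (L + 1) x t * (x - t) ^ (-β - 1)) (Ioo_subset_Icc_self hx)]
    rfl
  refine HasDerivAt.congr_of_eventuallyEq ?_ hev
  convert! hsum.add (hd.const_mul (Real.Gamma (-β))⁻¹) using 1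
  -- By `Gamma_nat_sub` the boundary term of the sum is the opposite of the first part of `e1`, and
  -- `(-β - 1) / Γ(-β) = 1 / Γ(-(β + 1))` gives the remainder of order `β + 1`.
  rw [sum_fallFact_pascal β (fun k => taylorC F τ k) (fun k => fracDeriv c (β + 1 - k) g τ), e1,
    leibnizSum, show β + 1 - (L + 1 : ℕ) = β - L by push_cast; ring, e2,
    Gamma_nat_sub hβ', hΓ]
  have h5 : -β - 1 ≠ 0 := fun h => hβ 0 (by push_cast; linarith)
  have h6 : ((-1 : ℝ) ^ L) * (-1) ^ L = 1 := by rw [← mul_pow]; simp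
  field_simp
  linear_combination ((L + 1) * taylorC F τ (L + 1) *
    ∫ t in c..τ, (τ - t) ^ ((L : ℝ) - β - 1) * g t) * h6

/-- At a negative order every term is an integral against the same kernel `(s - t) ^ (ν - 1)`, and
under the integral sign the Taylor polynomial plus its remainder is `F`. -/
theorem leibnizSum_neg (hν : 0 < ν) (hcs : c ≤ s) (hF : ContinuousOn F (Icc c s)) (K : ℕ)
    (hg : FracIntExists c ν g s) :
    leibnizSum F g c K (-ν) s = fracInt c ν (fun t => F t * g t) s := by
  have hg := hg.resolve_left hν.ne'
  have hν' : ∀ k : ℕ, -ν ≠ k := fun k h => by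
    have : (0 : ℝ) ≤ k := k.cast_nonneg
    linarith
  have hΓ := Gamma_neg_ne_zero hν'
  have hint : ∀ f : ℝ → ℝ, ContinuousOn f (Icc c s) →
      IntervalIntegrable (fun t => f t * ((s - t) ^ (ν - 1) * g t)) volume c s := fun f hf =>
    hg.continuousOn_mul (by rwa [uIcc_of_le hcs])
  have e1 : ∀ k : ℕ, fallFact (-ν) k * taylorC F s k * fracDeriv c (-ν - k) g s =
      (Real.Gamma ν)⁻¹ *
        ∫ t in c..s, taylorC F s k * (t - s) ^ k * ((s - t) ^ (ν - 1) * g t) := by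
    intro k
    rw [show -ν - k = -(k - -ν) by ring, fracDeriv_neg (by rw [sub_neg_eq_add]; positivity),
      fracInt, if_neg (by rw [sub_neg_eq_add]; positivity), Gamma_nat_sub hν', neg_neg]
    have h1 : ∫ t in c..s, taylorC F s k * (t - s) ^ k * ((s - t) ^ (ν - 1) * g t) =
        taylorC F s k * (-1) ^ k * ∫ t in c..s, (s - t) ^ ((k : ℝ) - -ν - 1) * g t := by
      rw [← intervalIntegral.integral_const_mul]
      refine intervalIntegral.integral_congr_ae ?_
      have : ∀ᵐ t : ℝ, t ≠ s := by simp [ae_iff]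
      filter_upwards [this] with t ht ht'
      rw [uIoc_of_le hcs] at ht'
      have h0 : 0 < s - t := sub_pos.2 (lt_of_le_of_ne ht'.2 ht)
      rw [show t - s = (-1) * (s - t) by ring, mul_pow,
        show (k : ℝ) - -ν - 1 = k + (ν - 1) by ring, Real.rpow_add h0, Real.rpow_natCast]
      ring
    rw [h1]
    have hf0 : fallFact (-ν) k ≠ 0 := Finset.prod_ne_zero_iff.2 fun r _ => sub_ne_zero.2 (hν' r)
    have h6 : ((-1 : ℝ) ^ k) ^ 2 = 1 := by rw [← pow_mul, mul_comm, pow_mul]; simp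
    rw [neg_neg] at hΓ
    field_simp
    rw [h6]
    ring
  have e2 : ∫ t in c..s, taylorR F K s t * (s - t) ^ (- -ν - 1) * g t =
      ∫ t in c..s, taylorR F K s t * ((s - t) ^ (ν - 1) * g t) :=
    intervalIntegral.integral_congr fun t _ => by rw [neg_neg, mul_assoc]
  rw [leibnizSum, Finset.sum_congr rfl fun k _ => e1 k, e2, neg_neg, ← Finset.mul_sum, ← mul_add,
    fracInt, if_neg hν.ne', ← intervalIntegral.integral_finsetSum fun k _ =>
      hint (fun t => taylorC F s k * (t - s) ^ k) (by fun_prop),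
    ← intervalIntegral.integral_add]
  · congr 1
    refine intervalIntegral.integral_congr fun t _ => ?_
    simp only [taylorR]
    rw [← Finset.sum_mul, ← add_mul]
    ring
  · have := hint (fun t => ∑ k ∈ Finset.range K, taylorC F s k * (t - s) ^ k) (by fun_prop)
    simpa only [Finset.sum_mul] using this
  · exact hint _ (hF.sub (by fun_prop))

end Leibniz

/-! ### Vanishing of the Leibniz sum of a vanishing combination -/

section Leibniz

open MeasureTheory

variable {ι : Type*} [Fintype ι] {F g : ι → ℝ → ℝ} {U : Set ℝ} {α c b s ν : ℝ}

theorem sum_leibnizSum_neg_eq_zero (hν : 0 < ν) (hcs : c ≤ s)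
    (hF : ∀ u, ContinuousOn (F u) (Icc c s)) (hg : ∀ u, FracIntExists c ν (g u) s)
    (h0 : ∀ t ∈ Icc c s, ∑ u, F u t * g u t = 0) (K : ℕ) :
    ∑ u, leibnizSum (F u) (g u) c K (-ν) s = 0 := by
  have h1 : ∀ u, leibnizSum (F u) (g u) c K (-ν) s =
      (Real.Gamma ν)⁻¹ * ∫ t in c..s, (s - t) ^ (ν - 1) * (F u t * g u t) := fun u => by
    rw [leibnizSum_neg hν hcs (hF u) K (hg u), fracInt, if_neg hν.ne']
  rw [Finset.sum_congr rfl fun u _ => h1 u, ← Finset.mul_sum,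
    ← intervalIntegral.integral_finsetSum]
  · have h2 : ∫ t in c..s, ∑ u, (s - t) ^ (ν - 1) * (F u t * g u t) = ∫ t in c..s, (0 : ℝ) := by
      refine intervalIntegral.integral_congr fun t ht => ?_
      rw [uIcc_of_le hcs] at ht
      simp only [← Finset.mul_sum, h0 t ht, mul_zero]
    rw [h2]
    simp
  · intro u _
    have := ((hg u).resolve_left hν.ne').continuousOn_mul (g := F u)
      (by rw [uIcc_of_le hcs]; exact hF u)
    refine this.congr fun t _ => ?_
    ring

/-- With α = m - ν and 0 < ν < 1 when m > 0, the sum of order `-ν` is an integral of 0 for all end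
points near `s`; m differentiations raise the order to α. For m = 0 nothing needs to be
differentiated. -/
theorem sum_leibnizSum_eq_zero (hcs : c < s) (hα : ∀ k : ℕ, α ≠ k)
    (hU : IsOpen U) (hcU : Icc c s ⊆ U) (hF : ∀ u, ContDiffOn ℝ ∞ (F u) U)
    (hg : ∀ u, FracDerivExists c α (g u) s) (h0 : ∀ t ∈ Icc c s, ∑ u, F u t * g u t = 0)
    (h0' : ∀ᶠ t in 𝓝 s, ∑ u, F u t * g u t = 0) :
    ∑ u, leibnizSum (F u) (g u) c (⌈α⌉₊ + 3) α s = 0 := by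
  obtain ⟨m, hm⟩ : ∃ m, m = ⌈α⌉₊ := ⟨_, rfl⟩
  rw [← hm]
  simp only [FracDerivExists, ← hm] at hg
  have hν : 0 < m - α := sub_pos.2 (lt_of_le_of_ne (hm ▸ Nat.le_ceil α) (hα m))
  rcases Nat.eq_zero_or_pos m with hm0 | hm0
  · subst hm0
    have h1 := sum_leibnizSum_neg_eq_zero hν hcs.le (fun u => (hF u).continuousOn.mono hcU)
      (fun u => (hg u).1) h0 (0 + 3)
    simpa using h1
  obtain ⟨ν, hνd⟩ : ∃ ν, ν = m - α := ⟨_, rfl⟩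
  have hαν : α = m - ν := by linarith
  rw [← hνd] at hν
  simp only [← hνd] at hg
  have hν1 : ν < 1 := by
    have h := (Nat.ceil_eq_iff hm0.ne').1 hm.symm
    rw [Nat.cast_sub hm0] at h
    push_cast at h
    linarith [h.1]
  have hev : ∀ᶠ τ in 𝓝 s, τ ∈ U ∧ (∑ u, F u τ * g u τ = 0) ∧ ∀ u, FracIntExists c ν (g u) τ :=
    (hU.eventually_mem (hcU (right_mem_Icc.2 hcs.le))).and (h0'.and
      (eventually_all.2 fun u => ((hg u).2 hm0).1))
  obtain ⟨ε, hε, hb⟩ := Metric.eventually_nhds_iff_ball.1 hev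
  have hball : ∀ t, t ∈ Icc s (s + ε / 2) → t ∈ Metric.ball s ε := fun t ht => by
    rw [Metric.mem_ball, Real.dist_eq, abs_of_nonneg (by linarith [ht.1])]
    linarith [ht.2]
  -- A point beyond `s` at which the integrals of order `ν` still exist: `s` becomes interior to
  -- `(c, b)`, and the `g u` are integrable up to `b`.
  obtain ⟨b, hbd⟩ : ∃ b, b = s + ε / 2 := ⟨_, rfl⟩
  rw [← hbd] at hball
  have hsb : s < b := by linarith
  have hcbU : Icc c b ⊆ U := fun t ht => (le_total t s).elim (fun h => hcU ⟨ht.1, h⟩)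
    fun h => (hb t (hball t ⟨h, ht.2⟩)).1
  have hzero : ∀ t ∈ Icc c b, ∑ u, F u t * g u t = 0 := fun t ht =>
    (le_total t s).elim (fun h => h0 t ⟨ht.1, h⟩) fun h => (hb t (hball t ⟨h, ht.2⟩)).2.1
  have hint : ∀ u, IntervalIntegrable (g u) volume c b := fun u =>
    ((hb b (hball b ⟨hsb.le, le_rfl⟩)).2.2 u).intervalIntegrable (hcs.trans hsb).le hν hν1.le
  have hαm : ∀ N : ℕ, ∀ k : ℕ, (N : ℝ) - ν ≠ k := fun N k h => by
    have h1 : (k : ℝ) < N := by linarith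
    have h2 : (N : ℝ) < (k + 1 : ℕ) := by push_cast; linarith
    have h1 : k < N := by exact_mod_cast h1
    have h2 : N < k + 1 := by exact_mod_cast h2
    omega
  -- Vanishing on a neighbourhood of `s`, not just at `s`, is what survives differentiation. The `m
  -- + 3` terms satisfy the bound of `hasDerivAt_leibnizSum` at every order reached.
  have key : ∀ N : ℕ, N ≤ m →
      ∀ᶠ τ in 𝓝 s, ∑ u, leibnizSum (F u) (g u) c (m + 3) (N - ν) τ = 0 := by
    intro N
    induction N with
    | zero =>
      intro _
      filter_upwards [Ioo_mem_nhds hcs hsb, hev] with τ hτ hτ'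
      have h1 := sum_leibnizSum_neg_eq_zero hν hτ.1.le
        (fun u => (hF u).continuousOn.mono ((Icc_subset_Icc_right hτ.2.le).trans hcbU))
        hτ'.2.2 (fun t ht => hzero t ⟨ht.1, ht.2.trans hτ.2.le⟩) (m + 3)
      simpa using h1
    | succ N ih =>
      intro hN
      have hD : ∀ᶠ τ in 𝓝 s, ∀ u, ∀ k ∈ Finset.range (m + 3), HasDerivAt
          (fracDeriv c (N - ν - k) (g u)) (fracDeriv c (N - ν - k + 1) (g u) τ) τ :=
        eventually_all.2 fun u => (Filter.eventually_all_finset _).2 fun k _ =>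
          eventually_hasDerivAt_fracDeriv hν hν1 (hint u) ⟨hcs, hsb⟩ ((hg u).2 hm0).2
            (by omega) k
      filter_upwards [(ih (by omega)).eventually_nhds, Ioo_mem_nhds hcs hsb, hD] with τ h1 hτ hD
      have hNm : (N : ℝ) + 1 ≤ m := by exact_mod_cast hN
      have h2 : HasDerivAt (fun τ => ∑ u, leibnizSum (F u) (g u) c (m + 3) (N - ν) τ)
          (∑ u, leibnizSum (F u) (g u) c (m + 3) (N - ν + 1) τ) τ :=
        HasDerivAt.fun_sum fun u _ => hasDerivAt_leibnizSum (L := m + 2) hU hcbU (hF u)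
          (by push_cast; linarith)
          (fun k => by
            have := hαm (N + 1) k
            push_cast at this
            rwa [show (N : ℝ) - ν + 1 = N + 1 - ν by ring]) hτ (hint u) (hD u)
      have h3 := h2.unique ((hasDerivAt_const τ (0 : ℝ)).congr_of_eventuallyEq h1)
      rw [← h3]
      push_cast
      rw [show (N : ℝ) - ν + 1 = N + 1 - ν by ring]
  rw [hαν]
  exact (key m le_rfl).self_of_nhds

end Leibniz

/-! ### Real and complex Taylor expansions -/

section Holomorphic

variable {U : Set ℂ} {f : ℝ → ℝ} {F : ℂ → ℂ}

theorem contDiffOn_of_differentiableOn_complex (hU : IsOpen U) (hF : DifferentiableOn ℂ F U)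
    (hFf : ∀ x : ℝ, (x : ℂ) ∈ U → F x = f x) :
    ContDiffOn ℝ ∞ f ((fun t : ℝ => (t : ℂ)) ⁻¹' U) := by
  have h1 : ContDiffOn ℝ ∞ F U := (hF.contDiffOn hU).restrict_scalars ℝ
  have h2 : ContDiffOn ℝ ∞ (fun x : ℝ => (F x).re) ((fun t : ℝ => (t : ℂ)) ⁻¹' U) :=
    Complex.reCLM.contDiff.comp_contDiffOn
      (h1.comp Complex.ofRealCLM.contDiff.contDiffOn fun x hx => hx)
  exact h2.congr fun x hx => by simp [hFf x hx]

theorem iteratedDeriv_ofReal (hU : IsOpen U) (hF : DifferentiableOn ℂ F U)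
    (hFf : ∀ x : ℝ, (x : ℂ) ∈ U → F x = f x) (k : ℕ) :
    ∀ x : ℝ, (x : ℂ) ∈ U → iteratedDeriv k F x = iteratedDeriv k f x := by
  have hV : IsOpen ((fun t : ℝ => (t : ℂ)) ⁻¹' U) := hU.preimage Complex.continuous_ofReal
  induction k with
  | zero => simpa using hFf
  | succ k ih =>
    intro x hx
    have h1 : DifferentiableAt ℂ (iteratedDeriv k F) x :=
      ((hF.contDiffOn (n := ∞) hU).contDiffAt (hU.mem_nhds hx)).differentiableAt_iteratedDeriv
        (by exact_mod_cast WithTop.coe_lt_top _)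
    have h2 : HasDerivAt (fun y : ℝ => iteratedDeriv k F y) (iteratedDeriv (k + 1) F x) x := by
      rw [iteratedDeriv_succ]
      exact h1.hasDerivAt.comp_ofReal
    have h3 : HasDerivAt (fun y : ℝ => ((iteratedDeriv k f y : ℝ) : ℂ))
        ((iteratedDeriv (k + 1) f x : ℝ) : ℂ) x := by
      rw [iteratedDeriv_succ]
      refine HasDerivAt.ofReal_comp (DifferentiableAt.hasDerivAt ?_)
      exact ((contDiffOn_of_differentiableOn_complex hU hF hFf).contDiffAt
        (hV.mem_nhds hx)).differentiableAt_iteratedDeriv (by exact_mod_cast WithTop.coe_lt_top _)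
    refine h2.unique (h3.congr_of_eventuallyEq ?_)
    filter_upwards [hV.mem_nhds hx] with y hy using ih y hy

/-- Each slope at 0 removes the constant term and divides by `x`. So K slopes give the Taylor
remainder divided by x^K, holomorphic on the same set. -/
theorem pow_mul_iterate_dslope {φ : ℂ → ℂ} {p : FormalMultilinearSeries ℂ ℂ ℂ}
    (hp : HasFPowerSeriesAt φ p 0) (K : ℕ) (x : ℂ) :
    x ^ K * (Function.swap dslope 0)^[K] φ x =
      φ x - ∑ k ∈ Finset.range K, p.coeff k * x ^ k := by
  induction K with
  | zero => simp
  | succ K ih =>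
    have h1 : (Function.swap dslope 0)^[K] φ 0 = p.coeff K := by
      have := (hp.has_fpower_series_iterate_dslope_fslope K).coeff_zero 1
      rw [← this]
      have h2 := FormalMultilinearSeries.coeff_iterate_fslope (p := p) K 0
      rw [zero_add] at h2
      rw [← h2]
      rfl
    have h2 := sub_smul_dslope ((Function.swap dslope 0)^[K] φ) 0 x
    rw [sub_zero, smul_eq_mul, h1] at h2
    rw [Function.iterate_succ_apply', pow_succ, mul_assoc, Function.swap, h2, mul_sub, ih,
      Finset.sum_range_succ]
    ring

theorem differentiableOn_iterate_dslope {φ : ℂ → ℂ} {V : Set ℂ} (hV : V ∈ 𝓝 0)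
    (hφ : DifferentiableOn ℂ φ V) (K : ℕ) :
    DifferentiableOn ℂ ((Function.swap dslope 0)^[K] φ) V := by
  induction K with
  | zero => exact hφ
  | succ K ih =>
    rw [Function.iterate_succ_apply']
    exact (Complex.differentiableOn_dslope hV).2 ih

end Holomorphic

/-! ### The sum of a convergent Leibniz series -/

section SeriesSum

open MeasureTheory

variable {ι : Type*} [Fintype ι] {F g : ι → ℝ → ℝ} {α c s S : ℝ}

theorem eq_sum_leibnizSum_of_tendsto (hcs : c < s) (hα : ∀ k : ℕ, α ≠ k)
    (hF : ∀ u, HolExt c s (F u)) (hg : ∀ u, FracDerivExists c α (g u) s) {K : ℕ}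
    (hK : ⌈α⌉₊ ≤ K)
    (hS : Tendsto (fun N => ∑ k ∈ Finset.range N, ∑ u,
      fallFact α k * taylorC (F u) s k * fracDeriv c (α - k) (g u) s) atTop (𝓝 S)) :
    S = ∑ u, leibnizSum (F u) (g u) c K α s := by
  obtain ⟨ε, hε, FC, hFC, hFCF, -⟩ := HolExt.exists_common hF
  obtain ⟨U, hUd⟩ : ∃ U, U = Metric.thickening ε ((fun t : ℝ => (t : ℂ)) '' Icc c s) := ⟨_, rfl⟩
  rw [← hUd] at hFC hFCF
  have hU : IsOpen U := hUd ▸ Metric.isOpen_thickening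
  have hcU : ∀ t ∈ Icc c s, (t : ℂ) ∈ U := fun t ht =>
    hUd ▸ Metric.self_subset_thickening hε _ (mem_image_of_mem _ ht)
  have hsU : (s : ℂ) ∈ U := hcU s ⟨hcs.le, le_rfl⟩
  have hαK : α < K := lt_of_le_of_ne ((Nat.le_ceil α).trans (by exact_mod_cast hK)) (hα K)
  have hΓ := Gamma_neg_ne_zero hα
  -- the reflected functions
  obtain ⟨φ, hφ⟩ : ∃ φ : ι → ℂ → ℂ, φ = fun u z => FC u (s - z) := ⟨_, rfl⟩
  obtain ⟨V, hVd⟩ : ∃ V : Set ℂ, V = (fun z : ℂ => (s : ℂ) - z) ⁻¹' U := ⟨_, rfl⟩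
  have hV : IsOpen V := hVd ▸ hU.preimage (by fun_prop)
  have h0V : (0 : ℂ) ∈ V := by simpa [hVd] using hsU
  have hφV : ∀ u, DifferentiableOn ℂ (φ u) V := fun u => by
    rw [hφ, hVd]
    exact (hFC u).comp (by fun_prop) fun z hz => hz
  have hp : ∀ u, ∃ p : FormalMultilinearSeries ℂ ℂ ℂ, HasFPowerSeriesAt (φ u) p 0 ∧
      ∀ k, p.coeff k = ((-1) ^ k * taylorC (F u) s k : ℝ) := fun u => by
    refine ⟨_, ((hφV u).analyticOnNhd hV 0 h0V).hasFPowerSeriesAt, fun k => ?_⟩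
    rw [FormalMultilinearSeries.coeff_ofScalars, hφ, iteratedDeriv_comp_const_sub]
    beta_reduce
    rw [sub_zero, iteratedDeriv_ofReal hU (hFC u) (hFCF u) k s hsU, taylorC]
    simp [mul_div_assoc]
  choose p hp hpc using hp
  -- The first K terms are split off because the kernel `x ^ (-α - 1)` may fail to be integrable
  -- against `g`. With the factor `x ^ K`, `K ≥ ⌈α⌉₊`, integrability follows from existence of the
  -- integral of order `⌈α⌉₊ - α`.
  obtain ⟨h, hh⟩ : ∃ h : ι → ℝ → ℝ, h = fun u x => x ^ ((K : ℝ) - α - 1) * g u (s - x) := ⟨_, rfl⟩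
  have hint : ∀ u, IntervalIntegrable (h u) volume 0 (s - c) := by
    intro u
    have hm : 0 < (⌈α⌉₊ : ℝ) - α := sub_pos.2 (lt_of_le_of_ne (Nat.le_ceil α) (hα _))
    have h1 := ((hg u).1.resolve_left hm.ne').comp_sub_left s
    rw [sub_self] at h1
    have h2 := h1.symm.continuousOn_mul (g := fun x => x ^ (K - ⌈α⌉₊)) (by fun_prop)
    refine h2.congr fun x hx => ?_
    rw [uIoc_of_le (by linarith)] at hx
    simp only [hh, sub_sub_cancel]
    rw [← mul_assoc, ← Real.rpow_natCast, ← Real.rpow_add hx.1, Nat.cast_sub hK]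
    congr 2
    ring
  -- Up to the constant `Γ(-α)`, the terms from index `K` on are the moments of `h` times Taylor
  -- coefficients of the reflected function `F u (s - x)`.
  have hterm : ∀ (u : ι) (j : ℕ), Real.Gamma (-α) * (fallFact α (j + K) * taylorC (F u) s (j + K) *
      fracDeriv c (α - (j + K : ℕ)) (g u) s) =
      (-1) ^ (j + K) * taylorC (F u) s (j + K) * ∫ x in 0..(s - c), x ^ j * h u x := by
    intro u j
    have hjK : 0 < ((j + K : ℕ) : ℝ) - α := by
      push_cast
      have : (0 : ℝ) ≤ j := j.cast_nonneg
      linarith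
    have e1 : ∫ t in c..s, (s - t) ^ (((j + K : ℕ) : ℝ) - α - 1) * g u t =
        ∫ x in 0..(s - c), x ^ j * h u x := by
      have := intervalIntegral.integral_comp_sub_left
        (fun t => (s - t) ^ (((j + K : ℕ) : ℝ) - α - 1) * g u t) s (a := 0) (b := s - c)
      rw [sub_zero, sub_sub_cancel] at this
      rw [← this]
      refine intervalIntegral.integral_congr_ae (Eventually.of_forall fun x hx => ?_)
      rw [uIoc_of_le (by linarith)] at hx
      simp only [hh, sub_sub_cancel]
      rw [← mul_assoc, ← Real.rpow_natCast x j, ← Real.rpow_add hx.1]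
      congr 2
      push_cast
      ring
    have hf0 : fallFact α (j + K) ≠ 0 :=
      Finset.prod_ne_zero_iff.2 fun r _ => sub_ne_zero.2 (hα r)
    rw [show α - (j + K : ℕ) = -((j + K : ℕ) - α) by ring, fracDeriv_neg hjK.le, fracInt,
      if_neg hjK.ne', e1, Gamma_nat_sub hα]
    have h6 : ((-1 : ℝ) ^ (j + K)) ^ 2 = 1 := by rw [← pow_mul, mul_comm, pow_mul]; simp
    field_simp
    rw [h6]
    ring
  have hsum := eq_integral_of_tendsto_moment_series (ρ := s - c) (sub_pos.2 hcs) hV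
    (f := fun u => (Function.swap dslope 0)^[K] (φ u)) (h := fun u x => (h u x : ℂ))
    (fun x hx => by
      rw [hVd, mem_preimage, ← Complex.ofReal_sub]
      exact hcU _ ⟨by linarith [hx.2], by linarith [hx.1]⟩)
    (fun u => differentiableOn_iterate_dslope (hV.mem_nhds h0V) (hφV u) K)
    (fun u => ⟨(hint u).1.ofReal, (hint u).2.ofReal⟩)
    (fun u => (hp u).has_fpower_series_iterate_dslope_fslope K)
    (l := ((Real.Gamma (-α) * (S - ∑ k ∈ Finset.range K, ∑ u,
      fallFact α k * taylorC (F u) s k * fracDeriv c (α - k) (g u) s) : ℝ) : ℂ)) (by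
      have h1 := ((hS.comp (tendsto_add_atTop_nat K)).sub_const (∑ k ∈ Finset.range K, ∑ u,
        fallFact α k * taylorC (F u) s k * fracDeriv c (α - k) (g u) s)).const_mul
          (Real.Gamma (-α))
      refine ((Complex.continuous_ofReal.tendsto _).comp h1).congr fun N => ?_
      simp only [Function.comp_apply]
      rw [add_comm N K, Finset.sum_range_add, add_sub_cancel_left, Finset.mul_sum,
        Complex.ofReal_sum]
      refine Finset.sum_congr rfl fun j _ => ?_
      rw [Finset.mul_sum, Complex.ofReal_sum]
      refine Finset.sum_congr rfl fun u _ => ?_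
      rw [add_comm K j, hterm, FormalMultilinearSeries.coeff_iterate_fslope, hpc,
        Complex.ofReal_mul, ← intervalIntegral.integral_ofReal]
      simp)
  have hI : ∀ u, ∫ x in 0..(s - c), (Function.swap dslope 0)^[K] (φ u) (x : ℂ) * (h u x : ℂ) =
      ((∫ t in c..s, taylorR (F u) K s t * (s - t) ^ (-α - 1) * g u t : ℝ) : ℂ) := by
    intro u
    have := intervalIntegral.integral_comp_sub_left
      (fun t => taylorR (F u) K s t * (s - t) ^ (-α - 1) * g u t) s (a := 0) (b := s - c)
    rw [sub_zero, sub_sub_cancel] at this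
    rw [← this, ← intervalIntegral.integral_ofReal]
    refine intervalIntegral.integral_congr_ae (Eventually.of_forall fun x hx => ?_)
    rw [uIoc_of_le (by linarith)] at hx
    have h1 := pow_mul_iterate_dslope (hp u) K x
    have h2 : φ u x - ∑ k ∈ Finset.range K, (p u).coeff k * (x : ℂ) ^ k =
        ((taylorR (F u) K s (s - x) : ℝ) : ℂ) := by
      rw [taylorR, hφ]
      beta_reduce
      rw [← Complex.ofReal_sub, hFCF u (s - x) (hcU _ ⟨by linarith [hx.2],
        by linarith [hx.1]⟩), Complex.ofReal_sub, Complex.ofReal_sum]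
      congr 1
      refine Finset.sum_congr rfl fun k _ => ?_
      rw [hpc, show s - x - s = (-1) * x by ring, mul_pow]
      push_cast
      ring
    rw [h2] at h1
    have h3 : x ^ ((K : ℝ) - α - 1) = x ^ K * x ^ (-α - 1) := by
      rw [← Real.rpow_natCast, ← Real.rpow_add hx.1]
      congr 1
      ring
    simp only [hh, sub_sub_cancel, h3]
    push_cast
    rw [← h1]
    ring
  simp only [hI] at hsum
  rw [← Complex.ofReal_sum, Complex.ofReal_inj] at hsum
  simp only [leibnizSum, Finset.sum_add_distrib]
  rw [← Finset.mul_sum, ← hsum, inv_mul_cancel_left₀ hΓ, Finset.sum_comm]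
  ring

theorem fallFact_natCast (m k : ℕ) : fallFact m k = m.descFactorial k := by
  induction k with
  | zero => simp [fallFact_zero]
  | succ k ih =>
    rw [fallFact_succ, ih, Nat.descFactorial_succ]
    rcases le_or_gt k m with h | h
    · rw [Nat.cast_mul, Nat.cast_sub h, mul_comm]
    · simp [Nat.descFactorial_of_lt h]

/-- Falling factorials of `m` vanish beyond index `m`, so the series is the finite sum of the
ordinary Leibniz rule. -/
theorem eq_zero_of_tendsto_natCast {m : ℕ} (hF : ∀ u, ContDiffAt ℝ ∞ (F u) s)
    (hg : ∀ u, FracDerivExists c m (g u) s) (h0 : ∀ᶠ t in 𝓝 s, ∑ u, F u t * g u t = 0)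
    (hS : Tendsto (fun N => ∑ k ∈ Finset.range N, ∑ u,
      fallFact m k * taylorC (F u) s k * fracDeriv c (m - k) (g u) s) atTop (𝓝 S)) :
    S = 0 := by
  have hI : ∀ u, fracInt c 0 (g u) = g u := fun u => by
    funext t
    simp [fracInt]
  have key : ∑ k ∈ Finset.range (m + 1), ∑ u,
      fallFact m k * taylorC (F u) s k * fracDeriv c (m - k) (g u) s = 0 := by
    rcases Nat.eq_zero_or_pos m with rfl | hm
    · have h1 := fun u => congrFun (fracDeriv_nat_sub (c := c) (g := g u) le_rfl one_pos 0) s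
      simp only [Nat.cast_zero, sub_zero, hI, iteratedDeriv_zero] at h1
      simpa [fallFact_zero, taylorC, h1] using h0.self_of_nhds
    have hF' : ∀ u, ContDiffAt ℝ m (F u) s := fun u => (hF u).of_le (by exact_mod_cast le_top)
    have hg' : ∀ u, ContDiffAt ℝ m (g u) s := fun u => by
      have h1 := ((hg u).2 (by simpa using hm)).2
      rwa [Nat.ceil_natCast, sub_self, hI] at h1
    have h1 : ∀ u, iteratedDeriv m (fun t => F u t * g u t) s = ∑ k ∈ Finset.range (m + 1),
        fallFact m k * taylorC (F u) s k * fracDeriv c (m - k) (g u) s := by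
      intro u
      rw [iteratedDeriv_fun_mul (hF' u) (hg' u)]
      refine Finset.sum_congr rfl fun k hk => ?_
      have hkm : k ≤ m := Nat.lt_succ_iff.1 (Finset.mem_range.1 hk)
      have h3 := fracDeriv_nat_sub (c := c) (g := g u) le_rfl one_pos (m - k)
      rw [sub_zero, hI, Nat.cast_sub hkm] at h3
      rw [h3, fallFact_natCast, Nat.descFactorial_eq_factorial_mul_choose, taylorC]
      have := Nat.factorial_pos k
      push_cast
      field_simp
    rw [Finset.sum_comm, ← Finset.sum_congr rfl fun u _ => h1 u,
      ← iteratedDeriv_fun_sum fun u _ => (hF' u).mul (hg' u),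
      Filter.EventuallyEq.iteratedDeriv_eq m (g := fun _ => (0 : ℝ)) h0]
    simp
  refine tendsto_nhds_unique hS (tendsto_const_nhds.congr' ?_)
  filter_upwards [eventually_ge_atTop (m + 1)] with N hN
  rw [Finset.eventually_constant_sum (fun k hk => ?_) hN, key]
  rw [fallFact_natCast, Nat.descFactorial_of_lt hk]
  simp

theorem eq_zero_of_tendsto (hcs : c < s) (hF : ∀ u, ContDiffAt ℝ ∞ (F u) s)
    (hF' : (∀ k : ℕ, α ≠ k) → ∀ u, HolExt c s (F u))
    (hg : ∀ u, FracDerivExists c α (g u) s)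
    (h0 : ∀ᶠ t in 𝓝 s, ∑ u, F u t * g u t = 0)
    (h0' : (∀ k : ℕ, α ≠ k) → ∀ t ∈ Icc c s, ∑ u, F u t * g u t = 0)
    (hS : Tendsto (fun N => ∑ k ∈ Finset.range N, ∑ u,
      fallFact α k * taylorC (F u) s k * fracDeriv c (α - k) (g u) s) atTop (𝓝 S)) :
    S = 0 := by
  by_cases hα : ∀ k : ℕ, α ≠ k
  · obtain ⟨ε, hε, FC, hFC, hFCF, -⟩ := HolExt.exists_common (hF' hα)
    have hU := Metric.isOpen_thickening (δ := ε) (E := (fun t : ℝ => (t : ℂ)) '' Icc c s)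
    rw [eq_sum_leibnizSum_of_tendsto hcs hα (hF' hα) hg (Nat.le_add_right _ 3) hS]
    exact sum_leibnizSum_eq_zero hcs hα (hU.preimage Complex.continuous_ofReal)
      (fun t ht => Metric.self_subset_thickening hε _ (mem_image_of_mem _ ht))
      (fun u => contDiffOn_of_differentiableOn_complex hU (hFC u) (hFCF u)) hg (h0' hα) h0
  · push Not at hα
    obtain ⟨m, rfl⟩ := hα
    exact eq_zero_of_tendsto_natCast hF hg h0 hS

end SeriesSum

/-- The conditional filter runs over the sets `Iic N`, that is, `range (N + 1)`; hence the shift by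
one. -/
theorem tendsto_sum_range_of_hasSum_conditional {f : ℕ → ℝ} {S : ℝ}
    (h : HasSum f S (SummationFilter.conditional ℕ)) :
    Tendsto (fun N => ∑ k ∈ Finset.range N, f k) atTop (𝓝 S) := by
  rw [HasSum, SummationFilter.conditional_filter_eq_map_Iic, tendsto_map'_iff] at h
  refine (tendsto_add_atTop_iff_nat 1).1 (h.congr fun N => ?_)
  rw [Function.comp_apply]
  congr 1
  ext k
  simp

/-! ### Change of frame for the series -/

section Change

variable {n p q : ℕ} {s a b : ℝ} {G G' : ℝ → Fin n → Fin n → ℝ}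
  {Φ Ψ Φ' Ψ' : ℝ → Matrix (Fin n) (Fin n) ℝ}

theorem sum_tensorKer_mul_sum (X Y X' Y' : Matrix (Fin n) (Fin n) ℝ)
    (f : (Fin p → Fin n) × (Fin q → Fin n) → ℝ) (j : Fin p → Fin n) (i : Fin q → Fin n) :
    ∑ w : (Fin p → Fin n) × (Fin q → Fin n), tensorKer X Y j i w.1 w.2 *
      ∑ z : (Fin p → Fin n) × (Fin q → Fin n), tensorKer X' Y' w.1 w.2 z.1 z.2 * f z =
    ∑ z : (Fin p → Fin n) × (Fin q → Fin n), tensorKer (X * X') (Y' * Y) j i z.1 z.2 * f z := by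
  simp only [Finset.mul_sum]
  rw [Finset.sum_comm]
  refine Finset.sum_congr rfl fun z _ => ?_
  rw [tensorKer_mul, ← Fintype.sum_prod_type', Finset.sum_mul]
  exact Finset.sum_congr rfl fun w _ => by ring

theorem HolExt.tensorKer {c : ℝ} (hΦ : ∀ i j, HolExt c s fun t => Φ t i j)
    (hΨ : ∀ i j, HolExt c s fun t => Ψ t i j) (j : Fin p → Fin n) (i : Fin q → Fin n)
    (u : Fin p → Fin n) (v : Fin q → Fin n) :
    HolExt c s fun t => FracCov.tensorKer (Φ t) (Ψ t) j i u v :=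
  (HolExt.prod fun _ => hΦ _ _).mul (HolExt.prod fun _ => hΨ _ _)

theorem taylorC_const_mul (x : ℝ) (f : ℝ → ℝ) (t : ℝ) (k : ℕ) :
    taylorC (fun t => x * f t) t k = x * taylorC f t k := by
  rw [taylorC, taylorC, iteratedDeriv_const_mul_field, mul_div_assoc]

/-- If two series of components are related by a change of frame, so are their sums. -/
theorem sum_nablaTerm_change {c α : ℝ} (hcs : c < s) (hs : s ∈ Ioo a b)
    (hI : (∀ k : ℕ, α ≠ k) → Icc c s ⊆ Ioo a b)
    (h : IsFrame G s (Ioo a b) Φ Ψ) (h' : IsFrame G' s (Ioo a b) Φ' Ψ')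
    (hG : ∀ i j, ContDiffAt ℝ ∞ (fun t => G t i j) s)
    (hG' : ∀ i j, ContDiffAt ℝ ∞ (fun t => G' t i j) s)
    (hΦ : (∀ k : ℕ, α ≠ k) → ∀ i j, HolExt c s fun t => Φ t i j)
    (hΨ : (∀ k : ℕ, α ≠ k) → ∀ i j, HolExt c s fun t => Ψ t i j)
    (hΦ' : (∀ k : ℕ, α ≠ k) → ∀ i j, HolExt c s fun t => Φ' t i j)
    (hΨ' : (∀ k : ℕ, α ≠ k) → ∀ i j, HolExt c s fun t => Ψ' t i j)
    {A A' : ℝ → (Fin p → Fin n) → (Fin q → Fin n) → ℝ}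
    (hA : ∀ u v, FracDerivExists c α (fun t => A t u v) s)
    (hA' : ∀ u v, FracDerivExists c α (fun t => A' t u v) s)
    {L K : ℝ → Matrix (Fin n) (Fin n) ℝ}
    (hL : ∀ t ∈ Ioo a b, ∀ i j, HasDerivAt (fun τ => L τ i j)
      ((L t * Matrix.of (G' t) - Matrix.of (G t) * L t) i j) t)
    (hK : ∀ t ∈ Ioo a b, K t * L t = 1)
    (hAA' : ∀ t ∈ Ioo a b, ∀ u v, A t u v = ∑ w : (Fin p → Fin n) × (Fin q → Fin n),
      tensorKer (L t) (K t) u v w.1 w.2 * A' t w.1 w.2)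
    (j : Fin p → Fin n) (i : Fin q → Fin n) {S : ℝ} {S' : (Fin p → Fin n) × (Fin q → Fin n) → ℝ}
    (hS : HasSum (nablaTerm c α G A s j i) S (SummationFilter.conditional ℕ))
    (hS' : ∀ w, HasSum (nablaTerm c α G' A' s w.1 w.2) (S' w) (SummationFilter.conditional ℕ)) :
    S = ∑ w : (Fin p → Fin n) × (Fin q → Fin n), tensorKer (L s) (K s) j i w.1 w.2 * S' w := by
  let κ := (Fin p → Fin n) × (Fin q → Fin n)
  -- Both series are merged into one family, the second with the constant coefficients `-tensorKer
  -- (L s) (K s)`. Then `S - Σ …` is the sum of a single Leibniz series; no part of it need converge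
  -- separately in what follows.
  let F : κ ⊕ κ × κ → ℝ → ℝ := Sum.elim
    (fun w t => tensorKer (Φ t) (Ψ t) j i w.1 w.2)
    (fun w t => -tensorKer (L s) (K s) j i w.1.1 w.1.2 *
      tensorKer (Φ' t) (Ψ' t) w.1.1 w.1.2 w.2.1 w.2.2)
  let g : κ ⊕ κ × κ → ℝ → ℝ := Sum.elim (fun w t => A t w.1 w.2) (fun w t => A' t w.2.1 w.2.2)
  have hsplit : ∀ f : κ × κ → ℝ, ∑ w, f w = ∑ x : κ, ∑ y : κ, f (x, y) :=
    fun f => Fintype.sum_prod_type f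
  -- Components in the parallel frames agree up to the constant change `L s`, `K s`: this is ΦL =
  -- L(s)Φ' and KΨ = Ψ'K(s), contracted with `A'`.
  have h0 : ∀ t ∈ Ioo a b, ∑ u, F u t * g u t = 0 := by
    intro t ht
    have e1 := sum_tensorKer_mul_sum (Φ t) (Ψ t) (L t) (K t) (fun z => A' t z.1 z.2) j i
    have e2 := sum_tensorKer_mul_sum (L s) (K s) (Φ' t) (Ψ' t) (fun z => A' t z.1 z.2) j i
    rw [h.mul_left_eq h' hs hL ht, h.mul_right_eq h' hs hL hK ht, ← e2] at e1
    rw [Fintype.sum_sum_type, hsplit]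
    simp only [F, g, Sum.elim_inl, Sum.elim_inr]
    simp only [hAA' t ht]
    rw [e1, ← Finset.sum_add_distrib]
    refine Finset.sum_eq_zero fun w _ => ?_
    rw [Finset.mul_sum, ← Finset.sum_add_distrib]
    exact Finset.sum_eq_zero fun z _ => by ring
  rw [← sub_eq_zero]
  refine eq_zero_of_tendsto (F := F) (g := g) (α := α) hcs ?_ ?_ ?_ ?_ ?_ ?_
  · rintro (w | w)
    · exact h.contDiffAt_tensorKer hs hG _ _ _ _
    · exact contDiffAt_const.mul (h'.contDiffAt_tensorKer hs hG' _ _ _ _)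
  · rintro hα (w | w)
    · exact HolExt.tensorKer (hΦ hα) (hΨ hα) _ _ _ _
    · exact (HolExt.const _).mul (HolExt.tensorKer (hΦ' hα) (hΨ' hα) _ _ _ _)
  · rintro (w | w)
    · exact hA _ _
    · exact hA' _ _
  · filter_upwards [isOpen_Ioo.mem_nhds hs] with t ht using h0 t ht
  · exact fun hα t ht => h0 t (hI hα ht)
  · have h1 := (tendsto_sum_range_of_hasSum_conditional hS).sub
      (tendsto_finsetSum Finset.univ fun w _ =>
        (tendsto_sum_range_of_hasSum_conditional (hS' w)).const_mul
          (tensorKer (L s) (K s) j i w.1 w.2))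
    refine h1.congr fun N => ?_
    simp only [Finset.mul_sum]
    rw [Finset.sum_comm, ← Finset.sum_sub_distrib]
    refine Finset.sum_congr rfl fun k _ => ?_
    rw [Fintype.sum_sum_type, hsplit]
    simp only [F, g, Sum.elim_inl, Sum.elim_inr, taylorC_const_mul]
    simp only [h.nablaTerm_eq hs hG, h'.nablaTerm_eq hs hG']
    rw [sub_eq_add_neg, ← Finset.sum_neg_distrib]
    congr 1
    · rw [Fintype.sum_prod_type]
      rfl
    · refine Finset.sum_congr rfl fun w _ => ?_
      rw [Fintype.sum_prod_type, ← neg_mul, Finset.mul_sum]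
      refine Finset.sum_congr rfl fun u _ => ?_
      rw [Finset.mul_sum]
      refine Finset.sum_congr rfl fun v _ => ?_
      rw [fallFact]
      ring

end Change

/-! ### Tensors with prescribed components -/

section Components

variable {n : ℕ} {M : Type*} [TopologicalSpace M] [ChartedSpace (EuclideanSpace ℝ (Fin n)) M]
  {p q : ℕ} {e : OpenPartialHomeomorph M (EuclideanSpace ℝ (Fin n))}

/-- The tensor is the combination of products of coordinate vectors and covectors with coefficients
`b`; duality of the two bases picks out each coefficient. -/
theorem exists_tensorAt_of_components (he : e ∈ IsManifold.maximalAtlas (𝓡 n) ∞ M) {x : M}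
    (hx : x ∈ e.source) (b : (Fin p → Fin n) → (Fin q → Fin n) → ℝ) :
    ∃ B : TensorAt n p q x, ∀ j i, tensorComp e B j i = b j i := by
  let V (i : Fin q → Fin n) : MultilinearMap ℝ (fun _ : Fin q => TangentSpace (𝓡 n) x) ℝ :=
    (MultilinearMap.mkPiAlgebra ℝ (Fin q) ℝ).compLinearMap
      fun k => (coordCovec e (i k) x).toLinearMap
  let W (j : Fin p → Fin n) : MultilinearMap ℝ
      (fun _ : Fin p => (TangentSpace (𝓡 n) x →L[ℝ] ℝ)) ℝ :=
    (MultilinearMap.mkPiAlgebra ℝ (Fin p) ℝ).compLinearMap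
      fun k => { toFun := fun θ => θ (coordVec e (j k) x), map_add' := fun _ _ => rfl,
                 map_smul' := fun _ _ => rfl }
  refine ⟨∑ j, ∑ i, (W j).smulRight (b j i • V i), fun j i => ?_⟩
  have h1 : ∀ {r : ℕ} (f g : Fin r → Fin n),
      ∏ k, coordCovec e (f k) x (coordVec e (g k) x) = if f = g then 1 else 0 := fun f g => by
    simp only [coordCovec_coordVec_self he hx, Finset.prod_ite_zero, Finset.prod_const_one,
      Finset.mem_univ, true_imp_iff, funext_iff]
  have h2 : ∀ j', W j' (fun k => coordCovec e (j k) x) = if j = j' then 1 else 0 := fun j' => by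
    rw [← h1]
    simp [W]
  have h3 : ∀ i', V i' (fun k => coordVec e (i k) x) = if i' = i then 1 else 0 := fun i' => by
    rw [← h1]
    simp [V]
  simp only [tensorComp, sum_apply, MultilinearMap.smulRight_apply, smul_apply, h2, h3]
  simp

end Components

/-! ### Transformation law on the manifold -/

section Manifold

variable {n : ℕ} {M : Type*} [TopologicalSpace M] [ChartedSpace (EuclideanSpace ℝ (Fin n)) M]
  [IsManifold (𝓡 n) ∞ M] {cov : CovariantDerivative (𝓡 n) (EuclideanSpace ℝ (Fin n))
      (TangentSpace (𝓡 n) : M → Type _)} {γ : ℝ → M} {c s α : ℝ} {p q : ℕ}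
  {A : ∀ t : ℝ, TensorAt n p q (γ t)} {e e' : OpenPartialHomeomorph M (EuclideanSpace ℝ (Fin n))}

/-- For fractional α the frame must exist and extend holomorphically along the whole arc. For
natural α only derivatives at `s` enter, so a local smooth frame suffices. -/
theorem IsAdmissible.exists_isFrame (hcs : c ≤ s) (he : IsAdmissible cov γ A c α s e) :
    ∃ a b Φ Ψ, a < s ∧ ((∀ k : ℕ, α ≠ k) → a < c) ∧ s < b ∧
      IsFrame (connAlong cov γ e) s (Ioo a b) Φ Ψ ∧
      ((∀ k : ℕ, α ≠ k) → ∀ i j, HolExt c s fun t => Φ t i j) ∧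
      ((∀ k : ℕ, α ≠ k) → ∀ i j, HolExt c s fun t => Ψ t i j) := by
  by_cases hα : ∀ k : ℕ, α ≠ k
  · obtain ⟨a, b, Φ, Ψ, ha, hb, h, h1, h2⟩ := exists_isFrame_of_holExt hcs fun i j =>
      HolExt.of_analyticOnNhd (he.conn_analytic hα i j)
    exact ⟨a, b, Φ, Ψ, ha.trans_le hcs, fun _ => ha, hb, h, fun _ => h1, fun _ => h2⟩
  · obtain ⟨a, b, Φ, Ψ, ha, hb, h⟩ := exists_isFrame_of_contDiffAt he.conn_smooth
    exact ⟨a, b, Φ, Ψ, ha, fun h => absurd h hα, hb, h, fun h => absurd h hα,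
      fun h => absurd h hα⟩

theorem exists_Ioo_of_eventually {P : ℝ → Prop} (hcs : c ≤ s)
    (hP : ∀ t ∈ Icc c s, ∀ᶠ τ in 𝓝 t, P τ) : ∃ a b, a < c ∧ s < b ∧ ∀ t ∈ Ioo a b, P t := by
  obtain ⟨a, a', ⟨ha, ha'⟩, h1⟩ := mem_nhds_iff_exists_Ioo_subset.1 (hP c (left_mem_Icc.2 hcs))
  obtain ⟨b', b, ⟨hb', hb⟩, h2⟩ := mem_nhds_iff_exists_Ioo_subset.1 (hP s (right_mem_Icc.2 hcs))
  refine ⟨a, b, ha, hb, fun t ht => ?_⟩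
  rcases lt_or_ge t c with h | h
  · exact h1 ⟨ht.1, h.trans ha'⟩
  rcases lt_or_ge s t with h' | h'
  · exact h2 ⟨hb'.trans h', ht.2⟩
  exact (hP t ⟨h, h'⟩).self_of_nhds

theorem nablaChart_change (hcs : c < s)
    (hγ : ∀ t ∈ Icc c s, ContMDiffAt 𝓘(ℝ, ℝ) (𝓡 n) ∞ γ t)
    (he : IsAdmissible cov γ A c α s e) (he' : IsAdmissible cov γ A c α s e')
    (j : Fin p → Fin n) (i : Fin q → Fin n) :
    nablaChart cov γ A c α s e j i = ∑ r : Fin p → Fin n, ∑ a : Fin q → Fin n,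
      (∏ k, partialCoord e e' (γ s) (j k) (r k)) * (∏ k, partialCoord e' e (γ s) (a k) (i k)) *
        nablaChart cov γ A c α s e' r a := by
  have : IsManifold (𝓡 n) 1 M := IsManifold.of_le (n := ∞) (by simp)
  obtain ⟨a₀, b₀, ha₀, hb₀, hgood⟩ := exists_Ioo_of_eventually (P := fun t =>
      MDifferentiableAt 𝓘(ℝ, ℝ) (𝓡 n) γ t ∧ γ t ∈ e.source ∧ γ t ∈ e'.source) hcs.le (by
    intro t ht
    have h1 : ContMDiffAt 𝓘(ℝ, ℝ) (𝓡 n) 1 γ t := (hγ t ht).of_le (by simp)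
    have h2 := (contMDiffAt_iff_contMDiffAt_nhds (by simp)).1 h1
    filter_upwards [h2, (hγ t ht).continuousAt (e.open_source.mem_nhds (he.arc_mem t ht)),
      (hγ t ht).continuousAt (e'.open_source.mem_nhds (he'.arc_mem t ht))] with τ h3 h4 h5
    exact ⟨h3.mdifferentiableAt one_ne_zero, h4, h5⟩)
  obtain ⟨a₁, b₁, Φ, Ψ, ha₁, hac₁, hb₁, h, hΦ, hΨ⟩ := he.exists_isFrame hcs.le
  obtain ⟨a₂, b₂, Φ', Ψ', ha₂, hac₂, hb₂, h', hΦ', hΨ'⟩ := he'.exists_isFrame hcs.le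
  obtain ⟨a, ha⟩ : ∃ a, a = max a₀ (max a₁ a₂) := ⟨_, rfl⟩
  obtain ⟨b, hb⟩ : ∃ b, b = min b₀ (min b₁ b₂) := ⟨_, rfl⟩
  have hs : s ∈ Ioo a b := by
    rw [ha, hb]
    exact ⟨max_lt (ha₀.trans hcs) (max_lt ha₁ ha₂), lt_min hb₀ (lt_min hb₁ hb₂)⟩
  have hI : (∀ k : ℕ, α ≠ k) → Icc c s ⊆ Ioo a b := fun hα t ht =>
    ⟨lt_of_lt_of_le (ha ▸ max_lt ha₀ (max_lt (hac₁ hα) (hac₂ hα))) ht.1, ht.2.trans_lt hs.2⟩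
  have hgood : ∀ t ∈ Ioo a b, MDifferentiableAt 𝓘(ℝ, ℝ) (𝓡 n) γ t ∧ γ t ∈ e.source ∧
      γ t ∈ e'.source := fun t ht => hgood t
    ⟨lt_of_le_of_lt (ha ▸ le_max_left _ _) ht.1, lt_of_lt_of_le ht.2 (hb ▸ min_le_left _ _)⟩
  have h := h.mono (a' := a) (b' := b) (ha ▸ (le_max_left _ _).trans (le_max_right _ _))
    (hb ▸ (min_le_right _ _).trans (min_le_left _ _))
  have h' := h'.mono (a' := a) (b' := b) (ha ▸ (le_max_right _ _).trans (le_max_right _ _))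
    (hb ▸ (min_le_right _ _).trans (min_le_right _ _))
  have key := sum_nablaTerm_change hcs hs hI h h' he.conn_smooth he'.conn_smooth hΦ hΨ hΦ' hΨ'
    he.fracDeriv_exists he'.fracDeriv_exists
    (L := fun t => Matrix.of (partialCoord e e' (γ t)))
    (K := fun t => Matrix.of (partialCoord e' e (γ t)))
    (fun t ht i j => by
      obtain ⟨h1, h2, h3⟩ := hgood t ht
      simpa [Matrix.mul_apply] using
        hasDerivAt_partialCoord_connAlong cov he.mem_atlas he'.mem_atlas h2 h3 h1 i j)
    (fun t ht => by
      obtain ⟨-, h2, h3⟩ := hgood t ht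
      ext i j
      simpa [Matrix.mul_apply, Matrix.one_apply] using
        sum_partialCoord_mul he'.mem_atlas he.mem_atlas h3 h2 i j)
    (fun t ht u v => by
      obtain ⟨-, h2, h3⟩ := hgood t ht
      rw [tensorComp_change he.mem_atlas he'.mem_atlas h2 h3, ← Fintype.sum_prod_type']
      rfl)
    j i (he.series_converges j i).hasSum (fun w => (he'.series_converges w.1 w.2).hasSum)
  rw [nablaChart, nablaFrac, key, Fintype.sum_prod_type]
  rfl

end Manifold

end FracCov

end

open FracCov in
theorem mainTheorem3 {n : ℕ} {M : Type*} [TopologicalSpace M]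
    [ChartedSpace (EuclideanSpace ℝ (Fin n)) M] [IsManifold (𝓡 n) ∞ M]
    (cov : CovariantDerivative (𝓡 n) (EuclideanSpace ℝ (Fin n))
      (TangentSpace (𝓡 n) : M → Type _))
    (γ : ℝ → M) (c s : ℝ) (hcs : c < s)
    (hγ : ∀ t ∈ Icc c s, ContMDiffAt 𝓘(ℝ, ℝ) (𝓡 n) ∞ γ t)
    (p q : ℕ) (A : ∀ t : ℝ, TensorAt n p q (γ t)) (α : ℝ) :
    (∀ e e' : OpenPartialHomeomorph M (EuclideanSpace ℝ (Fin n)),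
      IsAdmissible cov γ A c α s e → IsAdmissible cov γ A c α s e' →
      ∀ (j : Fin p → Fin n) (i : Fin q → Fin n),
        nablaChart cov γ A c α s e j i =
          ∑ r : Fin p → Fin n, ∑ a : Fin q → Fin n,
            (∏ k, partialCoord e e' (γ s) (j k) (r k)) *
            (∏ k, partialCoord e' e (γ s) (a k) (i k)) *
            nablaChart cov γ A c α s e' r a) ∧
    ∃ B : TensorAt n p q (γ s),
      ∀ e : OpenPartialHomeomorph M (EuclideanSpace ℝ (Fin n)),
        IsAdmissible cov γ A c α s e →
        ∀ (j : Fin p → Fin n) (i : Fin q → Fin n),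
          tensorComp e B j i = nablaChart cov γ A c α s e j i := by
  refine ⟨fun e e' he he' j i => nablaChart_change hcs hγ he he' j i, ?_⟩
  by_cases h : ∃ e : OpenPartialHomeomorph M (EuclideanSpace ℝ (Fin n)),
      IsAdmissible cov γ A c α s e
  · obtain ⟨e', he'⟩ := h
    have hs : s ∈ Icc c s := right_mem_Icc.2 hcs.le
    obtain ⟨B, hB⟩ := exists_tensorAt_of_components he'.mem_atlas (he'.arc_mem s hs)
      (nablaChart cov γ A c α s e')
    refine ⟨B, fun e he j i => ?_⟩
    rw [tensorComp_change he.mem_atlas he'.mem_atlas (he.arc_mem s hs) (he'.arc_mem s hs),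
      nablaChart_change hcs hγ he he']
    simp only [hB]
  -- Without admissible charts the condition on `B` is vacuous.
  · exact ⟨0, fun e he => absurd ⟨e, he⟩ h⟩
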